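/- **Setting.** Let $A=(a_{ij})_{i,j\in I}$ be a generalized Cartan matrix ($I$ finite, $a_{ii}=2$, $a_{ij}\in\mathbb Z_{\le 0}$ for $i\ne j$, and $a_{ij}=0\Rightarrow a_{ji}=0$). Let $\mathfrak h$ be a vector space of dimension $2|I|-\operatorname{rk}A$ over a field of characteristic $0$, with linearly independent simple roots $\alpha_i\in\mathfrak h^*$ and linearly independent simple coroots $\alpha_i^\vee\in\mathfrak h$ such that $\alpha_j(\alpha_i^\vee)=a_{ij}$. Let $W\subset GL(\mathfrak h^*)$ be the Weyl group generated by the reflections $s_i(\varphi)=\varphi-\varphi(\alpha_i^\vee)\alpha_i$, let $m_{ij}\in\mathbb N\cup\{\infty\}$ be the order of $s_is_j$, and let $\Phi^{re}=\{w(\alpha_i)\mid w\in W,\ i\in I\}$ be the set of real roots. For $\alpha=w(\alpha_i)\in\Phi^{re}$ put $s_\alpha=ws_iw^{-1}$. Let $\Lambda\subset\mathfrak h^*$ be a formal Demazure lattice, i.e. a finitely generated free subgroup such that every simple root can be extended to a $\mathbb Z$-basis of $\Lambda$ and $\langle\Lambda,\alpha_i^\vee\rangle\subset\mathbb Z$ for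 all $i\in I$. Let $R$ be a commutative unital ring, $\mu_1,\mu_2\in R$, and let $F(u,v)=\frac{u+v-\mu_1uv}{1+\mu_2uv}\in R[\![u,v]\!]$ be the hyperbolic formal group law. The formal group algebra $R[\![\Lambda]\!]_F$ is the completion of $R[x_\lambda]_{\lambda\in\Lambda}$ at the kernel of $x_\lambda\mapsto 0$, modulo the closure of the ideal generated by $x_0$ and all $x_{\lambda+\lambda'}-F(x_\lambda,x_{\lambda'})$; $W$ acts on it by $w(x_\lambda)=x_{w(\lambda)}$. Let $Q^F$ be its localization at the multiplicative subset generated by the $x_\alpha$, $\alpha\in\Phi^{re}$, and let $Q^F_W$ be the twisted formal group algebra: the right $Q^F$-module with basis $(\delta_w)_{w\in W}$ and multiplication $(\delta_{w'}\psi')(\delta_w\psi)=\delta_{w'w}\,w^{-1}(\psi')\psi$. For $\alpha\in\Phi^{re}$ and $\gamma\in R[\![\Lambda]\!]_F$ put $\Delta_\alpha(\gamma)=\frac{\gamma-s_\alpha(\gamma)}{x_\alpha}$ and $X_\alpha=\frac1{x_\alpha}(1-\delta_{s_\alpha})\in Q_W^F$, and write $X_i=X_{\alpha_i}$. The formal Demazure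 algebra $D_F$ is the $R$-subalgebra of $Q^F_W$ generated by all $X_\alpha$, $\alpha\in\Phi^{re}$, and the formal affine Demazure algebra $\mathbf D_F$ is the $R$-subalgebra generated by $R[\![\Lambda]\!]_F$ and $D_F$. **Proposition.** The reflection $s_\alpha$ depends only on $\alpha\in\Phi^{re}$, the element $x_\alpha$ is not a zero divisor in $R[\![\Lambda]\!]_F$, and $\gamma-s_\alpha(\gamma)$ is divisible by $x_\alpha$ for all $\gamma\in R[\![\Lambda]\!]_F$, so that $\Delta_\alpha(\gamma)\in R[\![\Lambda]\!]_F$ is well defined. The algebra $\mathbf D_F$ is generated as an $R$-algebra by the elements of $R[\![\Lambda]\!]_F$ and the $X_i$, $i\in I$, and the following relations hold: * $\gamma X_\alpha=X_\alpha s_\alpha(\gamma)+\Delta_\alpha(\gamma)$ for all $\alpha\in\Phi^{re}$ and $\gamma\in R[\![\Lambda]\!]_F$; * $X_i^2=\mu_1X_i$ for all $i\in I$; * $X_iX_j=X_jX_i$ if $m_{ij}=2$; * $X_jX_iX_j-X_iX_jX_i=\mu_2(X_i-X_j)$ if $m_{ij}=3$; * $(X_jX_i)^2-(X_iX_j)^2=2\mu_2(X_iX_j-X_jX_i)$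 if $m_{ij}=4$; * $(X_jX_i)^3-(X_iX_j)^3=4\mu_2\big((X_iX_j)^2-(X_jX_i)^2\big)+3\mu_2^2(X_iX_j-X_jX_i)$ if $m_{ij}=6$. These relations are complete, with no relation between $X_i$ and $X_j$ imposed when $m_{ij}=\infty$: the natural map to $\mathbf D_F$ from the $R$-algebra presented by generators $\gamma\in R[\![\Lambda]\!]_F$ and $X_i$ ($i\in I$), subject to the relations of the $R$-algebra $R[\![\Lambda]\!]_F$ and the relations above (the first one only for the simple roots $\alpha=\alpha_i$), is an isomorphism of $R$-algebras. -/

import Mathlib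

noncomputable section

namespace HyperbolicDemazure

section Hyperbolic
open MvPowerSeries

variable {R : Type*} [CommRing R]

/-- The denominator `1 + μ₂ u v` as a power series in two variables. -/
def hyperbolicDenom (μ₂ : R) : MvPowerSeries (Fin 2) R := 1 + C μ₂ * X 0 * X 1

/-- The power series `(u + v - μ₁ u v) / (1 + μ₂ u v)`; the second factor is the inverse of the
power series `1 + μ₂ u v`, whose constant coefficient is `1`. -/
def hyperbolicSeries (μ₁ μ₂ : R) : MvPowerSeries (Fin 2) R :=
  (X 0 + X 1 - C μ₁ * X 0 * X 1) * invOfUnit (hyperbolicDenom μ₂) 1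

lemma hyperbolicDenom_mul_series (μ₁ μ₂ : R) :
    hyperbolicDenom μ₂ * hyperbolicSeries μ₁ μ₂ = X 0 + X 1 - C μ₁ * X 0 * X 1 := by
  have h : hyperbolicDenom μ₂ * invOfUnit (hyperbolicDenom μ₂) 1 = 1 :=
    mul_invOfUnit _ _ (by simp [hyperbolicDenom])
  rw [hyperbolicSeries, mul_left_comm, h, mul_one]

lemma constantCoeff_hyperbolicSeries (μ₁ μ₂ : R) :
    constantCoeff (hyperbolicSeries μ₁ μ₂) = 0 := by
  simp [hyperbolicSeries]

lemma hyperbolicSeries_subst {σ : Type*} (μ₁ μ₂ : R) {f g : MvPowerSeries σ R}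
    (h : HasSubst ![f, g]) :
    (1 + C μ₂ * f * g) * (hyperbolicSeries μ₁ μ₂).subst ![f, g] = f + g - C μ₁ * f * g := by
  have e := congrArg (substAlgHom h) (hyperbolicDenom_mul_series μ₁ μ₂)
  have hC : ∀ r : R, substAlgHom h (C r) = C r := fun r => (substAlgHom h).commutes r
  simp only [hyperbolicDenom, map_mul, map_add, map_sub, map_one, hC, substAlgHom_X,
    Matrix.cons_val_zero, Matrix.cons_val_one] at e
  rw [← coe_substAlgHom h]
  exact e

lemma coeff_single_hyperbolicSeries (μ₁ μ₂ : R) (i : Fin 2) :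
    coeff (Finsupp.single i 1) (hyperbolicSeries μ₁ μ₂) = 1 := by
  have h : hyperbolicSeries μ₁ μ₂ = X 0 + X 1 +
      monomial (Finsupp.single 0 1 + Finsupp.single 1 1) (1 : R) *
        (-(C μ₁) - C μ₂ * hyperbolicSeries μ₁ μ₂) := by
    have e := hyperbolicDenom_mul_series μ₁ μ₂
    have m : monomial (Finsupp.single (0 : Fin 2) 1 + Finsupp.single 1 1) (1 : R) = X 0 * X 1 := by
      simp [X, monomial_mul_monomial]
    rw [m]
    rw [hyperbolicDenom] at e
    linear_combination e
  rw [h, map_add, coeff_monomial_mul, if_neg]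
  · fin_cases i <;> simp [coeff_X, Finsupp.single_left_inj (one_ne_zero : (1 : ℕ) ≠ 0)]
  · intro hle
    have h0 := hle 0
    have h1 := hle 1
    fin_cases i <;> simp at h0 h1

/-- The hyperbolic two-parameter formal group law
`F(u, v) = (u + v - μ₁ u v) / (1 + μ₂ u v)`. -/
def hyperbolicFGL (μ₁ μ₂ : R) : FormalGroup R where
  toPowerSeries := hyperbolicSeries μ₁ μ₂
  zero_constantCoeff := constantCoeff_hyperbolicSeries μ₁ μ₂
  lin_coeff_X := coeff_single_hyperbolicSeries μ₁ μ₂ 0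
  lin_coeff_Y := coeff_single_hyperbolicSeries μ₁ μ₂ 1
  assoc := by
    have h₀ := constantCoeff_hyperbolicSeries μ₁ μ₂
    have aux₁ := HasSubst.cons_subst_zero_left (0 : Fin 3) 1 2 h₀
    have aux₂ := HasSubst.cons_subst_zero_right (0 : Fin 3) 1 2 h₀
    have e₁ := hyperbolicSeries_subst μ₁ μ₂ aux₁
    have e₂ := hyperbolicSeries_subst μ₁ μ₂ aux₂
    have i₁ := hyperbolicSeries_subst μ₁ μ₂ (HasSubst.X_X (R := R) (i := (0 : Fin 3)) (j := 1))
    have i₂ := hyperbolicSeries_subst μ₁ μ₂ (HasSubst.X_X (R := R) (i := (1 : Fin 3)) (j := 2))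
    set A := (hyperbolicSeries μ₁ μ₂).subst ![(X 0 : MvPowerSeries (Fin 3) R), X 1]
    set B := (hyperbolicSeries μ₁ μ₂).subst ![(X 1 : MvPowerSeries (Fin 3) R), X 2]
    set L := (hyperbolicSeries μ₁ μ₂).subst ![A, (X 2 : MvPowerSeries (Fin 3) R)]
    set L' := (hyperbolicSeries μ₁ μ₂).subst ![(X 0 : MvPowerSeries (Fin 3) R), B]
    let D : MvPowerSeries (Fin 3) R := 1 + C μ₂ * X 0 * X 1 + C μ₂ * X 0 * X 2 + C μ₂ * X 1 * X 2
      - C μ₁ * C μ₂ * X 0 * X 1 * X 2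
    have hD : invOfUnit D 1 * D = 1 := by
      rw [mul_comm]; exact mul_invOfUnit _ _ (by simp [D])
    have key : D * L = D * L' := by
      simp only [D]
      linear_combination (1 + C μ₂ * X 0 * X 1) * e₁ - (1 + C μ₂ * X 1 * X 2) * e₂
        + (1 - C μ₁ * X 2 - C μ₂ * X 2 * L) * i₁ - (1 - C μ₁ * X 0 - C μ₂ * X 0 * L') * i₂
    calc L = (invOfUnit D 1 * D) * L := by rw [hD, one_mul]
      _ = (invOfUnit D 1 * D) * L' := by rw [mul_assoc, key, mul_assoc]
      _ = L' := by rw [hD, one_mul]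

instance (μ₁ μ₂ : R) : (hyperbolicFGL μ₁ μ₂).IsComm where
  comm := by
    have e := hyperbolicSeries_subst μ₁ μ₂ (HasSubst.X_X (R := R) (i := (1 : Fin 2)) (j := 0))
    have e' := hyperbolicDenom_mul_series μ₁ μ₂
    have hD : invOfUnit (hyperbolicDenom μ₂) 1 * hyperbolicDenom μ₂ = 1 := by
      rw [mul_comm]; exact mul_invOfUnit _ _ (by simp [hyperbolicDenom])
    set S := (hyperbolicSeries μ₁ μ₂).subst ![(X 1 : MvPowerSeries (Fin 2) R), X 0]
    have key : hyperbolicDenom μ₂ * hyperbolicSeries μ₁ μ₂ = hyperbolicDenom μ₂ * S := by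
      rw [e', hyperbolicDenom]
      linear_combination -e
    calc hyperbolicSeries μ₁ μ₂
        = (invOfUnit (hyperbolicDenom μ₂) 1 * hyperbolicDenom μ₂) * hyperbolicSeries μ₁ μ₂ := by
          rw [hD, one_mul]
      _ = (invOfUnit (hyperbolicDenom μ₂) 1 * hyperbolicDenom μ₂) * S := by
          rw [mul_assoc, key, mul_assoc]
      _ = S := by rw [hD, one_mul]

end Hyperbolic

section FormalGroupAlgebra

variable (R : Type*) [CommRing R] (Λ : Type*)

/-- The augmentation ideal: the kernel of `ε : R[x_λ] → R`, `x_λ ↦ 0`. -/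
abbrev augIdeal : Ideal (MvPolynomial Λ R) :=
  RingHom.ker (MvPolynomial.aeval (R := R) (fun _ : Λ => (0 : R)))

/-- `R⟦x_λ⟧_{λ ∈ Λ}`: the completion of `R[x_λ]` at the augmentation ideal. -/
abbrev CompletedPoly : Type _ := AdicCompletion (augIdeal R Λ) (MvPolynomial Λ R)

variable {R Λ}

lemma X_mem_augIdeal (l : Λ) : (MvPolynomial.X l : MvPolynomial Λ R) ∈ augIdeal R Λ := by
  simp [RingHom.mem_ker]

/-- The image of the indeterminate `x_λ` in the completion. -/
def xHat (R : Type*) [CommRing R] {Λ : Type*} (l : Λ) : CompletedPoly R Λ :=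
  AdicCompletion.of (augIdeal R Λ) (MvPolynomial Λ R) (MvPolynomial.X l)

/-- The truncation `∑_{i, j < n} c_{ij} a^i b^j` of `F(a, b)`, where `F = ∑ c_{ij} u^i v^j`. -/
def truncEval {S : Type*} [CommRing S] [Algebra R S] (F : MvPowerSeries (Fin 2) R) (a b : S)
    (n : ℕ) : S :=
  ∑ i ∈ Finset.range n, ∑ j ∈ Finset.range n,
    algebraMap R S (MvPowerSeries.coeff (Finsupp.single 0 i + Finsupp.single 1 j) F) *
      a ^ i * b ^ j

lemma truncEval_succ_sub_mem {S : Type*} [CommRing S] [Algebra R S] (F : MvPowerSeries (Fin 2) R)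
    {I : Ideal S} {a b : S} (ha : a ∈ I) (hb : b ∈ I) (n : ℕ) :
    truncEval F a b (n + 1) - truncEval F a b n ∈ I ^ n := by
  have e : truncEval F a b (n + 1) - truncEval F a b n =
      (∑ i ∈ Finset.range n,
        algebraMap R S (MvPowerSeries.coeff (Finsupp.single 0 i + Finsupp.single 1 n) F) *
          a ^ i * b ^ n) +
      ∑ j ∈ Finset.range (n + 1),
        algebraMap R S (MvPowerSeries.coeff (Finsupp.single 0 n + Finsupp.single 1 j) F) *
          a ^ n * b ^ j := by
    simp only [truncEval]
    rw [Finset.sum_range_succ]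
    simp only [Finset.sum_range_succ _ n, Finset.sum_add_distrib]
    ring
  rw [e]
  refine Ideal.add_mem _ (Ideal.sum_mem _ fun i _ => ?_) (Ideal.sum_mem _ fun j _ => ?_)
  · exact Ideal.mul_mem_left _ _ (Ideal.pow_mem_pow hb n)
  · exact Ideal.mul_mem_right _ _ (Ideal.mul_mem_left _ _ (Ideal.pow_mem_pow ha n))

/-- The element `x_a +_F x_b = F(x_a, x_b)` of `R⟦x_λ⟧`, the limit of the truncations. -/
def formalSum (F : FormalGroup R) (a b : Λ) : CompletedPoly R Λ :=
  AdicCompletion.mk (augIdeal R Λ) (MvPolynomial Λ R)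
    (AdicCompletion.AdicCauchySequence.mk (augIdeal R Λ) (MvPolynomial Λ R)
      (truncEval F.toPowerSeries (MvPolynomial.X a) (MvPolynomial.X b))
      fun n => by
        rw [SModEq.comm, SModEq.sub_mem, smul_eq_mul, Ideal.mul_top]
        exact truncEval_succ_sub_mem _ (X_mem_augIdeal a) (X_mem_augIdeal b) n)

variable {Λ' : Type*} {Λ'' : Type*}

lemma augIdeal_le_comap_rename (φ : Λ → Λ') :
    augIdeal R Λ ≤ (augIdeal R Λ').comap (MvPolynomial.rename φ) := by
  intro p hp
  rw [Ideal.mem_comap, RingHom.mem_ker, MvPolynomial.aeval_rename]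
  exact hp

/-- The map `R[x_λ] / I ^ n → R[x_λ'] / I' ^ n` induced by `x_λ ↦ x_{φ λ}`. -/
def quotMap (φ : Λ → Λ') (n : ℕ) :
    (MvPolynomial Λ R ⧸ augIdeal R Λ ^ n) →ₐ[R] (MvPolynomial Λ' R ⧸ augIdeal R Λ' ^ n) :=
  Ideal.quotientMapₐ _ (MvPolynomial.rename φ)
    ((Ideal.pow_right_mono (augIdeal_le_comap_rename φ) n).trans (Ideal.le_comap_pow _ n))

lemma quotMap_mk (φ : Λ → Λ') (n : ℕ) (p : MvPolynomial Λ R) :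
    quotMap φ n (Ideal.Quotient.mk _ p) = Ideal.Quotient.mk _ (MvPolynomial.rename φ p) :=
  rfl

lemma quotMap_compat (φ : Λ → Λ') {m n : ℕ} (hle : m ≤ n) :
    (Ideal.Quotient.factorₐ R (Ideal.pow_le_pow_right hle)).comp
      ((quotMap φ n).comp ((AdicCompletion.evalₐ (augIdeal R Λ) n).restrictScalars R)) =
    (quotMap φ m).comp ((AdicCompletion.evalₐ (augIdeal R Λ) m).restrictScalars R) := by
  refine AlgHom.ext fun x => ?_
  obtain ⟨a, rfl⟩ := AdicCompletion.mk_surjective (augIdeal R Λ) (MvPolynomial Λ R) x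
  have e := congrArg (quotMap (R := R) φ m) (AdicCompletion.Ideal.mk_eq_mk _ hle a)
  simp only [AlgHom.comp_apply, AlgHom.restrictScalars_apply, AdicCompletion.evalₐ_mk]
  exact e

/-- The map `R⟦x_λ⟧ → R⟦x_λ'⟧` induced by `x_λ ↦ x_{φ λ}`. -/
def completedMap (R : Type*) [CommRing R] (φ : Λ → Λ') :
    CompletedPoly R Λ →ₐ[R] CompletedPoly R Λ' :=
  AdicCompletion.liftAlgHom (augIdeal R Λ')
    (fun n => (quotMap φ n).comp ((AdicCompletion.evalₐ (augIdeal R Λ) n).restrictScalars R))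
    (quotMap_compat φ)

lemma evalₐ_completedMap (φ : Λ → Λ') (n : ℕ) (x : CompletedPoly R Λ) :
    AdicCompletion.evalₐ (augIdeal R Λ') n (completedMap R φ x) =
      quotMap φ n (AdicCompletion.evalₐ (augIdeal R Λ) n x) :=
  AdicCompletion.evalₐ_liftAlgHom (augIdeal R Λ') _ (quotMap_compat φ) n x

lemma completedMap_xHat (φ : Λ → Λ') (l : Λ) : completedMap R φ (xHat R l) = xHat R (φ l) := by
  refine AdicCompletion.ext_evalₐ fun n => ?_
  rw [evalₐ_completedMap, xHat, xHat, AdicCompletion.evalₐ_of, AdicCompletion.evalₐ_of,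
    quotMap_mk, MvPolynomial.rename_X]

lemma completedMap_formalSum (F : FormalGroup R) (φ : Λ → Λ') (a b : Λ) :
    completedMap R φ (formalSum F a b) = formalSum F (φ a) (φ b) := by
  refine AdicCompletion.ext_evalₐ fun n => ?_
  rw [evalₐ_completedMap, formalSum, formalSum, AdicCompletion.evalₐ_mk, AdicCompletion.evalₐ_mk,
    quotMap_mk]
  simp [AdicCompletion.AdicCauchySequence.mk, truncEval]

lemma completedMap_id (y : CompletedPoly R Λ) : completedMap R (id : Λ → Λ) y = y := by
  refine AdicCompletion.ext_evalₐ fun n => ?_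
  rw [evalₐ_completedMap]
  obtain ⟨p, hp⟩ := Ideal.Quotient.mk_surjective (AdicCompletion.evalₐ (augIdeal R Λ) n y)
  rw [← hp, quotMap_mk, MvPolynomial.rename_id_apply]

lemma completedMap_comp (φ : Λ → Λ') (ψ : Λ' → Λ'') (y : CompletedPoly R Λ) :
    completedMap R (ψ ∘ φ) y = completedMap R ψ (completedMap R φ y) := by
  refine AdicCompletion.ext_evalₐ fun n => ?_
  rw [evalₐ_completedMap, evalₐ_completedMap, evalₐ_completedMap]
  obtain ⟨p, hp⟩ := Ideal.Quotient.mk_surjective (AdicCompletion.evalₐ (augIdeal R Λ) n y)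
  rw [← hp, quotMap_mk, quotMap_mk, quotMap_mk, MvPolynomial.rename_rename]

/-- The closure of an ideal `J` of a completion `lim S / I ^ n`, for the topology in which the
kernels of the projections to the `S / I ^ n` form a basis of neighbourhoods of `0`: an element is
in the closure iff for every `n` its image in `S / I ^ n` is the image of an element of `J`. -/
def closureIdeal {S : Type*} [CommRing S] (I : Ideal S) (J : Ideal (AdicCompletion I S)) :
    Ideal (AdicCompletion I S) :=
  ⨅ n : ℕ, (J.map (AdicCompletion.evalₐ I n)).comap (AdicCompletion.evalₐ I n)

lemma mem_closureIdeal {S : Type*} [CommRing S] {I : Ideal S} {J : Ideal (AdicCompletion I S)}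
    {x : AdicCompletion I S} :
    x ∈ closureIdeal I J ↔
      ∀ n, ∃ y ∈ J, AdicCompletion.evalₐ I n y = AdicCompletion.evalₐ I n x := by
  simp only [closureIdeal, Ideal.mem_iInf, Ideal.mem_comap]
  exact forall_congr' fun n =>
    Ideal.mem_map_iff_of_surjective _ (AdicCompletion.surjective_evalₐ I n)

variable [AddCommGroup Λ] [AddCommGroup Λ']

/-- The ideal generated by `x_0` and all `x_{a+b} - (x_a +_F x_b)`. -/
def fgaRelIdeal (F : FormalGroup R) (Λ : Type*) [AddCommGroup Λ] : Ideal (CompletedPoly R Λ) :=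
  Ideal.span (insert (xHat R 0)
    (Set.range fun p : Λ × Λ => xHat R (p.1 + p.2) - formalSum F p.1 p.2))

/-- The formal group algebra `R⟦Λ⟧_F`. -/
def FormalGroupAlgebra (F : FormalGroup R) (Λ : Type*) [AddCommGroup Λ] : Type _ :=
  CompletedPoly R Λ ⧸ closureIdeal (augIdeal R Λ) (fgaRelIdeal F Λ)

instance (F : FormalGroup R) : CommRing (FormalGroupAlgebra F Λ) :=
  inferInstanceAs (CommRing (CompletedPoly R Λ ⧸ closureIdeal (augIdeal R Λ) (fgaRelIdeal F Λ)))

instance (F : FormalGroup R) : Algebra R (FormalGroupAlgebra F Λ) :=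
  inferInstanceAs (Algebra R (CompletedPoly R Λ ⧸ closureIdeal (augIdeal R Λ) (fgaRelIdeal F Λ)))

/-- The quotient map `R⟦x_λ⟧ → R⟦Λ⟧_F`. -/
def FormalGroupAlgebra.mk (F : FormalGroup R) (Λ : Type*) [AddCommGroup Λ] :
    CompletedPoly R Λ →ₐ[R] FormalGroupAlgebra F Λ :=
  Ideal.Quotient.mkₐ R (closureIdeal (augIdeal R Λ) (fgaRelIdeal F Λ))

/-- The element `x_λ` of `R⟦Λ⟧_F`. -/
def FormalGroupAlgebra.x (F : FormalGroup R) (l : Λ) : FormalGroupAlgebra F Λ :=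
  FormalGroupAlgebra.mk F Λ (xHat R l)

lemma fgaRelIdeal_le_comap (F : FormalGroup R) (φ : Λ →+ Λ') :
    fgaRelIdeal F Λ ≤ (fgaRelIdeal F Λ').comap (completedMap R φ) := by
  refine Ideal.span_le.2 ?_
  rintro _ (rfl | ⟨⟨a, b⟩, rfl⟩)
  · simp only [SetLike.mem_coe, Ideal.mem_comap, completedMap_xHat, map_zero]
    exact Ideal.subset_span (Set.mem_insert _ _)
  · simp only [SetLike.mem_coe, Ideal.mem_comap, map_sub, completedMap_xHat, map_add,
      completedMap_formalSum]
    exact Ideal.subset_span (Set.mem_insert_of_mem _ ⟨(φ a, φ b), rfl⟩)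

lemma closure_fgaRelIdeal_le_comap (F : FormalGroup R) (φ : Λ →+ Λ') :
    closureIdeal (augIdeal R Λ) (fgaRelIdeal F Λ) ≤
      (closureIdeal (augIdeal R Λ') (fgaRelIdeal F Λ')).comap (completedMap R φ) := by
  intro x hx
  rw [Ideal.mem_comap, mem_closureIdeal]
  intro n
  obtain ⟨y, hy, e⟩ := mem_closureIdeal.1 hx n
  exact ⟨completedMap R φ y, fgaRelIdeal_le_comap F φ hy, by
    rw [evalₐ_completedMap, evalₐ_completedMap, e]⟩

/-- The algebra map `R⟦Λ⟧_F → R⟦Λ'⟧_F`, `x_λ ↦ x_{φ λ}`, induced by `φ : Λ → Λ'`. -/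
def FormalGroupAlgebra.map (F : FormalGroup R) (φ : Λ →+ Λ') :
    FormalGroupAlgebra F Λ →ₐ[R] FormalGroupAlgebra F Λ' :=
  Ideal.quotientMapₐ _ (completedMap R φ) (closure_fgaRelIdeal_le_comap F φ)

lemma FormalGroupAlgebra.map_mk (F : FormalGroup R) (φ : Λ →+ Λ') (y : CompletedPoly R Λ) :
    FormalGroupAlgebra.map F φ (FormalGroupAlgebra.mk F Λ y) =
      FormalGroupAlgebra.mk F Λ' (completedMap R φ y) :=
  rfl

lemma FormalGroupAlgebra.mk_surjective (F : FormalGroup R) :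
    Function.Surjective (FormalGroupAlgebra.mk F Λ) :=
  Ideal.Quotient.mk_surjective

lemma FormalGroupAlgebra.map_x (F : FormalGroup R) (φ : Λ →+ Λ') (l : Λ) :
    FormalGroupAlgebra.map F φ (FormalGroupAlgebra.x F l) = FormalGroupAlgebra.x F (φ l) := by
  rw [FormalGroupAlgebra.x, FormalGroupAlgebra.map_mk, completedMap_xHat, FormalGroupAlgebra.x]

/-- A group acting linearly on `Λ` acts on `R⟦Λ⟧_F` by `R`-algebra maps, `g • x_λ = x_{g • λ}`. -/
instance {G : Type*} [Group G] [DistribMulAction G Λ] (F : FormalGroup R) :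
    MulSemiringAction G (FormalGroupAlgebra F Λ) where
  smul g y := FormalGroupAlgebra.map F (DistribSMul.toAddMonoidHom Λ g) y
  one_smul y := by
    obtain ⟨y, rfl⟩ := FormalGroupAlgebra.mk_surjective F y
    have h : (DistribSMul.toAddMonoidHom Λ (1 : G) : Λ → Λ) = id := funext fun l => one_smul G l
    change FormalGroupAlgebra.map F _ (FormalGroupAlgebra.mk F Λ y) = _
    rw [FormalGroupAlgebra.map_mk, h, completedMap_id]
  mul_smul g h y := by
    obtain ⟨y, rfl⟩ := FormalGroupAlgebra.mk_surjective F y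
    have e : (DistribSMul.toAddMonoidHom Λ (g * h) : Λ → Λ) =
        DistribSMul.toAddMonoidHom Λ g ∘ DistribSMul.toAddMonoidHom Λ h :=
      funext fun l => mul_smul g h l
    change FormalGroupAlgebra.map F _ (FormalGroupAlgebra.mk F Λ y) =
      FormalGroupAlgebra.map F _ (FormalGroupAlgebra.map F _ (FormalGroupAlgebra.mk F Λ y))
    rw [FormalGroupAlgebra.map_mk, FormalGroupAlgebra.map_mk, FormalGroupAlgebra.map_mk, e,
      completedMap_comp]
  smul_zero g := map_zero (FormalGroupAlgebra.map F (DistribSMul.toAddMonoidHom Λ g))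
  smul_add g := map_add (FormalGroupAlgebra.map F (DistribSMul.toAddMonoidHom Λ g))
  smul_one g := map_one (FormalGroupAlgebra.map F (DistribSMul.toAddMonoidHom Λ g))
  smul_mul g := map_mul (FormalGroupAlgebra.map F (DistribSMul.toAddMonoidHom Λ g))

lemma FormalGroupAlgebra.smul_def {G : Type*} [Group G] [DistribMulAction G Λ] (F : FormalGroup R)
    (g : G) (y : FormalGroupAlgebra F Λ) :
    g • y = FormalGroupAlgebra.map F (DistribSMul.toAddMonoidHom Λ g) y :=
  rfl

lemma FormalGroupAlgebra.smul_x {G : Type*} [Group G] [DistribMulAction G Λ] (F : FormalGroup R)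
    (g : G) (l : Λ) :
    g • FormalGroupAlgebra.x F l = FormalGroupAlgebra.x F (g • l) :=
  FormalGroupAlgebra.map_x F _ l

lemma FormalGroupAlgebra.smul_algebraMap {G : Type*} [Group G] [DistribMulAction G Λ]
    (F : FormalGroup R) (g : G) (r : R) :
    g • algebraMap R (FormalGroupAlgebra F Λ) r = algebraMap R (FormalGroupAlgebra F Λ) r :=
  (FormalGroupAlgebra.map F (DistribSMul.toAddMonoidHom Λ g)).commutes r

end FormalGroupAlgebra

/-! ### Kac-Moody root data, Weyl group, real roots -/

/-- Generalized Cartan matrices. -/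
structure IsGeneralizedCartanMatrix {ι : Type*} (A : Matrix ι ι ℤ) : Prop where
  diag : ∀ i, A i i = 2
  nonpos : ∀ i j, i ≠ j → A i j ≤ 0
  zero : ∀ i j, A i j = 0 → A j i = 0

/-- A generalized Cartan matrix `A` together with a triple `(𝔥, Π, Π^∨)`: a vector space `𝔥` of
dimension `2 l - rank A` with linearly independent families of simple roots `α_i ∈ 𝔥^*` and simple
coroots `α_i^∨ ∈ 𝔥` such that `α_j(α_i^∨) = a_ij`. -/
structure KacMoodyDatum (ι : Type*) [Fintype ι] (k : Type*) [Field k] (𝔥 : Type*)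
    [AddCommGroup 𝔥] [Module k 𝔥] where
  A : Matrix ι ι ℤ
  isGCM : IsGeneralizedCartanMatrix A
  root : ι → Module.Dual k 𝔥
  coroot : ι → 𝔥
  linearIndependent_root : LinearIndependent k root
  linearIndependent_coroot : LinearIndependent k coroot
  root_coroot : ∀ i j, root j (coroot i) = (A i j : k)
  finiteDimensional : Module.Finite k 𝔥
  finrank_add_rank :
    Module.finrank k 𝔥 + (A.map (Int.cast : ℤ → k)).rank = 2 * Fintype.card ι

namespace KacMoodyDatum

variable {ι : Type*} [Fintype ι] {k : Type*} [Field k] {𝔥 : Type*} [AddCommGroup 𝔥] [Module k 𝔥]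
  (D : KacMoodyDatum ι k 𝔥)

lemma eval_coroot_root (i : ι) : Module.Dual.eval k 𝔥 (D.coroot i) (D.root i) = 2 := by
  simp [D.root_coroot, D.isGCM.diag]

/-- The simple reflection `s_i(φ) = φ - φ(α_i^∨) α_i` of `𝔥^*`. -/
def simpleReflection (i : ι) : Module.Dual k 𝔥 ≃ₗ[k] Module.Dual k 𝔥 :=
  Module.reflection (D.eval_coroot_root i)

lemma simpleReflection_apply (i : ι) (φ : Module.Dual k 𝔥) :
    D.simpleReflection i φ = φ - φ (D.coroot i) • D.root i :=
  Module.reflection_apply _ _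

/-- The Weyl group: the group of automorphisms of `𝔥^*` generated by the simple reflections. -/
def weylGroup : Subgroup (Module.Dual k 𝔥 ≃ₗ[k] Module.Dual k 𝔥) :=
  Subgroup.closure (Set.range D.simpleReflection)

/-- The simple reflection `s_i` as an element of the Weyl group. -/
def s (i : ι) : D.weylGroup :=
  ⟨D.simpleReflection i, Subgroup.subset_closure ⟨i, rfl⟩⟩

/-- The order `m_ij` of `s_i s_j` in the Weyl group; the value `0` stands for `∞`. -/
def m (i j : ι) : ℕ := orderOf (D.s i * D.s j)

/-- The real roots: the vectors `w(α_i)` with `w` in the Weyl group and `α_i` a simple root. -/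
def realRoots : Set (Module.Dual k 𝔥) :=
  {β | ∃ (w : D.weylGroup) (i : ι), w • D.root i = β}

lemma root_mem_realRoots (i : ι) : D.root i ∈ D.realRoots := ⟨1, i, one_smul _ _⟩

lemma smul_mem_realRoots (w : D.weylGroup) {β : Module.Dual k 𝔥} (h : β ∈ D.realRoots) :
    w • β ∈ D.realRoots := by
  obtain ⟨v, i, rfl⟩ := h
  exact ⟨w * v, i, mul_smul _ _ _⟩

open Classical in
/-- The reflection `s_β = w s_i w⁻¹` in a real root `β = w(α_i)`. It does not depend on the choice
of `w` and `i`. (The value at vectors that are not real roots is irrelevant.) -/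
def reflection (β : Module.Dual k 𝔥) : D.weylGroup :=
  if h : β ∈ D.realRoots then h.choose * D.s h.choose_spec.choose * h.choose⁻¹ else 1

end KacMoodyDatum

/-- A formal Demazure lattice: a finitely generated free subgroup `Λ` of `𝔥^*` such that every
simple root is a member of some `ℤ`-basis of `Λ`, and `⟨Λ, α_i^∨⟩ ⊆ ℤ` for all `i`. -/
structure FormalDemazureLattice {ι : Type*} [Fintype ι] {k : Type*} [Field k] {𝔥 : Type*}
    [AddCommGroup 𝔥] [Module k 𝔥] (D : KacMoodyDatum ι k 𝔥) where
  lattice : AddSubgroup (Module.Dual k 𝔥)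
  finite : Module.Finite ℤ lattice
  free : Module.Free ℤ lattice
  exists_basis : ∀ i, ∃ (n : ℕ) (b : Module.Basis (Fin n) ℤ lattice) (t : Fin n),
    (b t : Module.Dual k 𝔥) = D.root i
  pairing_int : ∀ l ∈ lattice, ∀ i, ∃ z : ℤ, l (D.coroot i) = (z : k)

namespace FormalDemazureLattice

variable {ι : Type*} [Fintype ι] {k : Type*} [Field k] {𝔥 : Type*} [AddCommGroup 𝔥] [Module k 𝔥]
  {D : KacMoodyDatum ι k 𝔥} (L : FormalDemazureLattice D)

lemma root_mem (i : ι) : D.root i ∈ L.lattice := by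
  obtain ⟨n, b, t, h⟩ := L.exists_basis i
  exact h ▸ (b t).2

lemma smul_mem (w : D.weylGroup) {l : Module.Dual k 𝔥} (hl : l ∈ L.lattice) :
    w • l ∈ L.lattice := by
  obtain ⟨w, hw⟩ := w
  change w l ∈ L.lattice
  have hs : ∀ (i : ι) (l : Module.Dual k 𝔥), l ∈ L.lattice →
      D.simpleReflection i l ∈ L.lattice := by
    intro i l hl
    obtain ⟨z, hz⟩ := L.pairing_int l hl i
    rw [D.simpleReflection_apply, hz, Int.cast_smul_eq_zsmul k z (D.root i)]
    exact L.lattice.sub_mem hl (L.lattice.zsmul_mem (L.root_mem i) z)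
  induction hw using Subgroup.closure_induction'' generalizing l with
  | one => exact hl
  | mem x hx =>
    obtain ⟨i, rfl⟩ := hx
    exact hs i l hl
  | inv_mem x hx =>
    obtain ⟨i, rfl⟩ := hx
    exact hs i l hl
  | mul x y _ _ hx hy => exact hx (hy hl)

/-- The Weyl group acts on a formal Demazure lattice. -/
instance : DistribMulAction D.weylGroup L.lattice where
  smul w l := ⟨w • (l : Module.Dual k 𝔥), L.smul_mem w l.2⟩
  one_smul _ := Subtype.ext (one_smul _ _)
  mul_smul _ _ _ := Subtype.ext (mul_smul _ _ _)
  smul_zero _ := Subtype.ext (smul_zero _)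
  smul_add _ _ _ := Subtype.ext (smul_add _ _ _)

lemma coe_smul (w : D.weylGroup) (l : L.lattice) :
    ((w • l : L.lattice) : Module.Dual k 𝔥) = w • (l : Module.Dual k 𝔥) :=
  rfl

/-- The real roots, as a type of elements of the lattice. (They all lie in the lattice.) -/
def RealRoot : Type _ := {l : L.lattice // (l : Module.Dual k 𝔥) ∈ D.realRoots}

/-- The simple root `α_i`. -/
def simpleRoot (i : ι) : L.RealRoot := ⟨⟨D.root i, L.root_mem i⟩, D.root_mem_realRoots i⟩

/-- The reflection `s_α` in a real root `α`. -/
def refl (α : L.RealRoot) : D.weylGroup := D.reflection (α.1 : Module.Dual k 𝔥)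

variable {R : Type*} [CommRing R] (F : FormalGroup R)

/-- The formal group algebra `R⟦Λ⟧_F`. -/
abbrev FGA : Type _ := FormalGroupAlgebra F L.lattice

/-- The element `x_α ∈ R⟦Λ⟧_F` of a real root `α`. -/
def x (α : L.RealRoot) : L.FGA F := FormalGroupAlgebra.x F α.1

open Classical in
/-- The Demazure operator `Δ_α(γ) = (γ - s_α(γ)) / x_α`, i.e. the element `δ` of `R⟦Λ⟧_F` with
`x_α δ = γ - s_α(γ)`. -/
def demazureOp (α : L.RealRoot) (γ : L.FGA F) : L.FGA F :=
  if h : ∃ δ, L.x F α * δ = γ - L.refl α • γ then h.choose else 0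

/-- The multiplicative subset of `R⟦Λ⟧_F` generated by the `x_α`, `α` a real root. -/
def rootSubmonoid : Submonoid (L.FGA F) := Submonoid.closure (Set.range (L.x F))

lemma smul_mem_rootSubmonoid (w : D.weylGroup) {y : L.FGA F} (hy : y ∈ L.rootSubmonoid F) :
    w • y ∈ L.rootSubmonoid F := by
  induction hy using Submonoid.closure_induction with
  | mem y hy =>
    obtain ⟨α, rfl⟩ := hy
    refine Submonoid.subset_closure ⟨⟨w • α.1, ?_⟩, ?_⟩
    · exact D.smul_mem_realRoots w α.2
    · exact (FormalGroupAlgebra.smul_x F w α.1).symm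
  | one => rw [smul_one]; exact one_mem _
  | mul y z _ _ hy hz => rw [smul_mul']; exact mul_mem hy hz

/-- The localization `Q^F` of `R⟦Λ⟧_F` at the `x_α`, `α` a real root. -/
abbrev Q : Type _ := Localization (L.rootSubmonoid F)

/-- The ring endomorphism of `Q^F` induced by an element of the Weyl group. -/
def actQ (w : D.weylGroup) : L.Q F →+* L.Q F :=
  IsLocalization.map (L.Q F) (MulSemiringAction.toRingHom D.weylGroup (L.FGA F) w)
    (show L.rootSubmonoid F ≤ (L.rootSubmonoid F).comap _ from
      fun _ hy => L.smul_mem_rootSubmonoid F w hy)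

lemma actQ_algebraMap (w : D.weylGroup) (γ : L.FGA F) :
    L.actQ F w (algebraMap _ (L.Q F) γ) = algebraMap _ (L.Q F) (w • γ) :=
  IsLocalization.map_eq _ γ

/-- The action of the Weyl group on `Q^F` extending the one on `R⟦Λ⟧_F`. -/
instance : MulSemiringAction D.weylGroup (L.Q F) where
  smul w q := L.actQ F w q
  one_smul q := by
    have h : L.actQ F 1 = RingHom.id _ := by
      refine IsLocalization.ringHom_ext (L.rootSubmonoid F) (RingHom.ext fun γ => ?_)
      simp [actQ_algebraMap]
    exact congrArg (fun f => f q) h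
  mul_smul w v q := by
    have h : L.actQ F (w * v) = (L.actQ F w).comp (L.actQ F v) := by
      refine IsLocalization.ringHom_ext (L.rootSubmonoid F) (RingHom.ext fun γ => ?_)
      simp [actQ_algebraMap, mul_smul]
    exact congrArg (fun f => f q) h
  smul_zero w := map_zero (L.actQ F w)
  smul_add w := map_add (L.actQ F w)
  smul_one w := map_one (L.actQ F w)
  smul_mul w := map_mul (L.actQ F w)

lemma smul_algebraMap_Q (w : D.weylGroup) (γ : L.FGA F) :
    w • algebraMap (L.FGA F) (L.Q F) γ = algebraMap (L.FGA F) (L.Q F) (w • γ) :=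
  L.actQ_algebraMap F w γ

lemma smul_algebraMap_base (w : D.weylGroup) (r : R) :
    w • algebraMap R (L.Q F) r = algebraMap R (L.Q F) r := by
  rw [IsScalarTower.algebraMap_apply R (L.FGA F) (L.Q F), smul_algebraMap_Q,
    FormalGroupAlgebra.smul_algebraMap]

/-- The twisted formal group algebra `Q_W^F`. The element `single w q` is `q δ_w`, and
`(q δ_w) (q' δ_w') = q w(q') δ_{w w'}`; in particular `q δ_w = δ_w w⁻¹(q)`, which is the rule
`(δ_w' ψ') (δ_w ψ) = δ_{w' w} w⁻¹(ψ') ψ`. -/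
abbrev QW : Type _ := SkewMonoidAlgebra (L.Q F) D.weylGroup

/-- The `R`-algebra structure of `Q_W^F`. -/
instance : Algebra R (L.QW F) where
  algebraMap := (SkewMonoidAlgebra.singleOneRingHom).comp (algebraMap R (L.Q F))
  commutes' r f := by
    change SkewMonoidAlgebra.single 1 (algebraMap R (L.Q F) r) * f =
      f * SkewMonoidAlgebra.single 1 (algebraMap R (L.Q F) r)
    induction f using SkewMonoidAlgebra.induction_on with
    | zero => simp
    | single w q =>
      rw [SkewMonoidAlgebra.single_mul_single, SkewMonoidAlgebra.single_mul_single,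
        smul_algebraMap_base, one_smul, one_mul, mul_one, mul_comm]
    | add f g hf hg => rw [mul_add, add_mul, hf, hg]
  smul_def' r f := by
    change r • f = SkewMonoidAlgebra.single 1 (algebraMap R (L.Q F) r) * f
    induction f using SkewMonoidAlgebra.induction_on with
    | zero => simp
    | single w q =>
      rw [SkewMonoidAlgebra.single_mul_single, one_smul, one_mul, SkewMonoidAlgebra.smul_single,
        Algebra.smul_def]
    | add f g hf hg => rw [mul_add, smul_add, hf, hg]

/-- The element of `Q_W^F` given by an element of `R⟦Λ⟧_F`. -/
def ofFGA : L.FGA F →ₐ[R] L.QW F where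
  toRingHom := (SkewMonoidAlgebra.singleOneRingHom).comp (algebraMap (L.FGA F) (L.Q F))
  commutes' r := by
    change SkewMonoidAlgebra.single 1 (algebraMap (L.FGA F) (L.Q F) (algebraMap R (L.FGA F) r)) =
      SkewMonoidAlgebra.single 1 (algebraMap R (L.Q F) r)
    rw [IsScalarTower.algebraMap_apply R (L.FGA F) (L.Q F)]

/-- The element `1 / x_α` of `Q^F`. -/
def xInv (α : L.RealRoot) : L.Q F :=
  IsLocalization.mk' (L.Q F) (1 : L.FGA F)
    (⟨L.x F α, Submonoid.subset_closure ⟨α, rfl⟩⟩ : L.rootSubmonoid F)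

/-- The formal Demazure element `X_α = (1 / x_α) (1 - δ_{s_α})`. -/
def X (α : L.RealRoot) : L.QW F :=
  SkewMonoidAlgebra.single 1 (L.xInv F α) * (1 - SkewMonoidAlgebra.single (L.refl α) 1)

/-- `X_i = X_{α_i}`. -/
def Xi (i : ι) : L.QW F := L.X F (L.simpleRoot i)

/-- The formal Demazure algebra `D_F`, generated by all `X_α`. -/
def demazureAlgebra : Subalgebra R (L.QW F) := Algebra.adjoin R (Set.range (L.X F))

/-- The formal affine Demazure algebra `𝐃_F`, generated by `R⟦Λ⟧_F` and `D_F`. -/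
def affineDemazureAlgebra : Subalgebra R (L.QW F) :=
  Algebra.adjoin R (Set.range (L.ofFGA F) ∪ (L.demazureAlgebra F : Set (L.QW F)))

/-! ### The algebra presented by generators and relations -/

/-- The generator of the free algebra for an element of `R⟦Λ⟧_F`. -/
def genFGA (γ : L.FGA F) : FreeAlgebra R (L.FGA F ⊕ ι) := FreeAlgebra.ι R (Sum.inl γ)

/-- The generator of the free algebra for the index `i` (standing for `X_i`). -/
def genX (i : ι) : FreeAlgebra R (L.FGA F ⊕ ι) := FreeAlgebra.ι R (Sum.inr i)

/-- The defining relations. The first three say that the generators indexed by `R⟦Λ⟧_F` multiply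
and add as in the `R`-algebra `R⟦Λ⟧_F`. The commutation relation between `γ` and `X_α` is imposed
only for `α = α_i`, since only the `X_i` are generators. There is no relation between `X_i` and
`X_j` if `m_ij = ∞`. -/
inductive Rel (μ₁ μ₂ : R) : FreeAlgebra R (L.FGA F ⊕ ι) → FreeAlgebra R (L.FGA F ⊕ ι) → Prop
  | base (r : R) :
      Rel μ₁ μ₂ (L.genFGA F (algebraMap R (L.FGA F) r)) (algebraMap R _ r)
  | add (γ γ' : L.FGA F) : Rel μ₁ μ₂ (L.genFGA F (γ + γ')) (L.genFGA F γ + L.genFGA F γ')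
  | mul (γ γ' : L.FGA F) : Rel μ₁ μ₂ (L.genFGA F (γ * γ')) (L.genFGA F γ * L.genFGA F γ')
  | demazure (γ : L.FGA F) (i : ι) :
      Rel μ₁ μ₂ (L.genFGA F γ * L.genX F i)
        (L.genX F i * L.genFGA F (L.refl (L.simpleRoot i) • γ) +
          L.genFGA F (L.demazureOp F (L.simpleRoot i) γ))
  | sq (i : ι) : Rel μ₁ μ₂ (L.genX F i ^ 2) (μ₁ • L.genX F i)
  | comm (i j : ι) (h : D.m i j = 2) :
      Rel μ₁ μ₂ (L.genX F i * L.genX F j) (L.genX F j * L.genX F i)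
  | braid_three (i j : ι) (h : D.m i j = 3) :
      Rel μ₁ μ₂
        (L.genX F j * L.genX F i * L.genX F j - L.genX F i * L.genX F j * L.genX F i)
        (μ₂ • (L.genX F i - L.genX F j))
  | braid_four (i j : ι) (h : D.m i j = 4) :
      Rel μ₁ μ₂
        ((L.genX F j * L.genX F i) ^ 2 - (L.genX F i * L.genX F j) ^ 2)
        ((2 * μ₂) • (L.genX F i * L.genX F j - L.genX F j * L.genX F i))
  | braid_six (i j : ι) (h : D.m i j = 6) :
      Rel μ₁ μ₂
        ((L.genX F j * L.genX F i) ^ 3 - (L.genX F i * L.genX F j) ^ 3)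
        ((4 * μ₂) • ((L.genX F i * L.genX F j) ^ 2 - (L.genX F j * L.genX F i) ^ 2) +
          (3 * μ₂ ^ 2) • (L.genX F i * L.genX F j - L.genX F j * L.genX F i))

/-- The abstract `R`-algebra on generators `γ ∈ R⟦Λ⟧_F` and `X_i`, subject to `Rel`. -/
abbrev PresentedAlgebra (μ₁ μ₂ : R) : Type _ := RingQuot (L.Rel F μ₁ μ₂)

/-- The class of a generator `γ ∈ R⟦Λ⟧_F`. -/
def presFGA (μ₁ μ₂ : R) (γ : L.FGA F) : L.PresentedAlgebra F μ₁ μ₂ :=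
  RingQuot.mkAlgHom R (L.Rel F μ₁ μ₂) (L.genFGA F γ)

/-- The class of the generator `X_i`. -/
def presX (μ₁ μ₂ : R) (i : ι) : L.PresentedAlgebra F μ₁ μ₂ :=
  RingQuot.mkAlgHom R (L.Rel F μ₁ μ₂) (L.genX F i)

end FormalDemazureLattice

end HyperbolicDemazure

end

open HyperbolicDemazure

/-!
The four facts behind the theorem are the following.

*Coordinates.* For a `ℤ`-basis `b` of `Λ` the algebra `R⟦Λ⟧_F` is a power series ring in the
`x_{b t}` (`coordHom`): the hyperbolic formal group law makes the power series without constant term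
into an abelian group, and `x_λ` is sent to the point of this group with coordinates `λ`. Taking a
basis that contains `α_i`, one sees that `x_{α_i}` is regular and, since `s_i` moves `λ` by a
multiple of `α_i`, that it divides `γ - s_i γ`. The case of a general real root follows by
conjugation, once `s_α` is known to be well defined (`KacMoodyDatum.conj_s_eq`).

*Rank two.* The elements `y_α = 1 / x_α` satisfy `y_{-α} = μ₁ - y_α` and
`y_{α+β} (y_α + y_β - μ₁) = y_α y_β + μ₂`. Let `U_n` be given by `U_1 = X_i`, `U_2 = X_j X_i` and
the recursion `U_{n+1} = X U_n + μ₂ U_{n-1}` for `n ≥ 2`, where `X` is alternately `X_i` and `X_j`.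
The two identities imply that `U_m`, for `m = m_ij` finite, is `∏ y_β ∑_w ε(w) δ_w`, the product
over the positive roots of the dihedral group of `s_i` and `s_j` and the sum over its elements. This
is symmetric in `i` and `j`, and the equality of the two ways to compute it is the braid relation
(`divDiff_braid_three`, `divDiff_braid_four`, `divDiff_braid_six`).

*Spanning.* The positivity of roots (`KacMoodyDatum.isPos_smul_root`), deduced from the rank two
case by induction on the length, gives Matsumoto's theorem for `W` (`KacMoodyDatum.matsumoto`).
Hence in the presented algebra the product of the `X_i` along a reduced word for `w` is independent
of the word up to products of fewer factors, and `X_i² = μ₁ X_i` removes the words that are not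
reduced. So the products along one reduced word for each `w` span the presented algebra over
`R⟦Λ⟧_F` (`FormalDemazureLattice.exists_eq_sum_presX`).

*Independence.* In `Q_W^F` the product along a reduced word for `w` is a unit times `δ_w`, plus
terms with `δ_v` for shorter `v`. As `R⟦Λ⟧_F` embeds into `Q^F`, these products are linearly
independent over `R⟦Λ⟧_F` (`FormalDemazureLattice.eq_zero_of_sum_eq_zero`), and the natural map is
injective. Its image is everything, because `δ_{s_i} = 1 - x_{α_i} X_i` and conjugation by `δ_w`
turns `X_α` into `X_{w α}`.
-/

noncomputable section

namespace HyperbolicDemazure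

/-! ### Rank two relations in a twisted group algebra -/

section RankTwo

open SkewMonoidAlgebra

variable {K G : Type*} [CommRing K] [Group G] [MulSemiringAction G K]

/-- The divided difference element `y (1 - δ_s)` of a twisted group algebra. -/
def divDiff (s : G) (y : K) : SkewMonoidAlgebra K G := single 1 y * (1 - single s 1)

/-- The element `g δ_v (1 - δ_s)`. For fixed `s` with `s² = 1` these span the left ideal generated
by `1 - δ_s`, with one free coordinate for each coset `v ⟨s⟩`. -/
def cosetTerm (s v : G) (g : K) : SkewMonoidAlgebra K G := single v g * (1 - single s 1)

lemma cosetTerm_eq (s v : G) (g : K) : cosetTerm s v g = single v g - single (v * s) g := by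
  rw [cosetTerm, mul_sub, mul_one, single_mul_single, smul_one, mul_one]

lemma cosetTerm_zero (s v : G) : cosetTerm s v (0 : K) = 0 := by
  rw [cosetTerm, single_zero, zero_mul]

lemma cosetTerm_add (s v : G) (g h : K) :
    cosetTerm s v (g + h) = cosetTerm s v g + cosetTerm s v h := by
  simp only [cosetTerm, single_add, add_mul]

lemma divDiff_eq (s : G) (y : K) : divDiff s y = cosetTerm s 1 y := rfl

lemma divDiff_mul_cosetTerm (p s v : G) (y g : K) :
    divDiff p y * cosetTerm s v g = cosetTerm s v (y * g) - cosetTerm s (p * v) (y * p • g) := by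
  simp only [cosetTerm, divDiff, ← sub_mul, ← mul_assoc]
  congr 1
  rw [mul_assoc, sub_mul, one_mul, mul_sub, single_mul_single, single_mul_single,
    single_mul_single]
  simp

lemma cosetTerm_self {s : G} (hs : s * s = 1) (g : K) : cosetTerm s s g = -cosetTerm s 1 g := by
  rw [cosetTerm_eq, cosetTerm_eq, hs, one_mul]; abel

lemma single_one_mul_cosetTerm (c : K) (s v : G) (g : K) :
    single 1 c * cosetTerm s v g = cosetTerm s v (c * g) := by
  rw [cosetTerm, ← mul_assoc, single_mul_single, one_mul, one_smul, cosetTerm]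

/-- Left multiplication by `y (1 - δ_p)` on two cosets interchanged by `p`. -/
lemma divDiff_mul_pair {p : G} (hp : p * p = 1) (s v : G) (y g g' : K) :
    divDiff p y * (cosetTerm s v g - cosetTerm s (p * v) g') =
      cosetTerm s v (y * (g + p • g')) - cosetTerm s (p * v) (y * (g' + p • g)) := by
  rw [mul_sub, divDiff_mul_cosetTerm, divDiff_mul_cosetTerm, ← mul_assoc, hp, one_mul]
  simp only [mul_add, cosetTerm_add]
  abel

/-- Left multiplication by `y (1 - δ_s)` on the coset fixed by `s`. -/
lemma divDiff_mul_base {s : G} (hs : s * s = 1) (y g : K) :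
    divDiff s y * cosetTerm s 1 g = cosetTerm s 1 (y * (g + s • g)) := by
  rw [divDiff_mul_cosetTerm, mul_one, cosetTerm_self hs, mul_add, cosetTerm_add]
  abel

/-- `X² = m X` for `X = y (1 - δ_s)` when `y + s(y) = m`. -/
lemma divDiff_sq {s : G} (hs : s * s = 1) {y m : K} (hy : s • y = m - y) :
    divDiff s y * divDiff s y = single 1 m * divDiff s y := by
  have h := divDiff_mul_base hs y y
  rw [hy, add_sub_cancel, mul_comm, ← single_one_mul_cosetTerm, ← divDiff_eq] at h
  exact h

lemma divDiff_comm {s t : G} (hst : s * t = t * s) {A B : K} (hsB : s • B = B) (htA : t • A = A) :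
    divDiff s A * divDiff t B = divDiff t B * divDiff s A := by
  rw [divDiff_eq t B, divDiff_mul_cosetTerm, ← divDiff_eq t B, divDiff_eq s A,
    divDiff_mul_cosetTerm, hsB, htA]
  simp only [cosetTerm_eq, mul_one, one_mul, hst, mul_comm B A]
  abel

/-- The element of the left ideal generated by `1 - δ_s` with coordinates `± g₀, …, g₅` at the
cosets of `1, t, st, tst, stst, tstst`. -/
def dihedralChain (s t : G) (g₀ g₁ g₂ g₃ g₄ g₅ : K) : SkewMonoidAlgebra K G :=
  cosetTerm s 1 g₀ - cosetTerm s t g₁ + cosetTerm s (s * t) g₂ - cosetTerm s (t * (s * t)) g₃ +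
    cosetTerm s (s * (t * (s * t))) g₄ - cosetTerm s (t * (s * (t * (s * t)))) g₅

lemma divDiff_eq_dihedralChain (s t : G) (A : K) : divDiff s A = dihedralChain s t A 0 0 0 0 0 := by
  simp [dihedralChain, divDiff_eq, cosetTerm_zero]

lemma single_one_mul_dihedralChain (s t : G) (c g₀ g₁ g₂ g₃ g₄ g₅ : K) :
    single 1 c * dihedralChain s t g₀ g₁ g₂ g₃ g₄ g₅ =
      dihedralChain s t (c * g₀) (c * g₁) (c * g₂) (c * g₃) (c * g₄) (c * g₅) := by
  simp only [dihedralChain, mul_add, mul_sub, single_one_mul_cosetTerm]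

lemma dihedralChain_add (s t : G) (g₀ g₁ g₂ g₃ g₄ g₅ h₀ h₁ h₂ h₃ h₄ h₅ : K) :
    dihedralChain s t g₀ g₁ g₂ g₃ g₄ g₅ + dihedralChain s t h₀ h₁ h₂ h₃ h₄ h₅ =
      dihedralChain s t (g₀ + h₀) (g₁ + h₁) (g₂ + h₂) (g₃ + h₃) (g₄ + h₄) (g₅ + h₅) := by
  simp only [dihedralChain, cosetTerm_add]
  abel

lemma divDiff_snd_mul_dihedralChain (s : G) {t : G} (ht : t * t = 1) (B g₀ g₁ g₂ g₃ g₄ g₅ : K) :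
    divDiff t B * dihedralChain s t g₀ g₁ g₂ g₃ g₄ g₅ =
      dihedralChain s t (B * (g₀ + t • g₁)) (B * (g₁ + t • g₀)) (B * (g₂ + t • g₃))
        (B * (g₃ + t • g₂)) (B * (g₄ + t • g₅)) (B * (g₅ + t • g₄)) := by
  have h (v : G) (g g' : K) := divDiff_mul_pair ht s v B g g'
  have h₀ := h 1 g₀ g₁
  rw [mul_one] at h₀
  have e : dihedralChain s t g₀ g₁ g₂ g₃ g₄ g₅ =
      (cosetTerm s 1 g₀ - cosetTerm s t g₁) +
      (cosetTerm s (s * t) g₂ - cosetTerm s (t * (s * t)) g₃) +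
      (cosetTerm s (s * (t * (s * t))) g₄ - cosetTerm s (t * (s * (t * (s * t)))) g₅) := by
    rw [dihedralChain]; abel
  rw [e, mul_add, mul_add, h₀, h, h, dihedralChain]
  abel

lemma divDiff_fst_mul_dihedralChain {s : G} (t : G) (hs : s * s = 1) (A g₀ g₁ g₂ g₃ g₄ : K) :
    divDiff s A * dihedralChain s t g₀ g₁ g₂ g₃ g₄ 0 =
      dihedralChain s t (A * (g₀ + s • g₀)) (A * (g₁ + s • g₂)) (A * (g₂ + s • g₁))
        (A * (g₃ + s • g₄)) (A * (g₄ + s • g₃)) 0 := by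
  have e : dihedralChain s t g₀ g₁ g₂ g₃ g₄ 0 = cosetTerm s 1 g₀ -
      (cosetTerm s t g₁ - cosetTerm s (s * t) g₂) -
      (cosetTerm s (t * (s * t)) g₃ - cosetTerm s (s * (t * (s * t))) g₄) := by
    rw [dihedralChain, cosetTerm_zero]; abel
  rw [e, mul_sub, mul_sub, divDiff_mul_base hs, divDiff_mul_pair hs, divDiff_mul_pair hs,
    dihedralChain, cosetTerm_zero]
  abel

lemma dihedralChain_symm_three {s t : G} (h : s * (t * s) = t * (s * t)) (q : K) :
    dihedralChain s t q q q 0 0 0 = dihedralChain t s q q q 0 0 0 := by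
  simp only [dihedralChain, cosetTerm_zero]
  simp only [cosetTerm_eq, mul_assoc, one_mul, h]
  abel

lemma dihedralChain_symm_four {s t : G} (h : s * (t * (s * t)) = t * (s * (t * s))) (q : K) :
    dihedralChain s t q q q q 0 0 = dihedralChain t s q q q q 0 0 := by
  simp only [dihedralChain, cosetTerm_zero]
  simp only [cosetTerm_eq, mul_assoc, one_mul, h]
  abel

lemma dihedralChain_symm_six {s t : G}
    (h : s * (t * (s * (t * (s * t)))) = t * (s * (t * (s * (t * s))))) (q : K) :
    dihedralChain s t q q q q q q = dihedralChain t s q q q q q q := by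
  simp only [dihedralChain]
  simp only [cosetTerm_eq, mul_assoc, one_mul, h]
  abel

/-- Type `A₂`: the element `X_s X_t X_s + c X_s` is `A B C` times the alternating sum of the
`δ_w`, where `A`, `B`, `C` belong to the positive roots `p`, `q`, `p + q`. -/
lemma divDiff_chain_three {s t : G} (hs : s * s = 1) (ht : t * t = 1) {A B C m c : K}
    (hsA : s • A = m - A) (hsB : s • B = C) (hsC : s • C = B) (htA : t • A = C)
    (h₁ : C * (A + B - m) = A * B + c) :
    divDiff s A * (divDiff t B * divDiff s A) + single 1 c * divDiff s A =
      dihedralChain s t (A * B * C) (A * B * C) (A * B * C) 0 0 0 := by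
  have e₁ := divDiff_eq_dihedralChain s t A
  have e₂ : divDiff t B * divDiff s A = dihedralChain s t (A * B) (B * C) 0 0 0 0 := by
    rw [e₁, divDiff_snd_mul_dihedralChain s ht]
    congr 1 <;> (try simp only [smul_zero, htA]) <;> ring1
  rw [e₂, divDiff_fst_mul_dihedralChain t hs, e₁, single_one_mul_dihedralChain, dihedralChain_add]
  congr 1 <;> (try simp only [smul_mul', smul_zero, hsA, hsB, hsC]) <;> try ring1
  linear_combination -A * h₁

/-- Type `B₂`, starting from the short root `p`: the element `X_t X_s X_t X_s + 2 c X_t X_s` is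
`A B C D` times the alternating sum of the `δ_w`, where `A`, `B`, `C`, `D` belong to the positive
roots `p`, `q`, `p + q`, `2 p + q`. -/
lemma divDiff_chain_four_short {s t : G} (hs : s * s = 1) (ht : t * t = 1) {A B C D m c : K}
    (hsA : s • A = m - A) (hsB : s • B = D) (hsC : s • C = C)
    (htA : t • A = C) (htB : t • B = m - B) (htC : t • C = A) (htD : t • D = D)
    (h₁ : C * (A + B - m) = A * B + c) (h₂ : D * (A + C - m) = A * C + c) :
    divDiff t B * (divDiff s A * (divDiff t B * divDiff s A) + single 1 c * divDiff s A) +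
      single 1 c * (divDiff t B * divDiff s A) =
      dihedralChain s t (A * B * C * D) (A * B * C * D) (A * B * C * D) (A * B * C * D) 0 0 := by
  have e₁ := divDiff_eq_dihedralChain s t A
  have e₂ : divDiff t B * divDiff s A = dihedralChain s t (A * B) (B * C) 0 0 0 0 := by
    rw [e₁, divDiff_snd_mul_dihedralChain s ht]
    congr 1 <;> (try simp only [smul_zero, htA]) <;> ring1
  have e₃ : divDiff s A * (divDiff t B * divDiff s A) + single 1 c * divDiff s A =
      dihedralChain s t (A * (A * B + C * D - A * C)) (A * B * C) (A * C * D) 0 0 0 := by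
    rw [e₂, divDiff_fst_mul_dihedralChain t hs, e₁, single_one_mul_dihedralChain,
      dihedralChain_add]
    congr 1 <;> (try simp only [smul_mul', smul_zero, hsA, hsB, hsC]) <;> try ring1
    linear_combination -A * h₂
  rw [e₃, divDiff_snd_mul_dihedralChain s ht, e₂, single_one_mul_dihedralChain, dihedralChain_add]
  congr 1 <;> (try simp only [smul_mul', smul_zero, smul_add, smul_sub, htA, htB, htC, htD]) <;>
    try ring1
  · linear_combination -(A * B) * h₁
  · linear_combination -(B * C) * h₁

/-- Type `B₂`, starting from the long root `q`; compare `divDiff_chain_four_short`. -/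
lemma divDiff_chain_four_long {s t : G} (hs : s * s = 1) (ht : t * t = 1) {A B C D m c : K}
    (hsA : s • A = m - A) (hsB : s • B = D) (hsC : s • C = C) (hsD : s • D = B)
    (htA : t • A = C) (htB : t • B = m - B) (htD : t • D = D)
    (h₁ : C * (A + B - m) = A * B + c) (h₂ : D * (A + C - m) = A * C + c) :
    divDiff s A * (divDiff t B * (divDiff s A * divDiff t B) + single 1 c * divDiff t B) +
      single 1 c * (divDiff s A * divDiff t B) =
      dihedralChain t s (A * B * C * D) (A * B * C * D) (A * B * C * D) (A * B * C * D) 0 0 := by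
  have e₁ := divDiff_eq_dihedralChain t s B
  have e₂ : divDiff s A * divDiff t B = dihedralChain t s (A * B) (A * D) 0 0 0 0 := by
    rw [e₁, divDiff_snd_mul_dihedralChain t hs]
    congr 1 <;> (try simp only [smul_zero, hsB]) <;> ring1
  have e₃ : divDiff t B * (divDiff s A * divDiff t B) + single 1 c * divDiff t B =
      dihedralChain t s (A * B * C) (A * B * D) (B * C * D) 0 0 0 := by
    rw [e₂, divDiff_fst_mul_dihedralChain s ht, e₁, single_one_mul_dihedralChain,
      dihedralChain_add]
    congr 1 <;> (try simp only [smul_mul', smul_zero, htA, htB, htD]) <;> try ring1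
    linear_combination -B * h₁
  rw [e₃, divDiff_snd_mul_dihedralChain t hs, e₂, single_one_mul_dihedralChain, dihedralChain_add]
  congr 1 <;> (try simp only [smul_mul', smul_zero, hsA, hsB, hsC, hsD]) <;> try ring1
  · linear_combination -(A * B) * h₂
  · linear_combination -(A * D) * h₁

/-- Type `G₂`, starting from the short root `p`: the last term of the recursion
`U_{k+1} = X U_k + c U_{k-1}`, with `X` alternately `X_t` and `X_s`, is `A B C D E G` times the
alternating sum of the `δ_w`, where the six factors belong to the positive roots `p`, `q`, `p + q`,
`2 p + q`, `3 p + q`, `3 p + 2 q`. -/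
lemma divDiff_chain_six_short {s t : G} (hs : s * s = 1) (ht : t * t = 1) {A B C D E G' m c : K}
    (hsA : s • A = m - A) (hsB : s • B = E) (hsC : s • C = D) (hsD : s • D = C) (hsE : s • E = B)
    (hsG : s • G' = G') (htA : t • A = C) (htB : t • B = m - B) (htC : t • C = A) (htD : t • D = D)
    (htE : t • E = G') (htG : t • G' = E) (hsm : s • m = m) (hsc : s • c = c)
    (htm : t • m = m) (htc : t • c = c)
    (h₁ : C * (A + B - m) = A * B + c) (h₂ : D * (A + C - m) = A * C + c)
    (h₃ : E * (A + D - m) = A * D + c) (h₄ : G' * (B + E - m) = B * E + c)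
    {U₁ U₂ U₃ U₄ U₅ U₆ : SkewMonoidAlgebra K G}
    (e₁ : U₁ = divDiff s A) (e₂ : U₂ = divDiff t B * U₁)
    (e₃ : U₃ = divDiff s A * U₂ + single 1 c * U₁) (e₄ : U₄ = divDiff t B * U₃ + single 1 c * U₂)
    (e₅ : U₅ = divDiff s A * U₄ + single 1 c * U₃) (e₆ : U₆ = divDiff t B * U₅ + single 1 c * U₄)
    {q : K} (hq : q = A * B * C * D * E * G') :
    U₆ = dihedralChain s t q q q q q q := by
  rw [divDiff_eq_dihedralChain s t] at e₁
  replace e₂ : U₂ = dihedralChain s t (A * B) (B * C) 0 0 0 0 := by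
    rw [e₂, e₁, divDiff_snd_mul_dihedralChain s ht]
    congr 1 <;> (try simp only [smul_zero, htA]) <;> ring1
  replace e₃ : U₃ = dihedralChain s t (A * (A * B + D * E - A * D)) (A * B * C) (A * D * E)
      0 0 0 := by
    rw [e₃, e₂, e₁, divDiff_fst_mul_dihedralChain t hs, single_one_mul_dihedralChain,
      dihedralChain_add]
    congr 1 <;> (try simp only [smul_mul', smul_zero, hsA, hsB, hsC]) <;> try ring1
    linear_combination -A * h₃
  replace e₄ : U₄ = dihedralChain s t (A * B * (D * (C + E - m) - c))
      (B * C * (D * (A + G' - m) - c)) (A * B * D * E) (B * C * D * G') 0 0 := by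
    rw [e₄, e₃, e₂, divDiff_snd_mul_dihedralChain s ht, single_one_mul_dihedralChain,
      dihedralChain_add]
    congr 1 <;>
      (try simp only [smul_mul', smul_zero, smul_add, smul_sub, htA, htB, htC, htD, htE]) <;>
      try ring1
    · linear_combination -(A * B) * h₁ - A * B * h₂
    · linear_combination -(B * C) * h₁ - B * C * h₂
  replace e₅ : U₅ = dihedralChain s t
      (A * (A * B * (D * (C + E - m) - c) + (m - A) * E * (C * (B + D - m) - c) +
        c * (A * B + D * E - A * D)))
      (A * B * C * (D * (E + G' - m) - c)) (A * D * E * (C * (B + G' - m) - c))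
      (A * B * C * D * G') (A * C * D * E * G') 0 := by
    rw [e₅, e₄, e₃, divDiff_fst_mul_dihedralChain t hs, single_one_mul_dihedralChain,
      dihedralChain_add]
    congr 1 <;>
      (try simp only [smul_mul', smul_zero, smul_add, smul_sub, hsA, hsB, hsC, hsD, hsE, hsG, hsm,
        hsc]) <;> try ring1
    · linear_combination -(A * B * C) * h₃
    · linear_combination -(A * D * E) * h₁
  rw [e₆, e₅, e₄, divDiff_snd_mul_dihedralChain s ht, single_one_mul_dihedralChain,
    dihedralChain_add, hq]
  congr 1 <;>
    (try simp only [smul_mul', smul_zero, smul_add, smul_sub, htA, htB, htC, htD, htE, htG, htm,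
      htc]) <;> try ring1
  · linear_combination (A * B) * ((D * m - D * E) * h₁ + (C * m + c - B * C) * h₃ - C * D * h₄)
  · linear_combination (B * C) * ((G' * m + c + D * m - 2 * D * G') * h₁ +
      (B * E - E * G' + G' * m + c - B * G') * h₂ + (B * C - C * G') * h₃ +
      (2 * C * D - c - C * m - D * m) * h₄)

/-- Type `G₂`, starting from the long root `q`; compare `divDiff_chain_six_short`. -/
lemma divDiff_chain_six_long {s t : G} (hs : s * s = 1) (ht : t * t = 1) {A B C D E G' m c : K}
    (hsA : s • A = m - A) (hsB : s • B = E) (hsC : s • C = D) (hsD : s • D = C) (hsE : s • E = B)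
    (hsG : s • G' = G') (htA : t • A = C) (htB : t • B = m - B) (htC : t • C = A) (htD : t • D = D)
    (htE : t • E = G') (htG : t • G' = E) (hsm : s • m = m) (hsc : s • c = c)
    (htm : t • m = m) (htc : t • c = c)
    (h₁ : C * (A + B - m) = A * B + c) (h₂ : D * (A + C - m) = A * C + c)
    (h₃ : E * (A + D - m) = A * D + c) (h₄ : G' * (B + E - m) = B * E + c)
    {U₁ U₂ U₃ U₄ U₅ U₆ : SkewMonoidAlgebra K G}
    (e₁ : U₁ = divDiff t B) (e₂ : U₂ = divDiff s A * U₁)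
    (e₃ : U₃ = divDiff t B * U₂ + single 1 c * U₁) (e₄ : U₄ = divDiff s A * U₃ + single 1 c * U₂)
    (e₅ : U₅ = divDiff t B * U₄ + single 1 c * U₃) (e₆ : U₆ = divDiff s A * U₅ + single 1 c * U₄)
    {q : K} (hq : q = A * B * C * D * E * G') :
    U₆ = dihedralChain t s q q q q q q := by
  rw [divDiff_eq_dihedralChain t s] at e₁
  replace e₂ : U₂ = dihedralChain t s (A * B) (A * E) 0 0 0 0 := by
    rw [e₂, e₁, divDiff_snd_mul_dihedralChain t hs]
    congr 1 <;> (try simp only [smul_zero, hsB]) <;> ring1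
  replace e₃ : U₃ = dihedralChain t s (A * B * C) (A * B * E) (B * C * G') 0 0 0 := by
    rw [e₃, e₂, e₁, divDiff_fst_mul_dihedralChain s ht, single_one_mul_dihedralChain,
      dihedralChain_add]
    congr 1 <;> (try simp only [smul_mul', smul_zero, htA, htB, htE]) <;> try ring1
    linear_combination -B * h₁
  replace e₄ : U₄ = dihedralChain t s (A * B * (D * (C + E - m) - c))
      (A * E * (C * (B + D - m) - c)) (A * B * C * G') (A * D * E * G') 0 0 := by
    rw [e₄, e₃, e₂, divDiff_snd_mul_dihedralChain t hs, single_one_mul_dihedralChain,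
      dihedralChain_add]
    congr 1 <;> (try simp only [smul_mul', smul_zero, hsA, hsB, hsC, hsE, hsG]) <;> try ring1
    · linear_combination -(A * B) * h₂ - A * B * h₃
    · linear_combination -(A * E) * h₁ - A * E * h₂
  replace e₅ : U₅ = dihedralChain t s
      (B * (A * B * (D * (C + E - m) - c) + C * (m - B) * (D * (A + G' - m) - c) + c * A * C))
      (A * B * C * D * E) (A * B * C * D * G') (A * B * D * E * G') (B * C * D * E * G') 0 := by
    rw [e₅, e₄, e₃, divDiff_fst_mul_dihedralChain s ht, single_one_mul_dihedralChain,
      dihedralChain_add]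
    congr 1 <;>
      (try simp only [smul_mul', smul_zero, smul_add, smul_sub, htA, htB, htC, htD, htE, htG, htm,
        htc]) <;> ring1
  rw [e₆, e₅, e₄, divDiff_snd_mul_dihedralChain t hs, single_one_mul_dihedralChain,
    dihedralChain_add, hq]
  congr 1 <;>
    (try simp only [smul_mul', smul_zero, smul_add, smul_sub, hsA, hsB, hsC, hsD, hsE, hsG, hsm,
      hsc]) <;> try ring1
  · linear_combination (A * B) * ((D * m + c - D * E) * h₁ - C * D * h₄)
  · linear_combination (A * E) * ((C * m + c - B * C) * h₃ - C * D * h₄)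
  · linear_combination -(A * B * C * G') * h₃
  · linear_combination -(A * D * E * G') * h₁

/-- The recursion `U_{k+1} = X U_k + κ U_{k-1}` in closed form up to `k = 5`. -/
lemma dihedral_recursion_six {S : Type*} [Ring S] {X Y κ : S} (hX : X * κ = κ * X)
    (hY : Y * κ = κ * Y) :
    Y * (X * (Y * (X * (Y * X) + κ * X) + κ * (Y * X)) + κ * (X * (Y * X) + κ * X)) +
        κ * (Y * (X * (Y * X) + κ * X) + κ * (Y * X)) =
      (Y * X) ^ 3 + 4 * κ * (Y * X) ^ 2 + 3 * κ ^ 2 * (Y * X) := by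
  have hX' (z : S) : X * (κ * z) = κ * (X * z) := by rw [← mul_assoc, hX, mul_assoc]
  have hY' (z : S) : Y * (κ * z) = κ * (Y * z) := by rw [← mul_assoc, hY, mul_assoc]
  rw [show (4 : S) = 1 + 1 + 1 + 1 by norm_num, show (3 : S) = 1 + 1 + 1 by norm_num]
  simp only [mul_add, add_mul, one_mul, pow_succ, pow_zero, mul_assoc, hX', hY']
  abel

/-- The recursion `U_{k+1} = X U_k + κ U_{k-1}` in closed form up to `k = 3`. -/
lemma dihedral_recursion_four {S : Type*} [Ring S] {X Y κ : S} (hY : Y * κ = κ * Y) :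
    Y * (X * (Y * X) + κ * X) + κ * (Y * X) = (Y * X) ^ 2 + 2 * κ * (Y * X) := by
  have hY' (z : S) : Y * (κ * z) = κ * (Y * z) := by rw [← mul_assoc, hY, mul_assoc]
  rw [show (2 : S) = 1 + 1 by norm_num]
  simp only [mul_add, add_mul, one_mul, pow_succ, pow_zero, mul_assoc, hY']
  abel

lemma divDiff_mul_single_one {s : G} {c : K} (hc : s • c = c) (y : K) :
    divDiff s y * single 1 c = single 1 c * divDiff s y := by
  simp only [divDiff, mul_sub, sub_mul, mul_one, single_mul_single, one_mul, one_smul, hc]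
  rw [mul_comm y c]

/-- The braid relation of type `A₂`: both sides are the element of `divDiff_chain_three`, which is
symmetric in the two reflections. -/
lemma divDiff_braid_three {s t : G} (hs : s * s = 1) (ht : t * t = 1)
    (hst : s * (t * s) = t * (s * t)) {A B C m c : K}
    (hsA : s • A = m - A) (hsB : s • B = C) (htA : t • A = C) (htB : t • B = m - B)
    (h₁ : C * (A + B - m) = A * B + c) :
    divDiff t B * divDiff s A * divDiff t B + single 1 c * divDiff t B =
      divDiff s A * divDiff t B * divDiff s A + single 1 c * divDiff s A := by
  have hsC : s • C = B := by rw [← hsB, smul_smul, hs, one_smul]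
  have htC : t • C = A := by rw [← htA, smul_smul, ht, one_smul]
  rw [mul_assoc, mul_assoc, divDiff_chain_three hs ht hsA hsB hsC htA h₁,
    divDiff_chain_three ht hs htB htA htC hsB (by linear_combination h₁),
    dihedralChain_symm_three hst, mul_comm A B]

/-- The braid relation of type `B₂`, for `s` the reflection in the short simple root. Here `A`, `B`,
`C`, `D` belong to the positive roots `p`, `q`, `p + q`, `2 p + q`. -/
lemma divDiff_braid_four {s t : G} (hs : s * s = 1) (ht : t * t = 1)
    (hst : s * (t * (s * t)) = t * (s * (t * s))) {A B C D m c : K}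
    (hsA : s • A = m - A) (hsB : s • B = D) (hsC : s • C = C)
    (htA : t • A = C) (htB : t • B = m - B) (htD : t • D = D) (hsc : s • c = c) (htc : t • c = c)
    (h₁ : C * (A + B - m) = A * B + c) (h₂ : D * (A + C - m) = A * C + c) :
    (divDiff t B * divDiff s A) ^ 2 + 2 * single 1 c * (divDiff t B * divDiff s A) =
      (divDiff s A * divDiff t B) ^ 2 + 2 * single 1 c * (divDiff s A * divDiff t B) := by
  have hsD : s • D = B := by rw [← hsB, smul_smul, hs, one_smul]
  have htC : t • C = A := by rw [← htA, smul_smul, ht, one_smul]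
  rw [← dihedral_recursion_four (divDiff_mul_single_one htc B),
    ← dihedral_recursion_four (divDiff_mul_single_one hsc A),
    divDiff_chain_four_short hs ht hsA hsB hsC htA htB htC htD h₁ h₂,
    divDiff_chain_four_long hs ht hsA hsB hsC hsD htA htB htD h₁ h₂, dihedralChain_symm_four hst]

/-- The braid relation of type `G₂`, for `s` the reflection in the short simple root. Here `A`, `B`,
`C`, `D`, `E`, `G'` belong to the positive roots `p`, `q`, `p + q`, `2 p + q`, `3 p + q`,
`3 p + 2 q`. -/
lemma divDiff_braid_six {s t : G} (hs : s * s = 1) (ht : t * t = 1)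
    (hst : s * (t * (s * (t * (s * t)))) = t * (s * (t * (s * (t * s))))) {A B C D E G' m c : K}
    (hsA : s • A = m - A) (hsB : s • B = E) (hsC : s • C = D) (hsG : s • G' = G')
    (htA : t • A = C) (htB : t • B = m - B) (htD : t • D = D) (htE : t • E = G')
    (hsm : s • m = m) (hsc : s • c = c) (htm : t • m = m) (htc : t • c = c)
    (h₁ : C * (A + B - m) = A * B + c) (h₂ : D * (A + C - m) = A * C + c)
    (h₃ : E * (A + D - m) = A * D + c) (h₄ : G' * (B + E - m) = B * E + c) :
    (divDiff t B * divDiff s A) ^ 3 + 4 * single 1 c * (divDiff t B * divDiff s A) ^ 2 +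
        3 * single 1 c ^ 2 * (divDiff t B * divDiff s A) =
      (divDiff s A * divDiff t B) ^ 3 + 4 * single 1 c * (divDiff s A * divDiff t B) ^ 2 +
        3 * single 1 c ^ 2 * (divDiff s A * divDiff t B) := by
  have hsE : s • E = B := by rw [← hsB, smul_smul, hs, one_smul]
  have hsD : s • D = C := by rw [← hsC, smul_smul, hs, one_smul]
  have htC : t • C = A := by rw [← htA, smul_smul, ht, one_smul]
  have htG : t • G' = E := by rw [← htE, smul_smul, ht, one_smul]
  have hcs := divDiff_mul_single_one hsc A
  have hct := divDiff_mul_single_one htc B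
  rw [← dihedral_recursion_six hcs hct, ← dihedral_recursion_six hct hcs,
    divDiff_chain_six_short hs ht hsA hsB hsC hsD hsE hsG htA htB htC htD htE htG hsm hsc htm htc
      h₁ h₂ h₃ h₄ rfl rfl rfl rfl rfl rfl rfl,
    divDiff_chain_six_long hs ht hsA hsB hsC hsD hsE hsG htA htB htC htD htE htG hsm hsc htm htc
      h₁ h₂ h₃ h₄ rfl rfl rfl rfl rfl rfl rfl, dihedralChain_symm_six hst]

end RankTwo

/-! ### Truncations of the hyperbolic formal group law -/

section Truncation

variable {R : Type*} [CommRing R] (μ₁ μ₂ : R)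

lemma hyperbolicSeries_eq : hyperbolicSeries μ₁ μ₂ = MvPowerSeries.X 0 + MvPowerSeries.X 1 +
    MvPowerSeries.monomial (Finsupp.single 0 1 + Finsupp.single 1 1) (1 : R) *
      (-(MvPowerSeries.C μ₁) - MvPowerSeries.C μ₂ * hyperbolicSeries μ₁ μ₂) := by
  have e := hyperbolicDenom_mul_series μ₁ μ₂
  have m : MvPowerSeries.monomial (Finsupp.single (0 : Fin 2) 1 + Finsupp.single 1 1) (1 : R) =
      MvPowerSeries.X 0 * MvPowerSeries.X 1 := by
    simp [MvPowerSeries.X, MvPowerSeries.monomial_mul_monomial]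
  rw [m]
  rw [hyperbolicDenom] at e
  linear_combination e

/-- The coefficient of `u ^ i * v ^ j` in the hyperbolic formal group law. -/
def hyperbolicCoeff (i j : ℕ) : R :=
  MvPowerSeries.coeff (Finsupp.single 0 i + Finsupp.single 1 j) (hyperbolicSeries μ₁ μ₂)

lemma hyperbolicCoeff_zero_right (i : ℕ) :
    hyperbolicCoeff μ₁ μ₂ i 0 = if i = 1 then 1 else 0 := by
  have hle : ¬ (Finsupp.single (0 : Fin 2) 1 + Finsupp.single 1 1 ≤
      Finsupp.single 0 i + Finsupp.single 1 0) := fun h => by simpa using h 1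
  rw [hyperbolicCoeff, hyperbolicSeries_eq, map_add, map_add, MvPowerSeries.coeff_monomial_mul,
    if_neg hle, MvPowerSeries.coeff_X, MvPowerSeries.coeff_X]
  have h1 : ¬ (Finsupp.single (0 : Fin 2) i = Finsupp.single 1 1) := fun h => by
    simpa using DFunLike.congr_fun h 1
  have h0 : (Finsupp.single (0 : Fin 2) i = Finsupp.single 0 1) ↔ i = 1 :=
    (Finsupp.single_injective 0).eq_iff
  simp [h1, h0]

lemma hyperbolicCoeff_zero_left (j : ℕ) :
    hyperbolicCoeff μ₁ μ₂ 0 j = if j = 1 then 1 else 0 := by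
  have hle : ¬ (Finsupp.single (0 : Fin 2) 1 + Finsupp.single 1 1 ≤
      Finsupp.single 0 0 + Finsupp.single 1 j) := fun h => by simpa using h 0
  rw [hyperbolicCoeff, hyperbolicSeries_eq, map_add, map_add, MvPowerSeries.coeff_monomial_mul,
    if_neg hle, MvPowerSeries.coeff_X, MvPowerSeries.coeff_X]
  have h1 : ¬ (Finsupp.single (1 : Fin 2) j = Finsupp.single 0 1) := fun h => by
    simpa using DFunLike.congr_fun h 0
  have h0 : (Finsupp.single (1 : Fin 2) j = Finsupp.single 1 1) ↔ j = 1 :=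
    (Finsupp.single_injective 1).eq_iff
  simp [h1, h0]

lemma hyperbolicCoeff_succ_succ (i j : ℕ) :
    hyperbolicCoeff μ₁ μ₂ (i + 1) (j + 1) =
      (if i = 0 ∧ j = 0 then -μ₁ else 0) - μ₂ * hyperbolicCoeff μ₁ μ₂ i j := by
  have hsum : Finsupp.single (0 : Fin 2) (i + 1) + Finsupp.single 1 (j + 1) =
      (Finsupp.single 0 1 + Finsupp.single 1 1) + (Finsupp.single 0 i + Finsupp.single 1 j) := by
    rw [Finsupp.single_add, Finsupp.single_add]; abel
  have h0 : ¬ (Finsupp.single (0 : Fin 2) (i + 1) + Finsupp.single 1 (j + 1) =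
      Finsupp.single 0 1) := fun h => by simpa using DFunLike.congr_fun h 1
  have h1 : ¬ (Finsupp.single (0 : Fin 2) (i + 1) + Finsupp.single 1 (j + 1) =
      Finsupp.single 1 1) := fun h => by simpa using DFunLike.congr_fun h 0
  rw [hyperbolicCoeff, hyperbolicSeries_eq, map_add, map_add, MvPowerSeries.coeff_X,
    MvPowerSeries.coeff_X, if_neg h0, if_neg h1, hsum, MvPowerSeries.coeff_add_monomial_mul,
    map_sub, map_neg, MvPowerSeries.coeff_C_mul, MvPowerSeries.coeff_C, hyperbolicCoeff]
  have hz : (Finsupp.single (0 : Fin 2) i + Finsupp.single 1 j = 0) ↔ i = 0 ∧ j = 0 := by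
    rw [add_eq_zero]; simp
  simp only [hz]
  split_ifs <;> ring

variable {S : Type*} [CommRing S] [Algebra R S]

/-- Truncating the functional equation `F = u + v - μ₁ u v - μ₂ u v F`. -/
lemma truncEval_hyperbolicSeries_succ (a b : S) (n : ℕ) :
    truncEval (hyperbolicSeries μ₁ μ₂) a b (n + 2) = a + b - algebraMap R S μ₁ * a * b -
      algebraMap R S μ₂ * a * b * truncEval (hyperbolicSeries μ₁ μ₂) a b (n + 1) := by
  have e : ∀ n, truncEval (hyperbolicSeries μ₁ μ₂) a b n = ∑ i ∈ Finset.range n,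
      ∑ j ∈ Finset.range n, algebraMap R S (hyperbolicCoeff μ₁ μ₂ i j) * a ^ i * b ^ j :=
    fun n => rfl
  have h₁ : ∑ i ∈ Finset.range (n + 1),
      algebraMap R S (hyperbolicCoeff μ₁ μ₂ (i + 1) 0) * a ^ (i + 1) * b ^ 0 = a := by
    rw [Finset.sum_range_succ']
    simp [hyperbolicCoeff_zero_right]
  have h₂ : ∑ j ∈ Finset.range (n + 2),
      algebraMap R S (hyperbolicCoeff μ₁ μ₂ 0 j) * a ^ 0 * b ^ j = b := by
    rw [Finset.sum_range_succ', Finset.sum_range_succ']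
    simp [hyperbolicCoeff_zero_left]
  have h₃ : ∑ i ∈ Finset.range (n + 1), ∑ j ∈ Finset.range (n + 1),
      (if i = 0 ∧ j = 0 then algebraMap R S (-μ₁) else 0) * a ^ (i + 1) * b ^ (j + 1) =
      - (algebraMap R S μ₁ * a * b) := by
    rw [Finset.sum_range_succ', Finset.sum_range_succ' _ n]
    simp
  rw [e, Finset.sum_range_succ', h₂]
  simp only [Finset.sum_range_succ' _ (n + 1)]
  rw [Finset.sum_add_distrib, h₁, e (n + 1), Finset.mul_sum]
  have h₄ : ∀ i ∈ Finset.range (n + 1), ∑ j ∈ Finset.range (n + 1),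
      algebraMap R S (hyperbolicCoeff μ₁ μ₂ (i + 1) (j + 1)) * a ^ (i + 1) * b ^ (j + 1) =
      (∑ j ∈ Finset.range (n + 1),
        (if i = 0 ∧ j = 0 then algebraMap R S (-μ₁) else 0) * a ^ (i + 1) * b ^ (j + 1)) -
      algebraMap R S μ₂ * a * b * ∑ j ∈ Finset.range (n + 1),
        algebraMap R S (hyperbolicCoeff μ₁ μ₂ i j) * a ^ i * b ^ j := by
    intro i _
    rw [Finset.mul_sum, ← Finset.sum_sub_distrib]
    refine Finset.sum_congr rfl fun j _ => ?_
    rw [hyperbolicCoeff_succ_succ, map_sub, map_mul, apply_ite (algebraMap R S), map_zero]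
    ring
  rw [Finset.sum_congr rfl h₄, Finset.sum_sub_distrib, h₃]
  ring

/-- The truncations of `F(a, b)` satisfy the defining equation of `F(a, b)` up to `I ^ n`. -/
lemma truncEval_hyperbolicSeries_mem {I : Ideal S} {a b : S} (ha : a ∈ I) (hb : b ∈ I) (n : ℕ) :
    (1 + algebraMap R S μ₂ * a * b) * truncEval (hyperbolicSeries μ₁ μ₂) a b n -
      (a + b - algebraMap R S μ₁ * a * b) ∈ I ^ n := by
  match n with
  | 0 => simp
  | 1 =>
    rw [pow_one]
    refine I.sub_mem (I.mul_mem_left _ ?_) (I.sub_mem (I.add_mem ha hb) (I.mul_mem_left _ hb))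
    have : truncEval (hyperbolicSeries μ₁ μ₂) a b 1 =
        algebraMap R S (hyperbolicCoeff μ₁ μ₂ 0 0) * a ^ 0 * b ^ 0 := by
      simp [truncEval, hyperbolicCoeff]
    rw [this, hyperbolicCoeff_zero_right]
    simp
  | n + 2 =>
    have h := truncEval_succ_sub_mem (hyperbolicSeries μ₁ μ₂) ha hb (n + 1)
    have e : (1 + algebraMap R S μ₂ * a * b) * truncEval (hyperbolicSeries μ₁ μ₂) a b (n + 2) -
        (a + b - algebraMap R S μ₁ * a * b) =
        algebraMap R S μ₂ * b * (a * (truncEval (hyperbolicSeries μ₁ μ₂) a b (n + 1 + 1) -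
          truncEval (hyperbolicSeries μ₁ μ₂) a b (n + 1))) := by
      linear_combination truncEval_hyperbolicSeries_succ μ₁ μ₂ a b n
    rw [e, pow_succ' I (n + 1)]
    exact Ideal.mul_mem_left _ _ (Ideal.mul_mem_mul ha h)

end Truncation

/-! ### The group of points of the hyperbolic formal group law -/

section Points

variable {R : Type*} [CommRing R]

lemma isUnit_of_constantCoeff_eq_one {σ : Type*} {f : MvPowerSeries σ R}
    (h : MvPowerSeries.constantCoeff f = 1) : IsUnit f :=
  MvPowerSeries.isUnit_iff_constantCoeff.2 (h ▸ isUnit_one)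

/-- The power series without constant term, with the group structure given by the hyperbolic formal
group law. -/
@[ext]
structure HyperbolicPoint (μ₁ μ₂ : R) (σ : Type*) where
  val : MvPowerSeries σ R
  constantCoeff_val : MvPowerSeries.constantCoeff val = 0

namespace HyperbolicPoint

variable {μ₁ μ₂ : R} {σ : Type*}

lemma isUnit_denom (u v : HyperbolicPoint μ₁ μ₂ σ) :
    IsUnit (1 + MvPowerSeries.C μ₂ * u.val * v.val) :=
  isUnit_of_constantCoeff_eq_one (by simp [constantCoeff_val])

instance : Zero (HyperbolicPoint μ₁ μ₂ σ) := ⟨⟨0, map_zero _⟩⟩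

instance : Add (HyperbolicPoint μ₁ μ₂ σ) :=
  ⟨fun u v => ⟨(u.val + v.val - MvPowerSeries.C μ₁ * u.val * v.val) *
    ((isUnit_denom u v).unit⁻¹ : (MvPowerSeries σ R)ˣ).val, by simp [constantCoeff_val]⟩⟩

lemma isUnit_negDenom (u : HyperbolicPoint μ₁ μ₂ σ) : IsUnit (1 - MvPowerSeries.C μ₁ * u.val) :=
  isUnit_of_constantCoeff_eq_one (by simp [constantCoeff_val])

instance : Neg (HyperbolicPoint μ₁ μ₂ σ) :=
  ⟨fun u => ⟨-u.val * ((isUnit_negDenom u).unit⁻¹ : (MvPowerSeries σ R)ˣ).val,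
    by simp [constantCoeff_val]⟩⟩

@[simp] lemma val_zero : (0 : HyperbolicPoint μ₁ μ₂ σ).val = 0 := rfl

lemma denom_mul_val_add (u v : HyperbolicPoint μ₁ μ₂ σ) :
    (1 + MvPowerSeries.C μ₂ * u.val * v.val) * (u + v).val =
      u.val + v.val - MvPowerSeries.C μ₁ * u.val * v.val := by
  change _ * (_ * ((isUnit_denom u v).unit⁻¹ : (MvPowerSeries σ R)ˣ).val) = _
  rw [mul_left_comm, (isUnit_denom u v).mul_val_inv, mul_one]

lemma negDenom_mul_val_neg (u : HyperbolicPoint μ₁ μ₂ σ) :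
    (1 - MvPowerSeries.C μ₁ * u.val) * (-u).val = -u.val := by
  change _ * (_ * ((isUnit_negDenom u).unit⁻¹ : (MvPowerSeries σ R)ˣ).val) = _
  rw [mul_left_comm, (isUnit_negDenom u).mul_val_inv, mul_one]

lemma add_eq_of {u v w : HyperbolicPoint μ₁ μ₂ σ}
    (h : (1 + MvPowerSeries.C μ₂ * u.val * v.val) * w.val =
      u.val + v.val - MvPowerSeries.C μ₁ * u.val * v.val) : u + v = w :=
  HyperbolicPoint.ext ((isUnit_denom u v).mul_left_cancel ((denom_mul_val_add u v).trans h.symm))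

instance : AddCommGroup (HyperbolicPoint μ₁ μ₂ σ) :=
  { AddGroup.ofLeftAxioms
      (fun u v w => by
        have e₁ := denom_mul_val_add (u + v) w
        have e₂ := denom_mul_val_add u (v + w)
        have i₁ := denom_mul_val_add u v
        have i₂ := denom_mul_val_add v w
        have hD : IsUnit (1 + MvPowerSeries.C μ₂ * u.val * v.val +
            MvPowerSeries.C μ₂ * u.val * w.val + MvPowerSeries.C μ₂ * v.val * w.val -
            MvPowerSeries.C μ₁ * MvPowerSeries.C μ₂ * u.val * v.val * w.val) :=
          isUnit_of_constantCoeff_eq_one (by simp [constantCoeff_val])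
        refine HyperbolicPoint.ext (hD.mul_left_cancel ?_)
        linear_combination (1 + MvPowerSeries.C μ₂ * u.val * v.val) * e₁ -
          (1 + MvPowerSeries.C μ₂ * v.val * w.val) * e₂ +
          (1 - MvPowerSeries.C μ₁ * w.val - MvPowerSeries.C μ₂ * w.val * (u + v + w).val) * i₁ -
          (1 - MvPowerSeries.C μ₁ * u.val -
            MvPowerSeries.C μ₂ * u.val * (u + (v + w)).val) * i₂)
      (fun u => add_eq_of (by simp))
      (fun u => add_eq_of (by
        rw [val_zero, mul_zero]
        linear_combination -negDenom_mul_val_neg u)) with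
    add_comm := fun u v => add_eq_of (by linear_combination denom_mul_val_add v u) }

end HyperbolicPoint

end Points

/-! ### The formal group algebra as a power series ring -/

section SeriesHom

variable {R : Type*} [CommRing R] {σ : Type*}

variable (R σ) in
/-- The ideal of the power series of order at least `N`. -/
def orderIdeal (N : ℕ) : Ideal (MvPowerSeries σ R) where
  carrier := {f | (N : ℕ∞) ≤ f.order}
  zero_mem' := by simp
  add_mem' := fun hf hg => (le_min hf hg).trans MvPowerSeries.min_order_le_add
  smul_mem' := fun _ _ hf => (le_add_left hf).trans MvPowerSeries.le_order_mul

lemma mem_orderIdeal {N : ℕ} {f : MvPowerSeries σ R} :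
    f ∈ orderIdeal R σ N ↔ ∀ d : σ →₀ ℕ, d.degree < N → MvPowerSeries.coeff d f = 0 :=
  ⟨fun h _ hd => MvPowerSeries.coeff_of_lt_order (lt_of_lt_of_le (by exact_mod_cast hd) h),
    fun h => MvPowerSeries.nat_le_order h⟩

lemma eq_zero_of_forall_mem_orderIdeal {f : MvPowerSeries σ R}
    (h : ∀ N, f ∈ orderIdeal R σ N) : f = 0 :=
  MvPowerSeries.ext fun d => mem_orderIdeal.1 (h (d.degree + 1)) d (Nat.lt_succ_self _)

lemma orderIdeal_one_pow_le (N : ℕ) : orderIdeal R σ 1 ^ N ≤ orderIdeal R σ N := by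
  induction N with
  | zero => exact fun f _ => mem_orderIdeal.2 fun d hd => absurd hd (Nat.not_lt_zero _)
  | succ N ih =>
    rw [pow_succ, Ideal.mul_le]
    intro f hf g hg
    have h : ((N + 1 : ℕ) : ℕ∞) ≤ f.order + g.order := by
      push_cast
      exact add_le_add (ih hf) (by simpa using (show ((1 : ℕ) : ℕ∞) ≤ g.order from hg))
    exact h.trans MvPowerSeries.le_order_mul

lemma mem_orderIdeal_one {f : MvPowerSeries σ R} :
    f ∈ orderIdeal R σ 1 ↔ MvPowerSeries.constantCoeff f = 0 := by
  rw [← MvPowerSeries.one_le_order_iff_constCoeff_eq_zero]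
  change ((1 : ℕ) : ℕ∞) ≤ f.order ↔ _
  rw [Nat.cast_one]

variable {Λ : Type*} (g : Λ → MvPowerSeries σ R)

/-- A continuous evaluation `R⟦x_λ⟧ → R⟦t⟧`, `x_λ ↦ g λ`, as a function: its coefficients are those
of the evaluation of a polynomial approximating the argument to a sufficiently high order. -/
def seriesEvalFun (y : CompletedPoly R Λ) : MvPowerSeries σ R := fun d =>
  MvPowerSeries.coeff d (MvPolynomial.aeval g
    ((AdicCompletion.mk_surjective (augIdeal R Λ) (MvPolynomial Λ R) y).choose (d.degree + 1)))

variable {g}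

lemma aeval_mem_orderIdeal (hg : ∀ l, MvPowerSeries.constantCoeff (g l) = 0) {N : ℕ}
    {p : MvPolynomial Λ R} (hp : p ∈ augIdeal R Λ ^ N) :
    MvPolynomial.aeval g p ∈ orderIdeal R σ N := by
  have h : augIdeal R Λ ≤ (orderIdeal R σ 1).comap (MvPolynomial.aeval g) := by
    intro q hq
    rw [Ideal.mem_comap, mem_orderIdeal_one]
    have e : MvPowerSeries.constantCoeff (MvPolynomial.aeval g q) =
        MvPolynomial.aeval (fun _ => (0 : R)) q := by
      rw [MvPolynomial.aeval_def, MvPolynomial.hom_eval₂, MvPolynomial.aeval_def]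
      congr 1
      funext l; exact hg l
    rw [e]
    exact hq
  exact orderIdeal_one_pow_le N ((Ideal.pow_right_mono h N).trans (Ideal.le_comap_pow _ N) hp)

lemma seriesEvalFun_sub_mem (hg : ∀ l, MvPowerSeries.constantCoeff (g l) = 0) {N : ℕ}
    {y : CompletedPoly R Λ} {p : MvPolynomial Λ R}
    (h : AdicCompletion.evalₐ (augIdeal R Λ) N y = Ideal.Quotient.mk _ p) :
    seriesEvalFun g y - MvPolynomial.aeval g p ∈ orderIdeal R σ N := by
  rw [mem_orderIdeal]
  intro d hd
  have hy := (AdicCompletion.mk_surjective (augIdeal R Λ) (MvPolynomial Λ R) y).choose_spec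
  have e : MvPowerSeries.coeff d (seriesEvalFun g y) = MvPowerSeries.coeff d (MvPolynomial.aeval g
    ((AdicCompletion.mk_surjective (augIdeal R Λ) (MvPolynomial Λ R) y).choose (d.degree + 1))) :=
    rfl
  set a := (AdicCompletion.mk_surjective (augIdeal R Λ) (MvPolynomial Λ R) y).choose
  rw [← hy, AdicCompletion.evalₐ_mk] at h
  have h₁ : a N - p ∈ augIdeal R Λ ^ N := Ideal.Quotient.eq.1 h
  have h₂ : a N - a (d.degree + 1) ∈ augIdeal R Λ ^ (d.degree + 1) :=
    Ideal.Quotient.eq.1 (AdicCompletion.Ideal.mk_eq_mk (augIdeal R Λ) hd a)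
  have c₁ := mem_orderIdeal.1 (aeval_mem_orderIdeal hg h₁) d hd
  have c₂ := mem_orderIdeal.1 (aeval_mem_orderIdeal hg h₂) d (Nat.lt_succ_self _)
  rw [map_sub, map_sub] at c₁ c₂
  rw [map_sub, e]
  linear_combination c₁ - c₂

lemma exists_evalₐ_eq (N : ℕ) (y : CompletedPoly R Λ) :
    ∃ p, AdicCompletion.evalₐ (augIdeal R Λ) N y = Ideal.Quotient.mk _ p :=
  (Ideal.Quotient.mk_surjective _).imp fun _ h => h.symm

/-- To identify `seriesEvalFun g y`, it is enough to know it modulo every order. -/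
lemma seriesEvalFun_eq (hg : ∀ l, MvPowerSeries.constantCoeff (g l) = 0)
    {y : CompletedPoly R Λ} {f : MvPowerSeries σ R}
    (h : ∀ N p, AdicCompletion.evalₐ (augIdeal R Λ) N y = Ideal.Quotient.mk _ p →
      f - MvPolynomial.aeval g p ∈ orderIdeal R σ N) : seriesEvalFun g y = f := by
  refine sub_eq_zero.1 (eq_zero_of_forall_mem_orderIdeal fun N => ?_)
  obtain ⟨p, hp⟩ := exists_evalₐ_eq N y
  have := Ideal.sub_mem _ (seriesEvalFun_sub_mem hg hp) (h N p hp)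
  rwa [sub_sub_sub_cancel_right] at this

/-- The continuous evaluation `R⟦x_λ⟧ → R⟦t⟧`, `x_λ ↦ g λ`, where the `g λ` have no constant
term. -/
def seriesEval (g : Λ → MvPowerSeries σ R) (hg : ∀ l, MvPowerSeries.constantCoeff (g l) = 0) :
    CompletedPoly R Λ →ₐ[R] MvPowerSeries σ R :=
  AlgHom.ofLinearMap
    { toFun := seriesEvalFun g
      map_add' := fun y z => by
        refine sub_eq_zero.1 (eq_zero_of_forall_mem_orderIdeal fun N => ?_)
        obtain ⟨p, hp⟩ := exists_evalₐ_eq N y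
        obtain ⟨q, hq⟩ := exists_evalₐ_eq N z
        have h := seriesEvalFun_sub_mem (g := g) hg (N := N) (y := y + z) (p := p + q)
          (by rw [map_add, map_add, hp, hq])
        have := Ideal.sub_mem _ h (Ideal.add_mem _ (seriesEvalFun_sub_mem hg hp)
          (seriesEvalFun_sub_mem hg hq))
        rw [map_add] at this
        convert this using 1
        ring
      map_smul' := fun r y => by
        refine sub_eq_zero.1 (eq_zero_of_forall_mem_orderIdeal fun N => ?_)
        obtain ⟨p, hp⟩ := exists_evalₐ_eq N y
        have h := seriesEvalFun_sub_mem (g := g) hg (N := N) (y := r • y) (p := r • p) (by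
          have := map_smul ((AdicCompletion.evalₐ (augIdeal R Λ) N).restrictScalars R) r y
          exact this.trans (congrArg (fun z => r • z) hp))
        have := Ideal.sub_mem _ h (Submodule.smul_of_tower_mem (orderIdeal R σ N) r
          (seriesEvalFun_sub_mem hg hp))
        rw [map_smul, smul_sub, sub_sub_sub_cancel_right] at this
        exact this }
    (by
      refine seriesEvalFun_eq hg fun N p h => ?_
      rw [map_one, ← map_one (Ideal.Quotient.mk _), Ideal.Quotient.eq] at h
      simpa using aeval_mem_orderIdeal hg h)
    (fun y z => by
      refine sub_eq_zero.1 (eq_zero_of_forall_mem_orderIdeal fun N => ?_)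
      obtain ⟨p, hp⟩ := exists_evalₐ_eq N y
      obtain ⟨q, hq⟩ := exists_evalₐ_eq N z
      have h := seriesEvalFun_sub_mem (g := g) hg (N := N) (y := y * z) (p := p * q)
        (by rw [map_mul, map_mul, hp, hq])
      have := Ideal.sub_mem _ h (Ideal.add_mem _
        (Ideal.mul_mem_left _ (MvPolynomial.aeval g q) (seriesEvalFun_sub_mem hg hp))
        (Ideal.mul_mem_left _ (seriesEvalFun g y) (seriesEvalFun_sub_mem hg hq)))
      rw [map_mul] at this
      convert this using 1
      change seriesEvalFun g (y * z) - seriesEvalFun g y * seriesEvalFun g z = _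
      ring)

lemma seriesEval_sub_mem (hg : ∀ l, MvPowerSeries.constantCoeff (g l) = 0) {N : ℕ}
    {y : CompletedPoly R Λ} {p : MvPolynomial Λ R}
    (h : AdicCompletion.evalₐ (augIdeal R Λ) N y = Ideal.Quotient.mk _ p) :
    seriesEval g hg y - MvPolynomial.aeval g p ∈ orderIdeal R σ N :=
  seriesEvalFun_sub_mem hg h

lemma seriesEval_xHat (hg : ∀ l, MvPowerSeries.constantCoeff (g l) = 0) (l : Λ) :
    seriesEval g hg (xHat R l) = g l := by
  refine sub_eq_zero.1 (eq_zero_of_forall_mem_orderIdeal fun N => ?_)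
  have h := seriesEval_sub_mem hg (N := N) (AdicCompletion.evalₐ_of (augIdeal R Λ) N
    (MvPolynomial.X l : MvPolynomial Λ R))
  rwa [MvPolynomial.aeval_X] at h

end SeriesHom

section Coordinates

variable {R : Type*} [CommRing R] (μ₁ μ₂ : R) {Λ : Type*} [AddCommGroup Λ] {σ : Type*}
  (b : Module.Basis σ ℤ Λ)

/-- The homomorphism from `Λ` to the points of the formal group law sending the basis to the
coordinates. -/
def basisPoint : Λ →+ HyperbolicPoint μ₁ μ₂ σ :=
  (b.constr ℤ fun i => (⟨MvPowerSeries.X i, MvPowerSeries.constantCoeff_X i⟩ :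
    HyperbolicPoint μ₁ μ₂ σ)).toAddMonoidHom

lemma basisPoint_basis (i : σ) : (basisPoint μ₁ μ₂ b (b i)).val = MvPowerSeries.X i := by
  change (b.constr ℤ _ (b i) : HyperbolicPoint μ₁ μ₂ σ).val = _
  rw [b.constr_basis]

/-- The power series in the coordinates that represents `x_λ`. -/
def basisSeries (l : Λ) : MvPowerSeries σ R := (basisPoint μ₁ μ₂ b l).val

lemma constantCoeff_basisSeries (l : Λ) :
    MvPowerSeries.constantCoeff (basisSeries μ₁ μ₂ b l) = 0 :=
  (basisPoint μ₁ μ₂ b l).constantCoeff_val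

lemma basisSeries_zero : basisSeries μ₁ μ₂ b 0 = 0 := by
  rw [basisSeries, map_zero, HyperbolicPoint.val_zero]

lemma basisSeries_add (l l' : Λ) :
    (1 + MvPowerSeries.C μ₂ * basisSeries μ₁ μ₂ b l * basisSeries μ₁ μ₂ b l') *
        basisSeries μ₁ μ₂ b (l + l') =
      basisSeries μ₁ μ₂ b l + basisSeries μ₁ μ₂ b l' -
        MvPowerSeries.C μ₁ * basisSeries μ₁ μ₂ b l * basisSeries μ₁ μ₂ b l' := by
  simp only [basisSeries, map_add]
  exact HyperbolicPoint.denom_mul_val_add _ _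

lemma truncEval_map {S T : Type*} [CommRing S] [CommRing T] [Algebra R S] [Algebra R T]
    (f : S →ₐ[R] T) (F : MvPowerSeries (Fin 2) R) (a b : S) (n : ℕ) :
    f (truncEval F a b n) = truncEval F (f a) (f b) n := by
  simp [truncEval]

/-- The evaluation `R⟦x_λ⟧ → R⟦t⟧` in the coordinates given by a basis. -/
def coordEval : CompletedPoly R Λ →ₐ[R] MvPowerSeries σ R :=
  seriesEval (basisSeries μ₁ μ₂ b) (constantCoeff_basisSeries μ₁ μ₂ b)

lemma coordEval_sub_mem {N : ℕ} {y : CompletedPoly R Λ} {p : MvPolynomial Λ R}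
    (h : AdicCompletion.evalₐ (augIdeal R Λ) N y = Ideal.Quotient.mk _ p) :
    coordEval μ₁ μ₂ b y - MvPolynomial.aeval (basisSeries μ₁ μ₂ b) p ∈ orderIdeal R σ N :=
  seriesEval_sub_mem _ h

lemma evalₐ_formalSum {Λ : Type*} (F : FormalGroup R) (N : ℕ) (l l' : Λ) :
    AdicCompletion.evalₐ (augIdeal R Λ) N (formalSum F l l') =
      Ideal.Quotient.mk _ (truncEval F.toPowerSeries (MvPolynomial.X l) (MvPolynomial.X l') N) := by
  rw [formalSum, AdicCompletion.evalₐ_mk]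
  rfl

lemma coordEval_formalSum (l l' : Λ) :
    coordEval μ₁ μ₂ b (formalSum (hyperbolicFGL μ₁ μ₂) l l') = basisSeries μ₁ μ₂ b (l + l') := by
  refine sub_eq_zero.1 (eq_zero_of_forall_mem_orderIdeal fun N => ?_)
  have h := coordEval_sub_mem μ₁ μ₂ b (evalₐ_formalSum (hyperbolicFGL μ₁ μ₂) N l l')
  rw [truncEval_map, MvPolynomial.aeval_X, MvPolynomial.aeval_X] at h
  have hc := constantCoeff_basisSeries μ₁ μ₂ b
  have h₁ := orderIdeal_one_pow_le N (truncEval_hyperbolicSeries_mem μ₁ μ₂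
    (mem_orderIdeal_one.2 (hc l)) (mem_orderIdeal_one.2 (hc l')) N)
  rw [MvPowerSeries.algebraMap_apply, MvPowerSeries.algebraMap_apply, Algebra.algebraMap_self,
    RingHom.id_apply, RingHom.id_apply, ← basisSeries_add, ← mul_sub] at h₁
  obtain ⟨u, hu⟩ := isUnit_of_constantCoeff_eq_one
    (f := 1 + MvPowerSeries.C μ₂ * basisSeries μ₁ μ₂ b l * basisSeries μ₁ μ₂ b l')
    (by simp [hc])
  rw [← hu] at h₁
  have h₂ := Ideal.mul_mem_left _ (u⁻¹ : (MvPowerSeries σ R)ˣ).val h₁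
  rw [Units.inv_mul_cancel_left] at h₂
  have := Ideal.add_mem _ h h₂
  rwa [show (hyperbolicFGL μ₁ μ₂).toPowerSeries = hyperbolicSeries μ₁ μ₂ from rfl,
    sub_add_sub_cancel] at this

lemma coordEval_eq_zero_of_mem_relIdeal {y : CompletedPoly R Λ}
    (hy : y ∈ fgaRelIdeal (hyperbolicFGL μ₁ μ₂) Λ) : coordEval μ₁ μ₂ b y = 0 := by
  have h : fgaRelIdeal (hyperbolicFGL μ₁ μ₂) Λ ≤ RingHom.ker (coordEval μ₁ μ₂ b) := by
    refine Ideal.span_le.2 ?_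
    rintro _ (rfl | ⟨⟨l, l'⟩, rfl⟩)
    · exact (seriesEval_xHat _ _).trans (basisSeries_zero μ₁ μ₂ b)
    · change coordEval μ₁ μ₂ b _ = 0
      rw [map_sub, coordEval_formalSum]
      exact sub_eq_zero.2 (seriesEval_xHat _ _)
  exact h hy

lemma coordEval_eq_zero_of_mem_closure {y : CompletedPoly R Λ}
    (hy : y ∈ closureIdeal (augIdeal R Λ) (fgaRelIdeal (hyperbolicFGL μ₁ μ₂) Λ)) :
    coordEval μ₁ μ₂ b y = 0 := by
  refine eq_zero_of_forall_mem_orderIdeal fun N => ?_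
  obtain ⟨z, hz, e⟩ := mem_closureIdeal.1 hy N
  obtain ⟨p, hp⟩ := exists_evalₐ_eq N z
  have := Ideal.sub_mem _ (coordEval_sub_mem μ₁ μ₂ b (e.symm.trans hp))
    (coordEval_sub_mem μ₁ μ₂ b hp)
  rwa [coordEval_eq_zero_of_mem_relIdeal μ₁ μ₂ b hz, sub_sub_sub_cancel_right, sub_zero] at this

/-- The coordinate map `R⟦Λ⟧_F → R⟦t⟧` given by a basis of `Λ`: it sends `x_{b i}` to `t_i`. -/
def coordHom : FormalGroupAlgebra (hyperbolicFGL μ₁ μ₂) Λ →ₐ[R] MvPowerSeries σ R :=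
  Ideal.Quotient.liftₐ _ (coordEval μ₁ μ₂ b) fun _ h => coordEval_eq_zero_of_mem_closure μ₁ μ₂ b h

lemma coordHom_mk (y : CompletedPoly R Λ) :
    coordHom μ₁ μ₂ b (FormalGroupAlgebra.mk _ Λ y) = coordEval μ₁ μ₂ b y := rfl

lemma coordHom_x (l : Λ) :
    coordHom μ₁ μ₂ b (FormalGroupAlgebra.x _ l) = basisSeries μ₁ μ₂ b l :=
  seriesEval_xHat (constantCoeff_basisSeries μ₁ μ₂ b) l

/-- If `u` is nilpotent then the formal inverse of `u` is a polynomial in `u`. -/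
lemma mem_of_hyperbolic_inverse {C : Type*} [CommRing C] [Algebra R C] (S : Subalgebra R C)
    {u v : C} {N : ℕ} (hu : u ∈ S) (hN : u ^ N = 0) (r : R)
    (h : u + v - algebraMap R C r * u * v = 0) : v ∈ S := by
  have hr : algebraMap R C r * u ∈ S := S.mul_mem (S.algebraMap_mem r) hu
  have hg : (1 - algebraMap R C r * u) *
      ∑ i ∈ Finset.range N, (algebraMap R C r * u) ^ i = 1 := by
    rw [mul_neg_geom_sum, mul_pow, hN, mul_zero, sub_zero]
  have e : v = -u * ∑ i ∈ Finset.range N, (algebraMap R C r * u) ^ i := by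
    linear_combination -v * hg + (∑ i ∈ Finset.range N, (algebraMap R C r * u) ^ i) * h
  rw [e]
  exact S.mul_mem (S.neg_mem hu) (S.sum_mem fun i _ => S.pow_mem hr i)

/-- Modulo the relations and modulo the `N`-th power of the augmentation ideal, each polynomial in
the `x_λ` is a polynomial in the `x_{b i}`. -/
lemma exists_rename_basis (N : ℕ) (p : MvPolynomial Λ R) :
    ∃ (q : MvPolynomial σ R), ∃ z ∈ fgaRelIdeal (hyperbolicFGL μ₁ μ₂) Λ,
      AdicCompletion.evalₐ (augIdeal R Λ) N z =
        Ideal.Quotient.mk _ (p - MvPolynomial.rename b q) := by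
  let J := (fgaRelIdeal (hyperbolicFGL μ₁ μ₂) Λ).map (AdicCompletion.evalₐ (augIdeal R Λ) N)
  let π : MvPolynomial Λ R →ₐ[R] (MvPolynomial Λ R ⧸ augIdeal R Λ ^ N) ⧸ J :=
    (Ideal.Quotient.mkₐ R J).comp (Ideal.Quotient.mkₐ R (augIdeal R Λ ^ N))
  have hJ {z : CompletedPoly R Λ} (hz : z ∈ fgaRelIdeal (hyperbolicFGL μ₁ μ₂) Λ)
      {q : MvPolynomial Λ R}
      (hq : AdicCompletion.evalₐ (augIdeal R Λ) N z = Ideal.Quotient.mk _ q) : π q = 0 := by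
    refine Ideal.Quotient.eq_zero_iff_mem.2 ?_
    change Ideal.Quotient.mk _ q ∈ J
    exact hq ▸ Ideal.mem_map_of_mem _ hz
  have hI {q : MvPolynomial Λ R} (hq : q ∈ augIdeal R Λ ^ N) : π q = 0 := by
    change Ideal.Quotient.mk J (Ideal.Quotient.mk _ q) = 0
    rw [Ideal.Quotient.eq_zero_iff_mem.2 hq, map_zero]
  let S : Subalgebra R _ := (π.comp (MvPolynomial.rename b)).range
  have hadd (l l' : Λ) : π (MvPolynomial.X (l + l')) =
      truncEval (hyperbolicSeries μ₁ μ₂) (π (MvPolynomial.X l)) (π (MvPolynomial.X l')) N := by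
    rw [← truncEval_map, ← sub_eq_zero, ← map_sub]
    refine hJ (Ideal.subset_span (Set.mem_insert_of_mem _ ⟨(l, l'), rfl⟩)) ?_
    rw [map_sub, evalₐ_formalSum, xHat, AdicCompletion.evalₐ_of, map_sub]
    rfl
  have hzero : π (MvPolynomial.X 0) = 0 :=
    hJ (Ideal.subset_span (Set.mem_insert _ _)) (AdicCompletion.evalₐ_of _ _ _)
  have hneg (l : Λ) : π (MvPolynomial.X l) + π (MvPolynomial.X (-l)) -
      algebraMap R _ μ₁ * π (MvPolynomial.X l) * π (MvPolynomial.X (-l)) = 0 := by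
    have h := hI (truncEval_hyperbolicSeries_mem μ₁ μ₂ (X_mem_augIdeal (R := R) l)
      (X_mem_augIdeal (-l)) N)
    rw [map_sub, map_mul, truncEval_map, ← hadd, add_neg_cancel, hzero, mul_zero, zero_sub,
      neg_eq_zero] at h
    simpa using h
  let H : AddSubgroup Λ :=
    { carrier := {l | π (MvPolynomial.X l) ∈ S}
      zero_mem' := by rw [Set.mem_ofPred_eq, hzero]; exact S.zero_mem
      add_mem' := fun {l l'} hl hl' => by
        rw [Set.mem_ofPred_eq, hadd]
        exact S.sum_mem fun i _ => S.sum_mem fun j _ => S.mul_mem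
          (S.mul_mem (S.algebraMap_mem _) (S.pow_mem hl i)) (S.pow_mem hl' j)
      neg_mem' := fun {l} hl => mem_of_hyperbolic_inverse S hl (N := N)
        (by rw [← map_pow]; exact hI (Ideal.pow_mem_pow (X_mem_augIdeal l) N)) μ₁ (hneg l) }
  have hH (l : Λ) : π (MvPolynomial.X l) ∈ S := by
    have h : Submodule.span ℤ (Set.range b) ≤ AddSubgroup.toIntSubmodule H := by
      refine Submodule.span_le.2 ?_
      rintro _ ⟨i, rfl⟩
      exact ⟨MvPolynomial.X i, by
        change π (MvPolynomial.rename b (MvPolynomial.X i)) = _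
        rw [MvPolynomial.rename_X]⟩
    rw [b.span_eq] at h
    exact h (Submodule.mem_top (x := l))
  have hp : π p ∈ S := by
    induction p using MvPolynomial.induction_on with
    | C r => exact (π.commutes r).symm ▸ S.algebraMap_mem r
    | add p q hp hq => rw [map_add]; exact S.add_mem hp hq
    | mul_X p l hp => rw [map_mul]; exact S.mul_mem hp (hH l)
  obtain ⟨q, hq⟩ := hp
  have h : π (p - MvPolynomial.rename b q) = 0 := by
    rw [map_sub, sub_eq_zero]; exact hq.symm
  obtain ⟨z, hz, e⟩ := (Ideal.mem_map_iff_of_surjective _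
    (AdicCompletion.surjective_evalₐ (augIdeal R Λ) N)).1 (Ideal.Quotient.eq_zero_iff_mem.1 h)
  exact ⟨q, z, hz, e⟩

lemma aeval_basisSeries_rename (q : MvPolynomial σ R) :
    MvPolynomial.aeval (basisSeries μ₁ μ₂ b) (MvPolynomial.rename b q) =
      (q : MvPowerSeries σ R) := by
  rw [MvPolynomial.aeval_rename]
  have : (MvPolynomial.aeval (basisSeries μ₁ μ₂ b ∘ b) : MvPolynomial σ R →ₐ[R] _) =
      MvPolynomial.coeToMvPowerSeries.algHom R := by
    refine MvPolynomial.algHom_ext fun i => ?_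
    simp [basisSeries, basisPoint_basis]
  rw [this]
  simp [MvPolynomial.coeToMvPowerSeries.algHom_apply]

lemma rename_mem_augIdeal_pow {q : MvPolynomial σ R} {N : ℕ}
    (hq : (q : MvPowerSeries σ R) ∈ orderIdeal R σ N) :
    MvPolynomial.rename b q ∈ augIdeal R Λ ^ N := by
  have h : q ∈ MvPolynomial.idealOfVars σ R ^ N :=
    (MvPolynomial.mem_pow_idealOfVars_iff' N q).2 fun d hd => by
      rw [← MvPolynomial.coeff_coe]; exact mem_orderIdeal.1 hq d hd
  have hle : MvPolynomial.idealOfVars σ R ≤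
      (augIdeal R Λ).comap (MvPolynomial.rename b : MvPolynomial σ R →ₐ[R] _) := by
    refine Ideal.span_le.2 ?_
    rintro _ ⟨i, rfl⟩
    change MvPolynomial.rename b (MvPolynomial.X i) ∈ augIdeal R Λ
    rw [MvPolynomial.rename_X]
    exact X_mem_augIdeal _
  exact (Ideal.pow_right_mono hle N).trans (Ideal.le_comap_pow _ N) h

/-- If the coordinates of `y` vanish, then modulo the relations and modulo each power of the
augmentation ideal `y` is a polynomial in the `x_{b i}` of high order, so `y` lies in the closure of
the relations. -/
lemma coordHom_injective : Function.Injective (coordHom μ₁ μ₂ b) := by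
  rw [injective_iff_map_eq_zero]
  intro y hy
  obtain ⟨y, rfl⟩ := FormalGroupAlgebra.mk_surjective _ y
  rw [coordHom_mk] at hy
  refine Ideal.Quotient.eq_zero_iff_mem.2 (mem_closureIdeal.2 fun N => ?_)
  obtain ⟨p, hp⟩ := exists_evalₐ_eq N y
  obtain ⟨q, z, hz, e⟩ := exists_rename_basis μ₁ μ₂ b N p
  refine ⟨z, hz, ?_⟩
  have h₁ := coordEval_sub_mem μ₁ μ₂ b hp
  have h₂ := coordEval_sub_mem μ₁ μ₂ b e
  rw [coordEval_eq_zero_of_mem_relIdeal μ₁ μ₂ b hz, map_sub, aeval_basisSeries_rename] at h₂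
  rw [hy] at h₁
  have h₃ := Ideal.sub_mem _ h₂ h₁
  rw [show ∀ a c : MvPowerSeries σ R, 0 - (a - c) - (0 - a) = c from fun a c => by ring] at h₃
  rw [e, hp, map_sub, Ideal.Quotient.eq_zero_iff_mem.2 (rename_mem_augIdeal_pow b h₃), sub_zero]

/-- The truncations of a power series, read as polynomials in the `x_{b i}`, form a Cauchy sequence
whose limit is a preimage. Finitely many coordinates are needed for the truncations to be
polynomials. -/
lemma coordHom_surjective [Finite σ] : Function.Surjective (coordHom (R := R) μ₁ μ₂ b) := by
  intro f
  let a : ℕ → MvPolynomial Λ R := fun N => MvPolynomial.rename b (f.truncTotal N)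
  have ha (m n : ℕ) (h : m ≤ n) : a m - a n ∈ augIdeal R Λ ^ m := by
    rw [← map_sub]
    refine rename_mem_augIdeal_pow b (mem_orderIdeal.2 fun d hd => ?_)
    rw [MvPolynomial.coeff_coe]
    exact (MvPolynomial.mem_pow_idealOfVars_iff' _ _).1
      (MvPowerSeries.truncTotal_sub_truncTotal_mem_pow_idealOfVars le_rfl h f) d hd
  refine ⟨FormalGroupAlgebra.mk _ Λ (AdicCompletion.mk (augIdeal R Λ) (MvPolynomial Λ R)
    (AdicCompletion.AdicCauchySequence.mk (augIdeal R Λ) (MvPolynomial Λ R) a fun n => by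
      rw [SModEq.sub_mem, smul_eq_mul, Ideal.mul_top]
      exact ha n (n + 1) n.le_succ)), ?_⟩
  rw [coordHom_mk]
  refine sub_eq_zero.1 (eq_zero_of_forall_mem_orderIdeal fun N => ?_)
  have h := coordEval_sub_mem μ₁ μ₂ b (AdicCompletion.evalₐ_mk (augIdeal R Λ) N
    (AdicCompletion.AdicCauchySequence.mk (augIdeal R Λ) (MvPolynomial Λ R) a fun n => by
      rw [SModEq.sub_mem, smul_eq_mul, Ideal.mul_top]
      exact ha n (n + 1) n.le_succ))
  change _ - MvPolynomial.aeval _ (a N) ∈ _ at h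
  rw [aeval_basisSeries_rename] at h
  have h' : ((f.truncTotal N : MvPolynomial σ R) : MvPowerSeries σ R) - f ∈ orderIdeal R σ N := by
    refine mem_orderIdeal.2 fun d hd => ?_
    rw [map_sub, MvPolynomial.coeff_coe, MvPowerSeries.coeff_truncTotal _ hd, sub_self]
  have := Ideal.add_mem _ h h'
  rwa [sub_add_sub_cancel] at this

lemma coordHom_map_sub_mem (φ : Λ →+ Λ) {N : ℕ} {y : CompletedPoly R Λ} {p : MvPolynomial Λ R}
    (h : AdicCompletion.evalₐ (augIdeal R Λ) N y = Ideal.Quotient.mk _ p) :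
    coordHom μ₁ μ₂ b (FormalGroupAlgebra.map _ φ (FormalGroupAlgebra.mk _ Λ y)) -
      MvPolynomial.aeval (basisSeries μ₁ μ₂ b ∘ φ) p ∈ orderIdeal R σ N := by
  rw [FormalGroupAlgebra.map_mk, coordHom_mk, ← MvPolynomial.aeval_rename]
  exact coordEval_sub_mem μ₁ μ₂ b (by rw [evalₐ_completedMap, h, quotMap_mk])

/-- Moving `λ` by a multiple of `b t` does not change `x_λ` modulo `x_{b t}`. -/
lemma X_dvd_basisSeries_sub (t : σ) (l : Λ) (n : ℤ) :
    MvPowerSeries.X t ∣ basisSeries μ₁ μ₂ b l - basisSeries μ₁ μ₂ b (l - n • b t) := by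
  have h (l : Λ) :
      MvPowerSeries.X t ∣ basisSeries μ₁ μ₂ b l - basisSeries μ₁ μ₂ b (l - b t) := by
    have e := basisSeries_add μ₁ μ₂ b (l - b t) (b t)
    rw [sub_add_cancel] at e
    have ht : basisSeries μ₁ μ₂ b (b t) = MvPowerSeries.X t := basisPoint_basis μ₁ μ₂ b t
    rw [ht] at e
    exact ⟨1 - MvPowerSeries.C μ₁ * basisSeries μ₁ μ₂ b (l - b t) -
      MvPowerSeries.C μ₂ * basisSeries μ₁ μ₂ b (l - b t) * basisSeries μ₁ μ₂ b l, by
        linear_combination e⟩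
  induction n using Int.induction_on with
  | zero => simp
  | succ n ih =>
    have := dvd_add ih (h (l - (n : ℤ) • b t))
    rwa [sub_add_sub_cancel, sub_sub, ← add_one_zsmul] at this
  | pred n ih =>
    have := dvd_sub ih (h (l - (-(n : ℤ) - 1) • b t))
    rwa [show l - (-(n : ℤ) - 1) • b t - b t = l - (-(n : ℤ)) • b t by module,
      sub_sub_sub_cancel_right] at this

end Coordinates

namespace FormalGroupAlgebra

variable {R : Type*} [CommRing R] (μ₁ μ₂ : R) {Λ : Type*} [AddCommGroup Λ]

lemma x_zero {σ : Type*} (b : Module.Basis σ ℤ Λ) : x (hyperbolicFGL μ₁ μ₂) (0 : Λ) = 0 :=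
  coordHom_injective μ₁ μ₂ b (by rw [coordHom_x, basisSeries_zero, map_zero])

/-- The defining relation of the hyperbolic formal group law in `R⟦Λ⟧_F`, with the denominator
cleared. -/
lemma x_add {σ : Type*} (b : Module.Basis σ ℤ Λ) (l l' : Λ) :
    (1 + algebraMap R _ μ₂ * x (hyperbolicFGL μ₁ μ₂) l * x (hyperbolicFGL μ₁ μ₂) l') *
        x (hyperbolicFGL μ₁ μ₂) (l + l') =
      x (hyperbolicFGL μ₁ μ₂) l + x (hyperbolicFGL μ₁ μ₂) l' -
        algebraMap R _ μ₁ * x (hyperbolicFGL μ₁ μ₂) l * x (hyperbolicFGL μ₁ μ₂) l' := by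
  refine coordHom_injective μ₁ μ₂ b ?_
  simp only [map_add, map_sub, map_mul, map_one, coordHom_x, AlgHom.commutes]
  exact basisSeries_add μ₁ μ₂ b l l'

lemma x_basis_mem_nonZeroDivisors {σ : Type*} (b : Module.Basis σ ℤ Λ) (t : σ) :
    x (hyperbolicFGL μ₁ μ₂) (b t) ∈
      nonZeroDivisors (FormalGroupAlgebra (hyperbolicFGL μ₁ μ₂) Λ) := by
  have key : ∀ y, y * x (hyperbolicFGL μ₁ μ₂) (b t) = 0 → y = 0 := by
    intro y hy
    have h := congrArg (coordHom μ₁ μ₂ b) hy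
    have ht : basisSeries μ₁ μ₂ b (b t) = MvPowerSeries.X t := basisPoint_basis μ₁ μ₂ b t
    rw [map_mul, coordHom_x, map_zero, ht] at h
    have hX := MvPowerSeries.X_mem_nonzeroDivisors (R := R) (σ := σ) (i := t)
    have h' : coordHom μ₁ μ₂ b y = 0 := mem_nonZeroDivisors_iff_right.1 hX _ h
    exact coordHom_injective μ₁ μ₂ b (h'.trans (map_zero _).symm)
  exact mem_nonZeroDivisors_iff_right.2 key

/-- If `φ` is the identity modulo a basis vector `b t`, then the map induced by `φ` is the identity
modulo `x_{b t}`. -/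
lemma x_basis_dvd_sub_map {σ : Type*} [Finite σ] (b : Module.Basis σ ℤ Λ) (t : σ) (φ : Λ →+ Λ)
    (hφ : ∀ l, ∃ n : ℤ, φ l = l - n • b t)
    (y : FormalGroupAlgebra (hyperbolicFGL μ₁ μ₂) Λ) :
    x (hyperbolicFGL μ₁ μ₂) (b t) ∣ y - map _ φ y := by
  have ht : basisSeries μ₁ μ₂ b (b t) = MvPowerSeries.X t := basisPoint_basis μ₁ μ₂ b t
  have h : MvPowerSeries.X t ∣ coordHom μ₁ μ₂ b (y - map _ φ y) := by
    obtain ⟨y, rfl⟩ := mk_surjective _ y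
    rw [MvPowerSeries.X_dvd_iff]
    intro d hd
    obtain ⟨p, hp⟩ := exists_evalₐ_eq (d.degree + 1) y
    have h₁ := mem_orderIdeal.1 (coordEval_sub_mem μ₁ μ₂ b hp) d (Nat.lt_succ_self _)
    have h₂ := mem_orderIdeal.1 (coordHom_map_sub_mem μ₁ μ₂ b φ hp) d (Nat.lt_succ_self _)
    have h₃ : MvPowerSeries.X t ∣ MvPolynomial.aeval (basisSeries μ₁ μ₂ b) p -
        MvPolynomial.aeval (basisSeries μ₁ μ₂ b ∘ φ) p := by
      let q := Ideal.Quotient.mkₐ R (Ideal.span {(MvPowerSeries.X t : MvPowerSeries σ R)})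
      have e : q.comp (MvPolynomial.aeval (basisSeries μ₁ μ₂ b)) =
          q.comp (MvPolynomial.aeval (basisSeries μ₁ μ₂ b ∘ φ)) := by
        refine MvPolynomial.algHom_ext fun l => ?_
        obtain ⟨n, hn⟩ := hφ l
        rw [AlgHom.comp_apply, AlgHom.comp_apply, MvPolynomial.aeval_X, MvPolynomial.aeval_X,
          Function.comp_apply, hn]
        exact Ideal.Quotient.eq.2
          (Ideal.mem_span_singleton.2 (X_dvd_basisSeries_sub μ₁ μ₂ b t l n))
      exact Ideal.mem_span_singleton.1 (Ideal.Quotient.eq.1 (DFunLike.congr_fun e p))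
    have h₄ := MvPowerSeries.X_dvd_iff.1 h₃ d hd
    rw [map_sub] at h₁ h₂ h₄
    rw [map_sub, map_sub, coordHom_mk]
    linear_combination h₁ - h₂ + h₄
  obtain ⟨f, hf⟩ := h
  obtain ⟨z, rfl⟩ := coordHom_surjective μ₁ μ₂ b f
  exact ⟨z, coordHom_injective μ₁ μ₂ b (by rw [hf, map_mul, coordHom_x, ht])⟩

end FormalGroupAlgebra

/-! ### Rank two subgroups of the Weyl group -/

namespace KacMoodyDatum

open CoxeterSystem (alternatingWord)

variable {ι : Type*} [Fintype ι] {k : Type*} [Field k] {𝔥 : Type*} [AddCommGroup 𝔥] [Module k 𝔥]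
  (D : KacMoodyDatum ι k 𝔥)

lemma s_smul (i : ι) (φ : Module.Dual k 𝔥) : D.s i • φ = φ - φ (D.coroot i) • D.root i :=
  D.simpleReflection_apply i φ

lemma s_smul_root (i j : ι) : D.s i • D.root j = D.root j - (D.A i j : k) • D.root i := by
  rw [s_smul, D.root_coroot]

lemma s_smul_root_self (i : ι) : D.s i • D.root i = -D.root i := by
  rw [s_smul_root, D.isGCM.diag]; push_cast; module

lemma weylGroup_ext {w v : D.weylGroup} (h : ∀ φ : Module.Dual k 𝔥, w • φ = v • φ) : w = v :=
  Subtype.ext (LinearEquiv.ext h)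

lemma smul_smul_comm (w : D.weylGroup) (r : k) (φ : Module.Dual k 𝔥) : w • r • φ = r • w • φ :=
  map_smul (w : Module.Dual k 𝔥 ≃ₗ[k] Module.Dual k 𝔥) r φ

lemma s_mul_self (i : ι) : D.s i * D.s i = 1 := by
  refine D.weylGroup_ext fun φ => ?_
  rw [mul_smul, s_smul _ _ φ, smul_sub, smul_smul_comm, s_smul_root_self, s_smul, one_smul]
  module

lemma s_mul_s_mul (i : ι) (w : D.weylGroup) : D.s i * (D.s i * w) = w := by
  rw [← mul_assoc, s_mul_self, one_mul]

/-- The product of the simple reflections along a word. -/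
def wordProd (I : List ι) : D.weylGroup := (I.map D.s).prod

@[simp] lemma wordProd_nil : D.wordProd [] = 1 := rfl

@[simp] lemma wordProd_cons (i : ι) (I : List ι) : D.wordProd (i :: I) = D.s i * D.wordProd I := by
  simp [wordProd]

@[simp] lemma wordProd_append (I J : List ι) :
    D.wordProd (I ++ J) = D.wordProd I * D.wordProd J := by
  simp [wordProd]

/-- The coordinates of `… s_i s_j α_i` (with `n` reflections) with respect to `α_i`, `α_j`, where
`a = -a_ij` and `b = -a_ji`. -/
def dihedralCoord (a b : ℤ) : ℕ → ℤ × ℤ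
  | 0 => (1, 0)
  | n + 1 => if Even n then ((dihedralCoord a b n).1,
        b * (dihedralCoord a b n).1 - (dihedralCoord a b n).2)
      else (a * (dihedralCoord a b n).2 - (dihedralCoord a b n).1, (dihedralCoord a b n).2)

lemma wordProd_alternatingWord_smul_root (i j : ι) (n : ℕ) :
    D.wordProd (alternatingWord i j n) • D.root i =
      ((dihedralCoord (-D.A i j) (-D.A j i) n).1 : k) • D.root i +
      ((dihedralCoord (-D.A i j) (-D.A j i) n).2 : k) • D.root j := by
  induction n with
  | zero => simp [CoxeterSystem.alternatingWord, dihedralCoord]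
  | succ n ih =>
    rw [CoxeterSystem.alternatingWord_succ', wordProd_cons, mul_smul, ih, smul_add,
      smul_smul_comm, smul_smul_comm, dihedralCoord]
    split_ifs with h
    · rw [s_smul_root, s_smul_root_self]; push_cast; module
    · rw [s_smul_root_self, s_smul_root]; push_cast; module

lemma wordProd_alternatingWord_even (i j : ι) (n : ℕ) :
    D.wordProd (alternatingWord i j (2 * n)) = (D.s i * D.s j) ^ n := by
  induction n with
  | zero => simp [CoxeterSystem.alternatingWord]
  | succ n ih =>
    rw [Nat.mul_succ, CoxeterSystem.alternatingWord_succ', CoxeterSystem.alternatingWord_succ',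
      if_neg (by simp [parity_simps]), if_pos (by simp), wordProd_cons, wordProd_cons, ih,
      pow_succ', mul_assoc]

lemma eq_of_smul_root_add [CharZero k] {i j : ι} (hij : i ≠ j) {a b a' b' : ℤ}
    (h : (a : k) • D.root i + (b : k) • D.root j = (a' : k) • D.root i + (b' : k) • D.root j) :
    a = a' ∧ b = b' := by
  have hinj : Function.Injective ![i, j] := by
    intro x y hxy
    fin_cases x <;> fin_cases y <;> simp_all [hij.symm]
  have hli := D.linearIndependent_root.comp _ hinj
  rw [show D.root ∘ ![i, j] = ![D.root i, D.root j] by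
    funext x; fin_cases x <;> rfl] at hli
  exact_mod_cast hli.eq_of_pair h

/-- The seven types of pairs of distinct simple roots. -/
lemma rank_two_cases {i j : ι} (hij : i ≠ j) :
    (D.A i j = 0 ∧ D.A j i = 0) ∨ (D.A i j = -1 ∧ D.A j i = -1) ∨
    (D.A i j = -1 ∧ D.A j i = -2) ∨ (D.A i j = -2 ∧ D.A j i = -1) ∨
    (D.A i j = -1 ∧ D.A j i = -3) ∨ (D.A i j = -3 ∧ D.A j i = -1) ∨
    (D.A i j < 0 ∧ D.A j i < 0 ∧ 4 ≤ D.A i j * D.A j i) := by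
  have h₁ := D.isGCM.nonpos i j hij
  have h₂ := D.isGCM.nonpos j i hij.symm
  have h₃ := D.isGCM.zero i j
  have h₄ := D.isGCM.zero j i
  generalize D.A i j = a at *
  generalize D.A j i = b at *
  by_cases hab : 4 ≤ a * b
  · have ha : a ≠ 0 := by rintro rfl; omega
    have hb : b ≠ 0 := by rintro rfl; omega
    have : a < 0 := by omega
    have : b < 0 := by omega
    simp [*]
  · by_cases ha : a = 0
    · exact Or.inl ⟨ha, h₃ ha⟩
    · have hb : b ≠ 0 := fun h => ha (h₄ h)
      have ha' : -3 ≤ a := by nlinarith [show a ≤ -1 by omega, show b ≤ -1 by omega]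
      have hb' : -3 ≤ b := by nlinarith [show a ≤ -1 by omega, show b ≤ -1 by omega]
      interval_cases a <;> interval_cases b <;> omega

lemma s_smul_comb_left (i j : ι) (φ : Module.Dual k 𝔥) (x y : k) :
    D.s i • (φ + x • D.root i + y • D.root j) =
      φ + (-φ (D.coroot i) - x - (D.A i j : k) * y) • D.root i + y • D.root j := by
  rw [smul_add, smul_add, smul_smul_comm, smul_smul_comm, s_smul_root_self, s_smul_root, s_smul]
  module

lemma s_smul_comb_right (i j : ι) (φ : Module.Dual k 𝔥) (x y : k) :
    D.s j • (φ + x • D.root i + y • D.root j) =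
      φ + x • D.root i + (-φ (D.coroot j) - y - (D.A j i : k) * x) • D.root j := by
  have h := D.s_smul_comb_left j i φ y x
  rw [add_right_comm, h, add_right_comm]

lemma eq_add_comb (i j : ι) (φ : Module.Dual k 𝔥) :
    φ = φ + (0 : k) • D.root i + (0 : k) • D.root j := by simp

lemma braid_two {i j : ι} (h₁ : D.A i j = 0) (h₂ : D.A j i = 0) :
    D.s i * D.s j = D.s j * D.s i := by
  refine D.weylGroup_ext fun φ => ?_
  rw [D.eq_add_comb i j φ]
  simp only [mul_smul, s_smul_comb_left D i j, s_smul_comb_right D i j, h₁, h₂]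
  congr 2 <;> push_cast <;> ring_nf

lemma braid_three {i j : ι} (h₁ : D.A i j = -1) (h₂ : D.A j i = -1) :
    D.s i * (D.s j * D.s i) = D.s j * (D.s i * D.s j) := by
  refine D.weylGroup_ext fun φ => ?_
  rw [D.eq_add_comb i j φ]
  simp only [mul_smul, s_smul_comb_left D i j, s_smul_comb_right D i j, h₁, h₂]
  congr 2 <;> push_cast <;> ring_nf

lemma braid_four {i j : ι} (h₁ : D.A i j = -2) (h₂ : D.A j i = -1) :
    D.s i * (D.s j * (D.s i * D.s j)) = D.s j * (D.s i * (D.s j * D.s i)) := by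
  refine D.weylGroup_ext fun φ => ?_
  rw [D.eq_add_comb i j φ]
  simp only [mul_smul, s_smul_comb_left D i j, s_smul_comb_right D i j, h₁, h₂]
  congr 2 <;> push_cast <;> ring_nf

lemma braid_six {i j : ι} (h₁ : D.A i j = -3) (h₂ : D.A j i = -1) :
    D.s i * (D.s j * (D.s i * (D.s j * (D.s i * D.s j)))) =
      D.s j * (D.s i * (D.s j * (D.s i * (D.s j * D.s i)))) := by
  refine D.weylGroup_ext fun φ => ?_
  rw [D.eq_add_comb i j φ]
  simp only [mul_smul, s_smul_comb_left D i j, s_smul_comb_right D i j, h₁, h₂]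
  congr 2 <;> push_cast <;> ring_nf

/-- For `a b ≥ 4` the vectors `… s_i s_j α_i` are positive and all but the first one involve
`α_j`. -/
lemma dihedralCoord_of_four_le {a b : ℤ} (ha : 0 < a) (hb : 0 < b) (hab : 4 ≤ a * b) (n : ℕ) :
    0 < (dihedralCoord a b n).1 ∧ 0 ≤ (dihedralCoord a b n).2 ∧
      (0 < n → 0 < (dihedralCoord a b n).2) ∧
      (Even n → 2 * (dihedralCoord a b n).2 ≤ b * (dihedralCoord a b n).1) ∧
      (¬ Even n → 2 * (dihedralCoord a b n).1 ≤ a * (dihedralCoord a b n).2) := by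
  induction n with
  | zero => simp [dihedralCoord, hb.le]
  | succ n ih =>
    obtain ⟨h₁, h₂, h₃, h₄, h₅⟩ := ih
    rw [dihedralCoord]
    set x := (dihedralCoord a b n).1
    set y := (dihedralCoord a b n).2
    by_cases hn : Even n
    · have h := h₄ hn
      have hbx : 0 < b * x := mul_pos hb h₁
      have key : 4 * x ≤ a * (b * x) := by nlinarith
      rw [if_pos hn]
      simp only [Nat.even_add_one, hn, not_true_eq_false, false_imp_iff, not_false_eq_true,
        forall_true_left, true_and]
      exact ⟨h₁, by linarith, fun _ => by linarith, by nlinarith⟩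
    · have h := h₅ hn
      have hy : 0 < y := h₃ (Nat.pos_of_ne_zero (by rintro rfl; simp at hn))
      have key : 4 * y ≤ b * (a * y) := by nlinarith
      rw [if_neg hn]
      simp only [Nat.even_add_one, hn, not_true_eq_false, false_imp_iff, not_false_eq_true,
        forall_true_left, and_true]
      exact ⟨by linarith, h₂, fun _ => hy, by nlinarith⟩

/-- A criterion for `m_ij = M`: the power `(s_i s_j)^M` is trivial, and the smaller powers move
`α_i`. -/
lemma m_eq_of_braid [CharZero k] {i j : ι} (hij : i ≠ j) {M : ℕ} (hM : 0 < M)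
    (h : (D.s i * D.s j) ^ M = 1)
    (h' : ∀ n < M, 0 < n → dihedralCoord (-D.A i j) (-D.A j i) (2 * n) ≠ (1, 0)) : D.m i j = M := by
  rw [m, orderOf_eq_iff hM]
  refine ⟨h, fun n hn hn0 e => h' n hn hn0 ?_⟩
  have := D.wordProd_alternatingWord_smul_root i j (2 * n)
  rw [wordProd_alternatingWord_even, e, one_smul] at this
  have := D.eq_of_smul_root_add (a := 1) (b := 0) hij (by rw [← this]; simp)
  exact Prod.ext this.1.symm this.2.symm

/-- The Cartan integers and the number `m_ij` for the seven types of pairs of simple roots. -/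
lemma m_cases [CharZero k] {i j : ι} (hij : i ≠ j) :
    (D.A i j = 0 ∧ D.A j i = 0 ∧ D.m i j = 2) ∨ (D.A i j = -1 ∧ D.A j i = -1 ∧ D.m i j = 3) ∨
    (D.A i j = -1 ∧ D.A j i = -2 ∧ D.m i j = 4) ∨ (D.A i j = -2 ∧ D.A j i = -1 ∧ D.m i j = 4) ∨
    (D.A i j = -1 ∧ D.A j i = -3 ∧ D.m i j = 6) ∨ (D.A i j = -3 ∧ D.A j i = -1 ∧ D.m i j = 6) ∨
    (D.A i j < 0 ∧ D.A j i < 0 ∧ 4 ≤ D.A i j * D.A j i ∧ D.m i j = 0) := by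
  have hi (w : D.weylGroup) : D.s i * (D.s i * w) = w := D.s_mul_s_mul i w
  have hj (w : D.weylGroup) : D.s j * (D.s j * w) = w := D.s_mul_s_mul j w
  have e₄ (h : D.s i * (D.s j * (D.s i * D.s j)) = D.s j * (D.s i * (D.s j * D.s i))) :
      (D.s i * D.s j) ^ 4 = 1 := by
    calc (D.s i * D.s j) ^ 4 = (D.s i * (D.s j * (D.s i * D.s j))) *
          (D.s i * (D.s j * (D.s i * D.s j))) := by
            simp only [pow_succ, pow_zero, one_mul, mul_assoc]
      _ = 1 := by nth_rw 1 [h]; simp only [mul_assoc, hi, hj, s_mul_self]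
  have e₆ (h : D.s i * (D.s j * (D.s i * (D.s j * (D.s i * D.s j)))) =
      D.s j * (D.s i * (D.s j * (D.s i * (D.s j * D.s i))))) : (D.s i * D.s j) ^ 6 = 1 := by
    calc (D.s i * D.s j) ^ 6 = (D.s i * (D.s j * (D.s i * (D.s j * (D.s i * D.s j))))) *
          (D.s i * (D.s j * (D.s i * (D.s j * (D.s i * D.s j))))) := by
            simp only [pow_succ, pow_zero, one_mul, mul_assoc]
      _ = 1 := by nth_rw 1 [h]; simp only [mul_assoc, hi, hj, s_mul_self]
  have coord (M : ℕ) (hM : 0 < M) (h : (D.s i * D.s j) ^ M = 1)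
      (h' : ∀ n < M, 0 < n → dihedralCoord (-D.A i j) (-D.A j i) (2 * n) ≠ (1, 0)) : D.m i j = M :=
    D.m_eq_of_braid hij hM h h'
  obtain ⟨h₁, h₂⟩ | ⟨h₁, h₂⟩ | ⟨h₁, h₂⟩ | ⟨h₁, h₂⟩ | ⟨h₁, h₂⟩ | ⟨h₁, h₂⟩ | ⟨h₁, h₂, h₃⟩ :=
    D.rank_two_cases hij
  · refine Or.inl ⟨h₁, h₂, coord 2 (by norm_num) ?_ ?_⟩
    · nth_rw 1 [pow_two, D.braid_two h₁ h₂]; simp only [mul_assoc, hi, s_mul_self]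
    · rw [h₁, h₂]; decide
  · refine Or.inr (Or.inl ⟨h₁, h₂, coord 3 (by norm_num) ?_ ?_⟩)
    · calc (D.s i * D.s j) ^ 3 = (D.s i * (D.s j * D.s i)) * (D.s j * (D.s i * D.s j)) := by
            simp only [pow_succ, pow_zero, one_mul, mul_assoc]
        _ = 1 := by rw [D.braid_three h₁ h₂]; simp only [mul_assoc, hi, hj, s_mul_self]
    · rw [h₁, h₂]; decide
  · refine Or.inr (Or.inr (Or.inl
      ⟨h₁, h₂, coord 4 (by norm_num) (e₄ (D.braid_four h₂ h₁).symm) ?_⟩))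
    rw [h₁, h₂]; decide
  · refine Or.inr (Or.inr (Or.inr (Or.inl
      ⟨h₁, h₂, coord 4 (by norm_num) (e₄ (D.braid_four h₁ h₂)) ?_⟩)))
    rw [h₁, h₂]; decide
  · refine Or.inr (Or.inr (Or.inr (Or.inr (Or.inl
      ⟨h₁, h₂, coord 6 (by norm_num) (e₆ (D.braid_six h₂ h₁).symm) ?_⟩))))
    rw [h₁, h₂]; decide
  · refine Or.inr (Or.inr (Or.inr (Or.inr (Or.inr (Or.inl
      ⟨h₁, h₂, coord 6 (by norm_num) (e₆ (D.braid_six h₁ h₂)) ?_⟩)))))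
    rw [h₁, h₂]; decide
  · refine Or.inr (Or.inr (Or.inr (Or.inr (Or.inr (Or.inr ⟨h₁, h₂, h₃, ?_⟩)))))
    rw [m, orderOf_eq_zero_iff']
    intro n hn e
    have := D.wordProd_alternatingWord_smul_root i j (2 * n)
    rw [wordProd_alternatingWord_even, e, one_smul] at this
    have := (D.eq_of_smul_root_add (a := 1) (b := 0) hij (by rw [← this]; simp)).2
    have h := (dihedralCoord_of_four_le (a := -D.A i j) (b := -D.A j i) (by omega) (by omega)
      (by rwa [neg_mul_neg]) (2 * n)).2.2.1 (by omega)
    omega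

/-- Alternating words shorter than `m_ij` send `α_i` to a positive vector. -/
lemma dihedralCoord_nonneg [CharZero k] {i j : ι} (hij : i ≠ j) {n : ℕ}
    (hn : D.m i j = 0 ∨ n < D.m i j) :
    0 ≤ (dihedralCoord (-D.A i j) (-D.A j i) n).1 ∧
      0 ≤ (dihedralCoord (-D.A i j) (-D.A j i) n).2 := by
  obtain ⟨h₁, h₂, h₃⟩ | ⟨h₁, h₂, h₃⟩ | ⟨h₁, h₂, h₃⟩ | ⟨h₁, h₂, h₃⟩ | ⟨h₁, h₂, h₃⟩ | ⟨h₁, h₂, h₃⟩ |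
    ⟨h₁, h₂, h₃, -⟩ := D.m_cases hij
  case inr.inr.inr.inr.inr.inr =>
    have h := dihedralCoord_of_four_le (a := -D.A i j) (b := -D.A j i) (by omega) (by omega)
      (by rwa [neg_mul_neg]) n
    exact ⟨h.1.le, h.2.1⟩
  all_goals
    rw [h₃] at hn
    replace hn := hn.resolve_left (by norm_num)
    rw [h₁, h₂]
    revert n
    decide

/-- The braid relations in the Weyl group. -/
lemma wordProd_alternatingWord_m [CharZero k] {i j : ι} (hij : i ≠ j) :
    D.wordProd (alternatingWord i j (D.m i j)) = D.wordProd (alternatingWord j i (D.m i j)) := by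
  obtain ⟨h₁, h₂, h₃⟩ | ⟨h₁, h₂, h₃⟩ | ⟨h₁, h₂, h₃⟩ | ⟨h₁, h₂, h₃⟩ | ⟨h₁, h₂, h₃⟩ | ⟨h₁, h₂, h₃⟩ |
    ⟨h₁, h₂, -, h₃⟩ := D.m_cases hij
  all_goals
    rw [h₃]
    simp only [CoxeterSystem.alternatingWord, List.concat_eq_append, List.nil_append,
      List.cons_append, wordProd_cons, wordProd_nil, mul_one]
  · exact D.braid_two h₁ h₂
  · exact (D.braid_three h₁ h₂).symm
  · exact (D.braid_four h₂ h₁).symm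
  · exact D.braid_four h₁ h₂
  · exact (D.braid_six h₂ h₁).symm
  · exact D.braid_six h₁ h₂

end KacMoodyDatum

namespace KacMoodyDatum

open CoxeterSystem (alternatingWord)

/-! ### Length and positive roots -/

section Length

lemma exists_alternatingWord_append {ι : Type*} (i j : ι) (m d : ℕ) :
    ∃ Q : List ι, Q.length = d ∧ alternatingWord i j (m + d) = Q ++ alternatingWord i j m := by
  induction d with
  | zero => exact ⟨[], rfl, rfl⟩
  | succ d ih =>
    obtain ⟨Q, hQ, e⟩ := ih
    exact ⟨(if Even (m + d) then j else i) :: Q, by rw [List.length_cons, hQ],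
      by rw [← add_assoc, CoxeterSystem.alternatingWord_succ', e]; rfl⟩

variable {ι : Type*} [Fintype ι] {k : Type*} [Field k] {𝔥 : Type*} [AddCommGroup 𝔥] [Module k 𝔥]
  (D : KacMoodyDatum ι k 𝔥)

lemma inv_s (i : ι) : (D.s i)⁻¹ = D.s i := inv_eq_of_mul_eq_one_left (D.s_mul_self i)

lemma exists_word (w : D.weylGroup) : ∃ I, D.wordProd I = w := by
  obtain ⟨w, hw⟩ := w
  induction hw using Subgroup.closure_induction'' with
  | one => exact ⟨[], rfl⟩
  | mem x hx =>
    obtain ⟨i, rfl⟩ := hx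
    exact ⟨[i], by rw [wordProd_cons, wordProd_nil, mul_one]; rfl⟩
  | inv_mem x hx =>
    obtain ⟨i, rfl⟩ := hx
    refine ⟨[i], ?_⟩
    rw [wordProd_cons, wordProd_nil, mul_one, ← inv_s]; rfl
  | mul x y hx hy ihx ihy =>
    obtain ⟨I, hI⟩ := ihx
    obtain ⟨J, hJ⟩ := ihy
    exact ⟨I ++ J, by rw [wordProd_append, hI, hJ]; rfl⟩

lemma exists_word_of_length (w : D.weylGroup) :
    ∃ n, ∃ I : List ι, I.length = n ∧ D.wordProd I = w :=
  let ⟨I, hI⟩ := D.exists_word w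
  ⟨I.length, I, rfl, hI⟩

open Classical in
/-- The length of an element of the Weyl group: the smallest length of a word representing it. -/
def len (w : D.weylGroup) : ℕ := Nat.find (D.exists_word_of_length w)

lemma exists_reduced_word (w : D.weylGroup) :
    ∃ I : List ι, I.length = D.len w ∧ D.wordProd I = w := by
  classical exact Nat.find_spec (D.exists_word_of_length w)

lemma len_wordProd_le (I : List ι) : D.len (D.wordProd I) ≤ I.length := by
  classical exact Nat.find_min' _ ⟨I, rfl, rfl⟩

lemma len_mul_wordProd_le (w : D.weylGroup) (I : List ι) :
    D.len (w * D.wordProd I) ≤ D.len w + I.length := by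
  obtain ⟨J, hJ, rfl⟩ := D.exists_reduced_word w
  rw [← wordProd_append, ← hJ, ← List.length_append]
  exact D.len_wordProd_le _

lemma len_mul_s_le (w : D.weylGroup) (i : ι) : D.len (w * D.s i) ≤ D.len w + 1 := by
  simpa using D.len_mul_wordProd_le w [i]

lemma mul_s_mul_s (w : D.weylGroup) (i : ι) : w * D.s i * D.s i = w := by
  rw [mul_assoc, s_mul_self, mul_one]

lemma len_le_len_mul_s (w : D.weylGroup) (i : ι) : D.len w ≤ D.len (w * D.s i) + 1 := by
  simpa [mul_s_mul_s] using D.len_mul_s_le (w * D.s i) i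

lemma eq_one_or_exists_descent (w : D.weylGroup) : w = 1 ∨ ∃ j, D.len (w * D.s j) < D.len w := by
  obtain ⟨I, hI, hw⟩ := D.exists_reduced_word w
  induction I using List.reverseRecOn with
  | nil => exact Or.inl hw.symm
  | append_singleton I j _ =>
    refine Or.inr ⟨j, ?_⟩
    rw [← hI, ← hw, wordProd_append, wordProd_cons, wordProd_nil, mul_one, mul_s_mul_s]
    exact (D.len_wordProd_le I).trans_lt (by simp)

/-- A vector that is a combination of simple roots with natural number coefficients. -/
def IsPos (β : Module.Dual k 𝔥) : Prop := ∃ c : ι → ℕ, β = ∑ i, (c i : k) • D.root i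

lemma isPos_root (i : ι) : D.IsPos (D.root i) := by
  classical exact ⟨Pi.single i 1, by simp [Pi.single_apply]⟩

lemma IsPos.add {β γ : Module.Dual k 𝔥} (hβ : D.IsPos β) (hγ : D.IsPos γ) : D.IsPos (β + γ) := by
  obtain ⟨c, rfl⟩ := hβ
  obtain ⟨d, rfl⟩ := hγ
  exact ⟨c + d, by simp [add_smul, Finset.sum_add_distrib]⟩

lemma IsPos.intCast_smul {β : Module.Dual k 𝔥} (hβ : D.IsPos β) {z : ℤ} (hz : 0 ≤ z) :
    D.IsPos ((z : k) • β) := by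
  obtain ⟨c, rfl⟩ := hβ
  lift z to ℕ using hz
  exact ⟨fun i => z * c i, by simp [Finset.smul_sum, mul_smul]⟩

lemma IsPos.not_neg [CharZero k] {β : Module.Dual k 𝔥} (hβ : D.IsPos β) (hβ' : D.IsPos (-β)) :
    β = 0 := by
  obtain ⟨c, hc⟩ := hβ
  obtain ⟨d, hd⟩ := hβ'
  have h : ∑ i, ((c i : k) + d i) • D.root i = 0 := by
    simp only [add_smul, Finset.sum_add_distrib, ← hc, ← hd, add_neg_cancel]
  have h0 := Fintype.linearIndependent_iff.1 D.linearIndependent_root _ h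
  rw [hc]
  refine Finset.sum_eq_zero fun i _ => ?_
  have : c i + d i = 0 := by exact_mod_cast h0 i
  rw [show c i = 0 by omega, Nat.cast_zero, zero_smul]

lemma smul_root_ne_zero (w : D.weylGroup) (i : ι) : w • D.root i ≠ 0 := fun h =>
  D.linearIndependent_root.ne_zero i ((smul_eq_zero_iff_eq w).1 h)

/-- A maximal factorization `w = v u` with `u` an alternating word in `i`, `j` and
`ℓ(w) = ℓ(v) + ℓ(u)`. -/
lemma exists_dihedral_factor {w : D.weylGroup} {j : ι} (i : ι) (h : D.len (w * D.s j) < D.len w) :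
    ∃ (v : D.weylGroup) (n : ℕ), 0 < n ∧ w = v * D.wordProd (alternatingWord i j n) ∧
      D.len w = D.len v + n ∧ D.len v ≤ D.len (v * D.s i) ∧ D.len v ≤ D.len (v * D.s j) := by
  classical
  let P : ℕ → Prop := fun n => D.len (w * (D.wordProd (alternatingWord i j n))⁻¹) + n = D.len w
  have hP1 : P 1 := by
    have := D.len_le_len_mul_s w j
    simp only [P, CoxeterSystem.alternatingWord, List.concat_eq_append, List.nil_append,
      wordProd_cons, wordProd_nil, mul_one, inv_s]
    omega
  have hle {n : ℕ} (hn : P n) : n ≤ D.len w := by simp only [P] at hn; omega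
  let n := Nat.findGreatest P (D.len w)
  have hn : P n := Nat.findGreatest_spec (hle hP1) hP1
  have hn1 : 1 ≤ n := Nat.le_findGreatest (hle hP1) hP1
  have hsucc : ¬ P (n + 1) := fun h => by
    have := Nat.le_findGreatest (hle h) h
    change n + 1 ≤ n at this
    omega
  obtain ⟨n', hn'⟩ : ∃ n', n = n' + 1 := ⟨n - 1, by omega⟩
  set v := w * (D.wordProd (alternatingWord i j n))⁻¹ with hv
  have hw : w = v * D.wordProd (alternatingWord i j n) := by rw [hv, inv_mul_cancel_right]
  have hlen : D.len v + n = D.len w := hn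
  clear_value v
  -- the letter that would extend the alternating word
  have h₁ : D.len v ≤ D.len (v * D.s (if Even n then j else i)) := by
    have e : w * (D.wordProd (alternatingWord i j (n + 1)))⁻¹ =
        v * D.s (if Even n then j else i) := by
      rw [CoxeterSystem.alternatingWord_succ', wordProd_cons, mul_inv_rev, inv_s, ← mul_assoc, hv]
    have := D.len_le_len_mul_s v (if Even n then j else i)
    simp only [P, e] at hsucc
    omega
  -- the first letter of the alternating word
  have h₂ : D.len v ≤ D.len (v * D.s (if Even n' then j else i)) := by
    have e : w = v * D.s (if Even n' then j else i) * D.wordProd (alternatingWord i j n') := by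
      rw [hw, hn', CoxeterSystem.alternatingWord_succ', wordProd_cons, mul_assoc]
    have := D.len_mul_wordProd_le (v * D.s (if Even n' then j else i)) (alternatingWord i j n')
    rw [← e, CoxeterSystem.length_alternatingWord] at this
    omega
  simp only [hn', Nat.even_add_one] at h₁
  refine ⟨v, n, by omega, hw, hlen.symm, ?_⟩
  by_cases he : Even n'
  · simp only [he, not_true_eq_false, if_false, if_true] at h₁ h₂
    exact ⟨h₁, h₂⟩
  · simp only [he, not_false_eq_true, if_false, if_true] at h₁ h₂
    exact ⟨h₂, h₁⟩

variable [CharZero k]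

/-- If `j` is a right descent of `w` and `i ≠ j`, then either `w` ends with the longest element of
the dihedral group of `i` and `j`, or `w α_i` is positive. The positivity of shorter elements is
assumed, so that this serves as the step of an induction. -/
lemma exists_longest_factor_or_isPos {w : D.weylGroup} {i j : ι} (hij : i ≠ j)
    (h : D.len (w * D.s j) < D.len w)
    (ih : ∀ v, D.len v < D.len w → ∀ l, D.len v ≤ D.len (v * D.s l) → D.IsPos (v • D.root l)) :
    (D.m i j ≠ 0 ∧ ∃ v, w = v * D.wordProd (alternatingWord i j (D.m i j)) ∧
      D.len w = D.len v + D.m i j) ∨ D.IsPos (w • D.root i) := by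
  obtain ⟨v, n, hn, hw, hlen, hi, hj⟩ := D.exists_dihedral_factor i h
  by_cases hm : D.m i j = 0 ∨ n < D.m i j
  · right
    rw [hw, mul_smul, wordProd_alternatingWord_smul_root, smul_add, smul_smul_comm, smul_smul_comm]
    have hc := D.dihedralCoord_nonneg hij hm
    exact ((ih v (by omega) i hi).intCast_smul D hc.1).add D
      ((ih v (by omega) j hj).intCast_smul D hc.2)
  · left
    push Not at hm
    obtain ⟨d, rfl⟩ := Nat.exists_eq_add_of_le hm.2
    obtain ⟨Q, hQ, e⟩ := exists_alternatingWord_append i j (D.m i j) d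
    have hw' : w = v * D.wordProd Q * D.wordProd (alternatingWord i j (D.m i j)) := by
      rw [hw, e, wordProd_append, mul_assoc]
    refine ⟨hm.1, v * D.wordProd Q, hw', le_antisymm ?_ ?_⟩
    · have := D.len_mul_wordProd_le (v * D.wordProd Q) (alternatingWord i j (D.m i j))
      rwa [← hw', CoxeterSystem.length_alternatingWord] at this
    · have := D.len_mul_wordProd_le v Q
      omega

/-- If `w` ends with the longest element of the dihedral group of `i` and `j`, then `i` is a right
descent of `w`. -/
lemma len_mul_s_lt_of_longest_factor {w v : D.weylGroup} {i j : ι} (hij : i ≠ j)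
    (hm : D.m i j ≠ 0) (hw : w = v * D.wordProd (alternatingWord i j (D.m i j)))
    (hlen : D.len w = D.len v + D.m i j) : D.len (w * D.s i) < D.len w := by
  obtain ⟨n, hn⟩ := Nat.exists_eq_succ_of_ne_zero hm
  have e : w * D.s i = v * D.wordProd (alternatingWord i j n) := by
    rw [hw, D.wordProd_alternatingWord_m hij, hn, CoxeterSystem.alternatingWord_succ,
      List.concat_eq_append, wordProd_append, wordProd_cons, wordProd_nil, mul_one, mul_assoc,
      mul_assoc, s_mul_self, mul_one]
  have := D.len_mul_wordProd_le v (alternatingWord i j n)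
  rw [CoxeterSystem.length_alternatingWord, ← e] at this
  omega

/-- If `ℓ(w s_i) ≥ ℓ(w)` then the root `w α_i` is positive: for a right descent `j` of `w`, write
`w = v u` with `u` in the dihedral group of `s_i` and `s_j` and `v` shorter than `w`; then `w α_i` is
a nonnegative combination of `v α_i` and `v α_j`. -/
theorem isPos_smul_root (w : D.weylGroup) (i : ι) (h : D.len w ≤ D.len (w * D.s i)) :
    D.IsPos (w • D.root i) := by
  induction hn : D.len w using Nat.strong_induction_on generalizing w i with
  | h n ih =>
    obtain rfl | ⟨j, hj⟩ := D.eq_one_or_exists_descent w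
    · rw [one_smul]; exact D.isPos_root i
    · have hij : i ≠ j := by rintro rfl; omega
      have ih' : ∀ v, D.len v < D.len w → ∀ l, D.len v ≤ D.len (v * D.s l) →
          D.IsPos (v • D.root l) := fun v hv l hl => ih _ (hn ▸ hv) v l hl rfl
      obtain ⟨hm, v, hw, hlen⟩ | h' := D.exists_longest_factor_or_isPos hij hj ih'
      · exact absurd (D.len_mul_s_lt_of_longest_factor hij hm hw hlen) (not_lt.2 h)
      · exact h'

lemma isPos_neg_smul_root {w : D.weylGroup} {i : ι} (h : D.len (w * D.s i) < D.len w) :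
    D.IsPos (-(w • D.root i)) := by
  have := D.isPos_smul_root (w * D.s i) i (by rw [mul_s_mul_s]; exact h.le)
  rwa [mul_smul, s_smul_root_self, smul_neg] at this

/-- An element with two right descents `i ≠ j` ends with the longest element of the dihedral group
of `i` and `j`; in particular this group is finite. -/
lemma exists_longest_factor {w : D.weylGroup} {i j : ι} (hij : i ≠ j)
    (hi : D.len (w * D.s i) < D.len w) (hj : D.len (w * D.s j) < D.len w) :
    D.m i j ≠ 0 ∧ ∃ v, w = v * D.wordProd (alternatingWord i j (D.m i j)) ∧
      D.len w = D.len v + D.m i j :=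
  (D.exists_longest_factor_or_isPos hij hj fun v _ l hl => D.isPos_smul_root v l hl).resolve_right
    fun h => D.smul_root_ne_zero w i (h.not_neg D (D.isPos_neg_smul_root hi))

/-- An element of the Weyl group that keeps all simple roots positive is trivial. -/
lemma eq_one_of_isPos {w : D.weylGroup} (h : ∀ i, D.IsPos (w • D.root i)) : w = 1 :=
  (D.eq_one_or_exists_descent w).resolve_right fun ⟨j, hj⟩ =>
    D.smul_root_ne_zero w j ((h j).not_neg D (D.isPos_neg_smul_root hj))

/-- If `v α_i = α_j` then `v s_i v⁻¹ = s_j`. Indeed `v s_i v⁻¹ s_j` fixes `α_j` and changes each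
vector by a multiple of `α_j`, hence it keeps all simple roots positive. -/
lemma conj_s_eq {v : D.weylGroup} {i j : ι} (h : v • D.root i = D.root j) :
    v * D.s i * v⁻¹ = D.s j := by
  have hs (φ : Module.Dual k 𝔥) :
      (v * D.s i * v⁻¹) • φ = φ - (v⁻¹ • φ) (D.coroot i) • D.root j := by
    rw [mul_smul, mul_smul, s_smul, smul_sub, smul_inv_smul, smul_smul_comm, h]
  have hj : (v * D.s i * v⁻¹) • D.root j = -D.root j := by
    rw [mul_smul, mul_smul, ← h, inv_smul_smul, s_smul_root_self, smul_neg]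
  have key : v * D.s i * v⁻¹ * D.s j = 1 := by
    refine D.eq_one_of_isPos fun l => ?_
    by_cases hl : l = j
    · rw [hl, mul_smul, s_smul_root_self, smul_neg, hj, neg_neg]
      exact D.isPos_root j
    · obtain hlen | hlen := le_or_gt (D.len (v * D.s i * v⁻¹ * D.s j))
        (D.len (v * D.s i * v⁻¹ * D.s j * D.s l))
      · exact D.isPos_smul_root _ _ hlen
      · exfalso
        obtain ⟨c, hc⟩ := D.isPos_neg_smul_root hlen
        obtain ⟨x, hx⟩ : ∃ x : k, (v * D.s i * v⁻¹ * D.s j) • D.root l =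
            D.root l + x • D.root j := by
          refine ⟨D.A j l - (v⁻¹ • D.root l) (D.coroot i), ?_⟩
          rw [mul_smul, s_smul_root, smul_sub, smul_smul_comm, hj, hs]
          module
        rw [hx] at hc
        classical
        have h0 : ∑ a, ((c a : k) + (if a = l then 1 else 0) + x * (if a = j then 1 else 0)) •
            D.root a = 0 := by
          simp only [add_smul, Finset.sum_add_distrib, ← hc]
          simp [Finset.sum_ite_eq', ite_smul]
        have := Fintype.linearIndependent_iff.1 D.linearIndependent_root _ h0 l
        rw [if_pos rfl, if_neg hl, mul_zero, add_zero] at this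
        exact Nat.cast_add_one_ne_zero (c l) this
  rw [eq_inv_of_mul_eq_one_left key, inv_s]

end Length

end KacMoodyDatum

namespace KacMoodyDatum

open CoxeterSystem (alternatingWord)

/-! ### Matsumoto's theorem -/

section Matsumoto

variable {ι : Type*} [Fintype ι] {k : Type*} [Field k] {𝔥 : Type*} [AddCommGroup 𝔥] [Module k 𝔥]
  (D : KacMoodyDatum ι k 𝔥)

/-- A word is reduced if its length is the length of the element it represents. -/
def IsReduced (I : List ι) : Prop := D.len (D.wordProd I) = I.length

lemma IsReduced.of_append {I J : List ι} (h : D.IsReduced (I ++ J)) : D.IsReduced I := by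
  have h₁ := D.len_mul_wordProd_le (D.wordProd I) J
  have h₂ := D.len_wordProd_le I
  rw [← wordProd_append, h, List.length_append] at h₁
  exact le_antisymm h₂ (by omega)

lemma IsReduced.len_mul_s_lt {I : List ι} {i : ι} (h : D.IsReduced (I ++ [i])) :
    D.len (D.wordProd (I ++ [i]) * D.s i) < D.len (D.wordProd (I ++ [i])) := by
  rw [h, wordProd_append, wordProd_cons, wordProd_nil, mul_one, mul_s_mul_s, List.length_append,
    List.length_singleton]
  have := D.len_wordProd_le I
  omega

variable [CharZero k]

/-- Matsumoto's theorem: an equivalence relation on words that is stable under appending letters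
and contains the braid relations (with common beginnings) relates any two reduced words for the same
element. -/
theorem matsumoto {r : List ι → List ι → Prop} (hr : Equivalence r)
    (happ : ∀ I J i, r I J → r (I ++ [i]) (J ++ [i]))
    (hbraid : ∀ I i j, i ≠ j → D.m i j ≠ 0 →
      r (I ++ alternatingWord i j (D.m i j)) (I ++ alternatingWord j i (D.m i j)))
    {I J : List ι} (hI : D.IsReduced I) (hJ : D.IsReduced J)
    (h : D.wordProd I = D.wordProd J) : r I J := by
  induction hn : I.length using Nat.strong_induction_on generalizing I J with
  | h n ih =>
  have hlen : J.length = n := by rw [← hn, ← hI, ← hJ, h]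
  -- the case in which the last letters agree
  have same (I J : List ι) (i : ι) (hI : D.IsReduced (I ++ [i])) (hJ : D.IsReduced (J ++ [i]))
      (h : D.wordProd (I ++ [i]) = D.wordProd (J ++ [i])) (hn : (I ++ [i]).length = n) :
      r (I ++ [i]) (J ++ [i]) := by
    rw [List.length_append, List.length_singleton] at hn
    rw [wordProd_append, wordProd_append] at h
    exact happ _ _ _ (ih I.length (by omega) (hI.of_append D) (hJ.of_append D)
      (mul_right_cancel h) rfl)
  induction I using List.reverseRecOn with
  | nil =>
    obtain rfl : J = [] := List.length_eq_zero_iff.1 (by rw [hlen, ← hn]; rfl)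
    exact hr.refl _
  | append_singleton I i _ =>
    induction J using List.reverseRecOn with
    | nil => rw [← hlen] at hn; simp at hn
    | append_singleton J j _ =>
      by_cases hij : i = j
      · subst hij
        exact same I J i hI hJ h hn
      have hi := hI.len_mul_s_lt D
      have hj := hJ.len_mul_s_lt D
      rw [← h] at hj
      -- Both last letters are descents, so `w` has reduced words that end with the two alternating
      -- words of length `m_ij`. These are related by `hbraid`, and each of them shares its last letter
      -- with one of the given words.
      obtain ⟨hm, v, hw, hlv⟩ := D.exists_longest_factor hij hi hj
      obtain ⟨V, hV, rfl⟩ := D.exists_reduced_word v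
      obtain ⟨p, hp⟩ := Nat.exists_eq_succ_of_ne_zero hm
      have e := D.wordProd_alternatingWord_m hij
      have h₁ : V ++ alternatingWord i j (D.m i j) = V ++ alternatingWord j i p ++ [j] := by
        rw [hp, CoxeterSystem.alternatingWord_succ, List.concat_eq_append, List.append_assoc]
      have h₂ : V ++ alternatingWord j i (D.m i j) = V ++ alternatingWord i j p ++ [i] := by
        rw [hp, CoxeterSystem.alternatingWord_succ, List.concat_eq_append, List.append_assoc]
      have hw₁ : D.wordProd (V ++ alternatingWord i j (D.m i j)) = D.wordProd (I ++ [i]) := by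
        rw [hw, wordProd_append]
      have hw₂ : D.wordProd (V ++ alternatingWord j i (D.m i j)) = D.wordProd (I ++ [i]) := by
        rw [hw, wordProd_append, e]
      have hr₁ : D.IsReduced (V ++ alternatingWord i j (D.m i j)) := by
        rw [IsReduced, hw₁, hlv, List.length_append, CoxeterSystem.length_alternatingWord, hV]
      have hr₂ : D.IsReduced (V ++ alternatingWord j i (D.m i j)) := by
        rw [IsReduced, hw₂, hlv, List.length_append, CoxeterSystem.length_alternatingWord, hV]
      have hb := hbraid V i j hij hm
      have hn' : D.len (D.wordProd (I ++ [i])) = n := by rw [hI, hn]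
      have l₁ : (V ++ alternatingWord i j p ++ [i]).length = n := by
        rw [← h₂, ← hr₂, hw₂, hn']
      have l₂ : (V ++ alternatingWord j i p ++ [j]).length = n := by
        rw [← h₁, ← hr₁, hw₁, hn']
      rw [h₁] at hw₁ hr₁
      rw [h₂] at hw₂ hr₂
      rw [h₁, h₂] at hb
      exact hr.trans (hr.symm (same _ _ i hr₂ hI hw₂ l₁))
        (hr.trans (hr.symm hb) (same _ _ j hr₁ hJ (hw₁.trans h) l₂))

end Matsumoto

end KacMoodyDatum

/-! ### Reduction of words in Hecke-type algebras -/

section WordSpan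

variable {ι Γ S : Type*} [Ring Γ] [Ring S]

/-- The product of the elements `T i` along a word. -/
def wordMul (T : ι → S) (I : List ι) : S := (I.map T).prod

@[simp] lemma wordMul_nil (T : ι → S) : wordMul T [] = 1 := rfl

@[simp] lemma wordMul_cons (T : ι → S) (i : ι) (I : List ι) :
    wordMul T (i :: I) = T i * wordMul T I := by simp [wordMul]

@[simp] lemma wordMul_append (T : ι → S) (I J : List ι) :
    wordMul T (I ++ J) = wordMul T I * wordMul T J := by simp [wordMul]

lemma map_wordMul {S' : Type*} [Ring S'] (f : S →+* S') (T : ι → S) (I : List ι) :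
    f (wordMul T I) = wordMul (fun i => f (T i)) I := by
  rw [wordMul, wordMul, map_list_prod, List.map_map]; rfl

/-- The left `Γ`-span of the products of the `T i` along words of length less than `n`. -/
def wordSpan (g : Γ →+* S) (T : ι → S) (n : ℕ) : AddSubgroup S :=
  AddSubgroup.closure {x | ∃ (γ : Γ) (I : List ι), I.length < n ∧ g γ * wordMul T I = x}

variable {g : Γ →+* S} {T : ι → S}

lemma mul_wordMul_mem_wordSpan (γ : Γ) {I : List ι} {n : ℕ} (h : I.length < n) :
    g γ * wordMul T I ∈ wordSpan g T n :=
  AddSubgroup.subset_closure ⟨γ, I, h, rfl⟩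

lemma wordMul_mem_wordSpan {I : List ι} {n : ℕ} (h : I.length < n) :
    wordMul T I ∈ wordSpan g T n := by
  simpa using mul_wordMul_mem_wordSpan (g := g) (T := T) 1 h

lemma wordSpan_mono {m n : ℕ} (h : m ≤ n) : wordSpan g T m ≤ wordSpan g T n :=
  (AddSubgroup.closure_le _).2 fun _ ⟨γ, _, hI, e⟩ => e ▸ mul_wordMul_mem_wordSpan γ (hI.trans_le h)

lemma wordSpan_induction {n : ℕ} {P : S → Prop} (h : ∀ γ I, I.length < n → P (g γ * wordMul T I))
    (h0 : P 0) (hsub : ∀ x y, P x → P y → P (x - y)) {x : S} (hx : x ∈ wordSpan g T n) : P x := by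
  have hneg (x) (hx : P x) : P (-x) := by simpa using hsub 0 x h0 hx
  induction hx using AddSubgroup.closure_induction with
  | mem x hx =>
    obtain ⟨γ, I, hI, rfl⟩ := hx
    exact h γ I hI
  | zero => exact h0
  | add x y _ _ hx hy => simpa using hsub x (-y) hx (hneg y hy)
  | neg x _ hx => exact hneg x hx

lemma mul_mem_wordSpan (γ : Γ) {n : ℕ} {x : S} (hx : x ∈ wordSpan g T n) :
    g γ * x ∈ wordSpan g T n := by
  refine wordSpan_induction (P := fun x => g γ * x ∈ wordSpan g T n) (fun δ I hI => ?_) ?_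
    (fun x y hx hy => ?_) hx
  · rw [← mul_assoc, ← map_mul]
    exact mul_wordMul_mem_wordSpan _ hI
  · rw [mul_zero]; exact zero_mem _
  · rw [mul_sub]; exact sub_mem hx hy

lemma wordSpan_mul {n : ℕ} {x : S} (hx : x ∈ wordSpan g T n) (i : ι) :
    x * T i ∈ wordSpan g T (n + 1) := by
  refine wordSpan_induction (P := fun x => x * T i ∈ wordSpan g T (n + 1)) (fun δ I hI => ?_) ?_
    (fun x y hx hy => ?_) hx
  · rw [mul_assoc, show wordMul T I * T i = wordMul T (I ++ [i]) by simp]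
    exact mul_wordMul_mem_wordSpan _ (by simpa using hI)
  · rw [zero_mul]; exact zero_mem _
  · rw [sub_mul]; exact sub_mem hx hy

lemma mul_wordSpan (hdem : ∀ i γ, ∃ γ' δ, T i * g γ = g γ' * T i + g δ) (i : ι) {n : ℕ} {x : S}
    (hx : x ∈ wordSpan g T n) : T i * x ∈ wordSpan g T (n + 1) := by
  refine wordSpan_induction (P := fun x => T i * x ∈ wordSpan g T (n + 1)) (fun γ I hI => ?_) ?_
    (fun x y hx hy => ?_) hx
  · obtain ⟨γ', δ, e⟩ := hdem i γ
    rw [← mul_assoc, e, add_mul, mul_assoc, ← wordMul_cons]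
    exact add_mem (mul_wordMul_mem_wordSpan _ (by simpa using hI))
      (mul_wordMul_mem_wordSpan _ (by omega))
  · rw [mul_zero]; exact zero_mem _
  · rw [mul_sub]; exact sub_mem hx hy

lemma wordMul_mul_mem_wordSpan (hdem : ∀ i γ, ∃ γ' δ, T i * g γ = g γ' * T i + g δ) (I : List ι)
    {n : ℕ} {x : S} (hx : x ∈ wordSpan g T n) : wordMul T I * x ∈ wordSpan g T (n + I.length) := by
  induction I with
  | nil => simpa using hx
  | cons i I ih =>
    rw [wordMul_cons, mul_assoc]
    exact mul_wordSpan hdem i ih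

lemma exists_mem_wordSpan (hdem : ∀ i γ, ∃ γ' δ, T i * g γ = g γ' * T i + g δ)
    (hgen : Subring.closure (Set.range g ∪ Set.range T) = ⊤) (x : S) :
    ∃ n, x ∈ wordSpan g T n := by
  have hx : x ∈ Subring.closure (Set.range g ∪ Set.range T) := hgen ▸ Subring.mem_top x
  have key : ∀ n, ∀ y ∈ wordSpan g T n, ∃ n', x * y ∈ wordSpan g T n' := by
    induction hx using Subring.closure_induction with
    | mem x hx =>
      rintro n y hy
      obtain ⟨γ, rfl⟩ | ⟨i, rfl⟩ := hx
      · exact ⟨n, mul_mem_wordSpan γ hy⟩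
      · exact ⟨n + 1, mul_wordSpan hdem i hy⟩
    | zero => exact fun n y _ => ⟨n, by rw [zero_mul]; exact zero_mem _⟩
    | one => exact fun n y hy => ⟨n, by rwa [one_mul]⟩
    | add x z _ _ hx hz =>
      intro n y hy
      obtain ⟨a, ha⟩ := hx n y hy
      obtain ⟨b, hb⟩ := hz n y hy
      exact ⟨max a b, by
        rw [add_mul]
        exact add_mem (wordSpan_mono (le_max_left a b) ha) (wordSpan_mono (le_max_right a b) hb)⟩
    | neg x _ hx =>
      intro n y hy
      obtain ⟨a, ha⟩ := hx n y hy
      exact ⟨a, by rw [neg_mul]; exact neg_mem ha⟩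
    | mul x z _ _ hx hz =>
      intro n y hy
      obtain ⟨a, ha⟩ := hz n y hy
      obtain ⟨b, hb⟩ := hx a _ ha
      exact ⟨b, by rwa [mul_assoc]⟩
  simpa using key 1 1 (by simpa using wordMul_mem_wordSpan (g := g) (T := T) (I := []) one_pos)

namespace KacMoodyDatum

open CoxeterSystem (alternatingWord)

variable [Fintype ι] {k : Type*} [Field k] {𝔥 : Type*} [AddCommGroup 𝔥] [Module k 𝔥]
  (D : KacMoodyDatum ι k 𝔥)

/-- A reduced word for an element of the Weyl group. -/
def redWord (w : D.weylGroup) : List ι := (D.exists_reduced_word w).choose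

lemma length_redWord (w : D.weylGroup) : (D.redWord w).length = D.len w :=
  (D.exists_reduced_word w).choose_spec.1

lemma wordProd_redWord (w : D.weylGroup) : D.wordProd (D.redWord w) = w :=
  (D.exists_reduced_word w).choose_spec.2

lemma isReduced_redWord (w : D.weylGroup) : D.IsReduced (D.redWord w) := by
  rw [IsReduced, wordProd_redWord, length_redWord]

variable [CharZero k]

lemma len_mul_s_ne (w : D.weylGroup) (i : ι) : D.len (w * D.s i) ≠ D.len w := by
  intro h
  have h₁ := D.isPos_smul_root w i h.ge
  have h₂ := D.isPos_smul_root (w * D.s i) i (by rw [mul_s_mul_s]; exact h.le)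
  rw [mul_smul, s_smul_root_self, smul_neg] at h₂
  exact D.smul_root_ne_zero w i (h₁.not_neg D h₂)

/-- Modulo shorter words, the product of the `T i` along a reduced word depends only on the element
of the Weyl group. -/
lemma wordMul_sub_mem_wordSpan (hdem : ∀ i γ, ∃ γ' δ, T i * g γ = g γ' * T i + g δ)
    (hbraid : ∀ i j, i ≠ j → D.m i j ≠ 0 → wordMul T (alternatingWord i j (D.m i j)) -
      wordMul T (alternatingWord j i (D.m i j)) ∈ wordSpan g T (D.m i j))
    {I J : List ι} (hI : D.IsReduced I) (hJ : D.IsReduced J) (h : D.wordProd I = D.wordProd J) :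
    wordMul T I - wordMul T J ∈ wordSpan g T I.length := by
  let r (I J : List ι) : Prop :=
    I.length = J.length ∧ wordMul T I - wordMul T J ∈ wordSpan g T I.length
  have hr : Equivalence r := by
    refine ⟨fun I => ⟨rfl, by rw [sub_self]; exact zero_mem _⟩, fun ⟨h₁, h₂⟩ => ⟨h₁.symm, ?_⟩,
      fun ⟨h₁, h₂⟩ ⟨h₃, h₄⟩ => ⟨h₁.trans h₃, ?_⟩⟩
    · rw [← neg_sub, ← h₁]; exact neg_mem h₂
    · rw [← sub_add_sub_cancel]; exact add_mem h₂ (h₁ ▸ h₄)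
  refine (D.matsumoto hr (fun I J i ⟨h₁, h₂⟩ => ⟨by simp [h₁], ?_⟩) (fun I i j hij hm => ⟨?_, ?_⟩)
    hI hJ h).2
  · have := wordSpan_mul h₂ i
    rw [sub_mul] at this
    simpa using this
  · simp
  · rw [wordMul_append, wordMul_append, ← mul_sub, List.length_append,
      CoxeterSystem.length_alternatingWord, add_comm]
    exact wordMul_mul_mem_wordSpan hdem I (hbraid i j hij hm)

/-- The product of the `T i` along a word that is not reduced is a combination of products along
shorter words. -/
lemma wordMul_mem_wordSpan_length (hdem : ∀ i γ, ∃ γ' δ, T i * g γ = g γ' * T i + g δ)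
    (hsq : ∀ i, ∃ γ, T i * T i = g γ * T i)
    (hbraid : ∀ i j, i ≠ j → D.m i j ≠ 0 → wordMul T (alternatingWord i j (D.m i j)) -
      wordMul T (alternatingWord j i (D.m i j)) ∈ wordSpan g T (D.m i j))
    {I : List ι} (hI : ¬ D.IsReduced I) : wordMul T I ∈ wordSpan g T I.length := by
  induction I using List.reverseRecOn with
  | nil => exact absurd (Nat.le_zero.1 (D.len_wordProd_le [])) hI
  | append_singleton I i ih =>
    by_cases h : D.IsReduced I
    -- `i` is a descent of the element of `I`; up to shorter terms `I` may be replaced by a reduced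
    -- word that ends with `i`, and then the quadratic relation applies.
    · have e : D.wordProd (I ++ [i]) = D.wordProd I * D.s i := by simp
      have h₁ := D.len_mul_s_le (D.wordProd I) i
      have h₂ := D.len_le_len_mul_s (D.wordProd I) i
      have h₃ := D.len_mul_s_ne (D.wordProd I) i
      have h₄ : D.len (D.wordProd I * D.s i) ≠ I.length + 1 := fun h' => hI (by
        rw [IsReduced, e, h', List.length_append, List.length_singleton])
      rw [h] at h₁ h₂ h₃
      set J := D.redWord (D.wordProd I * D.s i)
      have hJw : D.wordProd (J ++ [i]) = D.wordProd I := by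
        rw [wordProd_append, wordProd_redWord, wordProd_cons, wordProd_nil, mul_one, mul_s_mul_s]
      have hJl : J.length + 1 = I.length := by rw [length_redWord]; omega
      have hJ : D.IsReduced (J ++ [i]) := by
        rw [IsReduced, hJw, h, List.length_append, List.length_singleton, hJl]
      have key := wordSpan_mul (D.wordMul_sub_mem_wordSpan hdem hbraid h hJ hJw.symm) i
      obtain ⟨γ, hγ⟩ := hsq i
      have h₅ : wordMul T J * (g γ * wordMul T [i]) ∈ wordSpan g T (2 + J.length) :=
        wordMul_mul_mem_wordSpan hdem J (mul_wordMul_mem_wordSpan γ (by simp))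
      rw [show 2 + J.length = I.length + 1 by omega] at h₅
      have h₆ := add_mem key h₅
      rw [List.length_append, List.length_singleton]
      convert h₆ using 1
      simp only [wordMul_append, wordMul_cons, wordMul_nil, mul_one]
      rw [← hγ]
      noncomm_ring
    · have := wordSpan_mul (ih h) i
      simpa using this

/-- Over a ring generated by `Γ` and by elements `T i` that can be moved past `Γ`, satisfy a
quadratic relation, and satisfy the braid relations up to shorter terms, every element is a left
`Γ`-combination of the products along the chosen reduced words. -/
theorem exists_sum_redWord (hdem : ∀ i γ, ∃ γ' δ, T i * g γ = g γ' * T i + g δ)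
    (hsq : ∀ i, ∃ γ, T i * T i = g γ * T i)
    (hbraid : ∀ i j, i ≠ j → D.m i j ≠ 0 → wordMul T (alternatingWord i j (D.m i j)) -
      wordMul T (alternatingWord j i (D.m i j)) ∈ wordSpan g T (D.m i j))
    (hgen : Subring.closure (Set.range g ∪ Set.range T) = ⊤) (x : S) :
    ∃ f : D.weylGroup →₀ Γ, x = f.sum fun w γ => g γ * wordMul T (D.redWord w) := by
  classical
  let Φ : (D.weylGroup →₀ Γ) →+ S := Finsupp.liftAddHom fun w =>
    (AddMonoidHom.mulRight (wordMul T (D.redWord w))).comp g.toAddMonoidHom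
  have hΦ (w : D.weylGroup) (γ : Γ) : Φ (Finsupp.single w γ) = g γ * wordMul T (D.redWord w) := by
    simp [Φ]
  have hmul (γ : Γ) {y : S} (hy : y ∈ Φ.range) : g γ * y ∈ Φ.range := by
    obtain ⟨f, rfl⟩ := hy
    induction f using Finsupp.induction_linear with
    | zero => rw [map_zero, mul_zero]; exact zero_mem _
    | add f f' h h' => rw [map_add, mul_add]; exact add_mem h h'
    | single w δ => exact ⟨Finsupp.single w (γ * δ), by rw [hΦ, hΦ, map_mul, mul_assoc]⟩
  have hle (n : ℕ) : wordSpan g T n ≤ Φ.range := by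
    induction n using Nat.strong_induction_on with
    | h n ih =>
      refine (AddSubgroup.closure_le _).2 ?_
      rintro _ ⟨γ, I, hI, rfl⟩
      refine hmul γ ?_
      by_cases h : D.IsReduced I
      · rw [← sub_add_cancel (wordMul T I) (wordMul T (D.redWord (D.wordProd I)))]
        refine add_mem (ih _ hI (D.wordMul_sub_mem_wordSpan hdem hbraid h (D.isReduced_redWord _)
          (D.wordProd_redWord _).symm)) ⟨Finsupp.single (D.wordProd I) 1, ?_⟩
        rw [hΦ, map_one, one_mul]
      · exact ih _ hI (D.wordMul_mem_wordSpan_length hdem hsq hbraid h)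
  obtain ⟨n, hn⟩ := exists_mem_wordSpan hdem hgen x
  obtain ⟨f, rfl⟩ := hle n hn
  exact ⟨f, by simp only [Φ, Finsupp.liftAddHom_apply]; rfl⟩

end KacMoodyDatum

end WordSpan

namespace FormalDemazureLattice

variable {ι : Type*} [Fintype ι] {k : Type*} [Field k] {𝔥 : Type*} [AddCommGroup 𝔥] [Module k 𝔥]
  {D : KacMoodyDatum ι k 𝔥} (L : FormalDemazureLattice D)

/-! ### Reflections in real roots -/

section Reflections

lemma exists_smul_simpleRoot (α : L.RealRoot) :
    ∃ (w : D.weylGroup) (i : ι), w • (L.simpleRoot i).1 = α.1 := by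
  obtain ⟨w, i, h⟩ := α.2
  exact ⟨w, i, Subtype.ext h⟩

/-- The image of a real root under an element of the Weyl group. -/
def smulRoot (w : D.weylGroup) (α : L.RealRoot) : L.RealRoot :=
  ⟨w • α.1, D.smul_mem_realRoots w α.2⟩

lemma s_smul_simpleRoot (i j : ι) :
    D.s i • (L.simpleRoot j).1 = (L.simpleRoot j).1 - D.A i j • (L.simpleRoot i).1 := by
  refine Subtype.ext ?_
  rw [coe_smul]
  change D.s i • D.root j = D.root j - D.A i j • D.root i
  rw [D.s_smul_root]
  exact congrArg (D.root j - ·) (Int.cast_smul_eq_zsmul k (D.A i j) (D.root i))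

lemma s_smul_simpleRoot_self (i : ι) : D.s i • (L.simpleRoot i).1 = -(L.simpleRoot i).1 := by
  rw [s_smul_simpleRoot, D.isGCM.diag]; module

lemma exists_s_smul (i : ι) (l : L.lattice) : ∃ n : ℤ, D.s i • l = l - n • (L.simpleRoot i).1 := by
  obtain ⟨z, hz⟩ := L.pairing_int l l.2 i
  refine ⟨z, Subtype.ext ?_⟩
  rw [coe_smul, D.s_smul, hz]
  exact congrArg ((l : Module.Dual k 𝔥) - ·) (Int.cast_smul_eq_zsmul k z (D.root i))

variable [CharZero k]

lemma refl_eq (α : L.RealRoot) {w : D.weylGroup} {i : ι} (h : w • (L.simpleRoot i).1 = α.1) :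
    L.refl α = w * D.s i * w⁻¹ := by
  have hα : (α.1 : Module.Dual k 𝔥) ∈ D.realRoots := α.2
  rw [refl, KacMoodyDatum.reflection, dif_pos hα]
  have hw : w • D.root i = α.1 := congrArg Subtype.val h
  have key (v : D.weylGroup) (j : ι) (hv : v • D.root j = α.1) :
      v * D.s j * v⁻¹ = w * D.s i * w⁻¹ := by
    rw [← D.conj_s_eq (v := w⁻¹ * v) (i := j) (j := i) (by rw [mul_smul, hv, ← hw, inv_smul_smul])]
    group
  exact key _ _ hα.choose_spec.choose_spec

lemma refl_simpleRoot (i : ι) : L.refl (L.simpleRoot i) = D.s i := by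
  rw [L.refl_eq _ (one_smul _ _)]; simp

lemma refl_mul_self (α : L.RealRoot) : L.refl α * L.refl α = 1 := by
  obtain ⟨w, i, h⟩ := L.exists_smul_simpleRoot α
  rw [L.refl_eq α h]
  calc w * D.s i * w⁻¹ * (w * D.s i * w⁻¹) = w * (D.s i * D.s i) * w⁻¹ := by group
    _ = 1 := by rw [D.s_mul_self]; group

lemma refl_smulRoot (w : D.weylGroup) (α : L.RealRoot) :
    L.refl (L.smulRoot w α) = w * L.refl α * w⁻¹ := by
  obtain ⟨v, i, h⟩ := L.exists_smul_simpleRoot α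
  rw [L.refl_eq α h, L.refl_eq (w := w * v) (i := i) _ (by rw [mul_smul, h]; rfl)]
  group

end Reflections

/-! ### The elements `x_α` -/

section Regularity

variable {R : Type*} [CommRing R] (F : FormalGroup R) {μ₁ μ₂ : R}

lemma smul_x {w : D.weylGroup} {α β : L.RealRoot} (h : w • α.1 = β.1) :
    w • L.x F α = L.x F β := by
  rw [x, x, ← h, FormalGroupAlgebra.smul_x]

variable {F}

lemma x_simpleRoot_mem_nonZeroDivisors (hF : F = hyperbolicFGL μ₁ μ₂) (i : ι) :
    L.x F (L.simpleRoot i) ∈ nonZeroDivisors (L.FGA F) := by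
  subst hF
  obtain ⟨n, b, t, h⟩ := L.exists_basis i
  have e : (L.simpleRoot i).1 = b t := Subtype.ext h.symm
  rw [x, e]
  exact FormalGroupAlgebra.x_basis_mem_nonZeroDivisors μ₁ μ₂ b t

lemma x_simpleRoot_dvd (hF : F = hyperbolicFGL μ₁ μ₂) (i : ι) (γ : L.FGA F) :
    L.x F (L.simpleRoot i) ∣ γ - D.s i • γ := by
  subst hF
  obtain ⟨n, b, t, h⟩ := L.exists_basis i
  have e : (L.simpleRoot i).1 = b t := Subtype.ext h.symm
  rw [x, e, FormalGroupAlgebra.smul_def]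
  exact FormalGroupAlgebra.x_basis_dvd_sub_map μ₁ μ₂ b t _ (fun l => e ▸ L.exists_s_smul i l) γ

lemma x_mem_nonZeroDivisors (hF : F = hyperbolicFGL μ₁ μ₂) (α : L.RealRoot) :
    L.x F α ∈ nonZeroDivisors (L.FGA F) := by
  obtain ⟨w, i, h⟩ := L.exists_smul_simpleRoot α
  rw [← L.smul_x F h, mem_nonZeroDivisors_iff_right]
  intro y hy
  have h₀ := (mem_nonZeroDivisors_iff_right.1 (L.x_simpleRoot_mem_nonZeroDivisors hF i)) (w⁻¹ • y)
    (by rw [← inv_smul_smul w (L.x F (L.simpleRoot i)), ← smul_mul', hy, smul_zero])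
  rwa [smul_eq_zero_iff_eq] at h₀

lemma algebraMap_Q_injective (hF : F = hyperbolicFGL μ₁ μ₂) :
    Function.Injective (algebraMap (L.FGA F) (L.Q F)) :=
  IsLocalization.injective (M := L.rootSubmonoid F) _ ((Submonoid.closure_le).2 (by
    rintro _ ⟨α, rfl⟩
    exact L.x_mem_nonZeroDivisors hF α))

variable [CharZero k]

lemma x_dvd (hF : F = hyperbolicFGL μ₁ μ₂) (α : L.RealRoot) (γ : L.FGA F) :
    L.x F α ∣ γ - L.refl α • γ := by
  obtain ⟨w, i, h⟩ := L.exists_smul_simpleRoot α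
  obtain ⟨δ, hδ⟩ := L.x_simpleRoot_dvd hF i (w⁻¹ • γ)
  refine ⟨w • δ, ?_⟩
  rw [← L.smul_x F h, ← smul_mul', ← hδ, smul_sub, smul_inv_smul, L.refl_eq α h, mul_smul, mul_smul]

lemma x_mul_demazureOp (hF : F = hyperbolicFGL μ₁ μ₂) (α : L.RealRoot) (γ : L.FGA F) :
    L.x F α * L.demazureOp F α γ = γ - L.refl α • γ := by
  obtain ⟨δ, hδ⟩ := L.x_dvd hF α γ
  have h : ∃ δ, L.x F α * δ = γ - L.refl α • γ := ⟨δ, hδ.symm⟩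
  rw [demazureOp, dif_pos h]
  exact h.choose_spec

end Regularity

end FormalDemazureLattice

namespace FormalDemazureLattice

open SkewMonoidAlgebra (single)

variable {ι : Type*} [Fintype ι] {k : Type*} [Field k] {𝔥 : Type*} [AddCommGroup 𝔥] [Module k 𝔥]
  {D : KacMoodyDatum ι k 𝔥} (L : FormalDemazureLattice D)

/-! ### The elements `1 / x_α` -/

section Inverses

variable {R : Type*} [CommRing R] {F : FormalGroup R} {μ₁ μ₂ : R}

lemma algebraMap_x_mul_xInv (α : L.RealRoot) :
    algebraMap (L.FGA F) (L.Q F) (L.x F α) * L.xInv F α = 1 := by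
  exact (IsLocalization.mk'_spec' (L.Q F) _ _).trans (map_one _)

lemma xInv_eq_of_mul_eq_one {α : L.RealRoot} {y : L.Q F}
    (h : algebraMap (L.FGA F) (L.Q F) (L.x F α) * y = 1) : L.xInv F α = y :=
  (left_inv_eq_right_inv (by rw [mul_comm]; exact h) (L.algebraMap_x_mul_xInv α)).symm

lemma smul_xInv {w : D.weylGroup} {α β : L.RealRoot} (h : w • α.1 = β.1) :
    w • L.xInv F α = L.xInv F β :=
  (L.xInv_eq_of_mul_eq_one (by
    rw [← L.smul_x F h, ← smul_algebraMap_Q, ← smul_mul', algebraMap_x_mul_xInv, smul_one])).symm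

lemma xInv_add (hF : F = hyperbolicFGL μ₁ μ₂) {α β γ : L.RealRoot} (h : γ.1 = α.1 + β.1) :
    L.xInv F γ * (L.xInv F α + L.xInv F β - algebraMap R (L.Q F) μ₁) =
      L.xInv F α * L.xInv F β + algebraMap R (L.Q F) μ₂ := by
  subst hF
  have := L.free
  have E := congrArg (algebraMap (L.FGA (hyperbolicFGL μ₁ μ₂)) (L.Q (hyperbolicFGL μ₁ μ₂)))
    (FormalGroupAlgebra.x_add μ₁ μ₂ (Module.Free.chooseBasis ℤ L.lattice) α.1 β.1)
  rw [← h] at E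
  simp only [map_mul, map_add, map_sub, map_one, ← IsScalarTower.algebraMap_apply] at E
  have hA := L.algebraMap_x_mul_xInv (F := hyperbolicFGL μ₁ μ₂) α
  have hB := L.algebraMap_x_mul_xInv (F := hyperbolicFGL μ₁ μ₂) β
  have hC := L.algebraMap_x_mul_xInv (F := hyperbolicFGL μ₁ μ₂) γ
  rw [x] at hA hB hC
  generalize algebraMap (L.FGA (hyperbolicFGL μ₁ μ₂)) (L.Q (hyperbolicFGL μ₁ μ₂))
    (FormalGroupAlgebra.x _ α.1) = a at *
  generalize algebraMap (L.FGA (hyperbolicFGL μ₁ μ₂)) (L.Q (hyperbolicFGL μ₁ μ₂))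
    (FormalGroupAlgebra.x _ β.1) = b at *
  generalize algebraMap (L.FGA (hyperbolicFGL μ₁ μ₂)) (L.Q (hyperbolicFGL μ₁ μ₂))
    (FormalGroupAlgebra.x _ γ.1) = g at *
  generalize L.xInv (hyperbolicFGL μ₁ μ₂) α = A at *
  generalize L.xInv (hyperbolicFGL μ₁ μ₂) β = B at *
  generalize L.xInv (hyperbolicFGL μ₁ μ₂) γ = C at *
  generalize algebraMap R (L.Q (hyperbolicFGL μ₁ μ₂)) μ₁ = m at *
  generalize algebraMap R (L.Q (hyperbolicFGL μ₁ μ₂)) μ₂ = c at *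
  -- the addition law multiplied by the inverses of the three elements
  linear_combination (-A * B * C) * E + (A * B + c) * hC +
    (c * B * b * C * g - B * C + m * C * B * b) * hA + (c * C * g - A * C + m * C) * hB

lemma xInv_neg (hF : F = hyperbolicFGL μ₁ μ₂) {α β : L.RealRoot} (h : β.1 = -α.1) :
    L.xInv F β = algebraMap R (L.Q F) μ₁ - L.xInv F α := by
  subst hF
  have := L.free
  have E := congrArg (algebraMap (L.FGA (hyperbolicFGL μ₁ μ₂)) (L.Q (hyperbolicFGL μ₁ μ₂)))
    (FormalGroupAlgebra.x_add μ₁ μ₂ (Module.Free.chooseBasis ℤ L.lattice) α.1 β.1)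
  rw [h, add_neg_cancel, FormalGroupAlgebra.x_zero μ₁ μ₂ (Module.Free.chooseBasis ℤ L.lattice),
    ← h] at E
  simp only [map_mul, map_add, map_sub, map_one, ← IsScalarTower.algebraMap_apply, map_zero] at E
  have hA := L.algebraMap_x_mul_xInv (F := hyperbolicFGL μ₁ μ₂) α
  have hB := L.algebraMap_x_mul_xInv (F := hyperbolicFGL μ₁ μ₂) β
  rw [x] at hA hB
  generalize algebraMap (L.FGA (hyperbolicFGL μ₁ μ₂)) (L.Q (hyperbolicFGL μ₁ μ₂))
    (FormalGroupAlgebra.x _ α.1) = a at *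
  generalize algebraMap (L.FGA (hyperbolicFGL μ₁ μ₂)) (L.Q (hyperbolicFGL μ₁ μ₂))
    (FormalGroupAlgebra.x _ β.1) = b at *
  generalize L.xInv (hyperbolicFGL μ₁ μ₂) α = A at *
  generalize L.xInv (hyperbolicFGL μ₁ μ₂) β = B at *
  generalize algebraMap R (L.Q (hyperbolicFGL μ₁ μ₂)) μ₁ = m at *
  linear_combination (-A * B) * E + (m * B * b - B) * hA + (m - A) * hB

end Inverses

/-! ### The relations between the `X_i` -/

section Relations

variable {R : Type*} [CommRing R] {F : FormalGroup R} {μ₁ μ₂ : R}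

lemma smul_QW (r : R) (f : L.QW F) : r • f = single 1 (algebraMap R (L.Q F) r) * f :=
  Algebra.smul_def r f

lemma X_eq_divDiff (α : L.RealRoot) : L.X F α = divDiff (L.refl α) (L.xInv F α) := rfl

lemma single_one_algebraMap (r : R) :
    (single 1 (algebraMap R (L.Q F) r) : L.QW F) = algebraMap R (L.QW F) r := rfl

lemma s_smul_xInv_self (hF : F = hyperbolicFGL μ₁ μ₂) (i : ι) :
    D.s i • L.xInv F (L.simpleRoot i) =
      algebraMap R (L.Q F) μ₁ - L.xInv F (L.simpleRoot i) := by
  rw [L.smul_xInv (β := L.smulRoot (D.s i) (L.simpleRoot i)) rfl]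
  exact L.xInv_neg hF (L.s_smul_simpleRoot_self i)

variable [CharZero k]

lemma Xi_eq_divDiff (i : ι) : L.Xi F i = divDiff (D.s i) (L.xInv F (L.simpleRoot i)) := by
  rw [Xi, X_eq_divDiff, refl_simpleRoot]

lemma Xi_sq (hF : F = hyperbolicFGL μ₁ μ₂) (i : ι) : L.Xi F i ^ 2 = μ₁ • L.Xi F i := by
  rw [pow_two, smul_QW, Xi_eq_divDiff, divDiff_sq (D.s_mul_self i) (L.s_smul_xInv_self hF i)]

lemma Xi_comm {i j : ι} (h₁ : D.A i j = 0) (h₂ : D.A j i = 0) :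
    L.Xi F i * L.Xi F j = L.Xi F j * L.Xi F i := by
  rw [Xi_eq_divDiff, Xi_eq_divDiff]
  refine divDiff_comm (D.braid_two h₁ h₂) (L.smul_xInv ?_) (L.smul_xInv ?_)
  · rw [s_smul_simpleRoot, h₁, zero_smul, sub_zero]
  · rw [s_smul_simpleRoot, h₂, zero_smul, sub_zero]

lemma Xi_braid_three (hF : F = hyperbolicFGL μ₁ μ₂) {i j : ι} (h₁ : D.A i j = -1)
    (h₂ : D.A j i = -1) :
    L.Xi F j * L.Xi F i * L.Xi F j + μ₂ • L.Xi F j =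
      L.Xi F i * L.Xi F j * L.Xi F i + μ₂ • L.Xi F i := by
  have hij : D.s i • (L.simpleRoot j).1 = (L.simpleRoot i).1 + (L.simpleRoot j).1 := by
    rw [s_smul_simpleRoot, h₁]; module
  have hji : D.s j • (L.simpleRoot i).1 = (L.simpleRoot i).1 + (L.simpleRoot j).1 := by
    rw [s_smul_simpleRoot, h₂]; module
  rw [smul_QW, smul_QW, Xi_eq_divDiff, Xi_eq_divDiff]
  exact divDiff_braid_three (D.s_mul_self i) (D.s_mul_self j) (D.braid_three h₁ h₂)
    (C := L.xInv F (L.smulRoot (D.s i) (L.simpleRoot j))) (L.s_smul_xInv_self hF i)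
    (L.smul_xInv rfl) (L.smul_xInv (hji.trans hij.symm)) (L.s_smul_xInv_self hF j)
    (L.xInv_add hF hij)

lemma Xi_braid_four (hF : F = hyperbolicFGL μ₁ μ₂) {i j : ι} (h₁ : D.A i j = -2)
    (h₂ : D.A j i = -1) :
    (L.Xi F j * L.Xi F i) ^ 2 + (2 * μ₂) • (L.Xi F j * L.Xi F i) =
      (L.Xi F i * L.Xi F j) ^ 2 + (2 * μ₂) • (L.Xi F i * L.Xi F j) := by
  have hij : D.s i • (L.simpleRoot j).1 = (2 : ℤ) • (L.simpleRoot i).1 + (L.simpleRoot j).1 := by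
    rw [s_smul_simpleRoot, h₁]; module
  have hji : D.s j • (L.simpleRoot i).1 = (L.simpleRoot i).1 + (L.simpleRoot j).1 := by
    rw [s_smul_simpleRoot, h₂]; module
  have hii := L.s_smul_simpleRoot_self i
  have hjj := L.s_smul_simpleRoot_self j
  let C := L.smulRoot (D.s j) (L.simpleRoot i)
  let E := L.smulRoot (D.s i) (L.simpleRoot j)
  have hC : C.1 = (L.simpleRoot i).1 + (L.simpleRoot j).1 := hji
  have hE : E.1 = (2 : ℤ) • (L.simpleRoot i).1 + (L.simpleRoot j).1 := hij
  have key := divDiff_braid_four (D.s_mul_self i) (D.s_mul_self j) (D.braid_four h₁ h₂)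
    (C := L.xInv F C) (D := L.xInv F E) (c := algebraMap R (L.Q F) μ₂) (L.s_smul_xInv_self hF i)
    (L.smul_xInv rfl) (L.smul_xInv (by rw [hC, smul_add, hii, hij]; module)) (L.smul_xInv rfl)
    (L.s_smul_xInv_self hF j)
    (L.smul_xInv (by rw [hE, smul_add, smul_comm (D.s j), hji, hjj]; module))
    (L.smul_algebraMap_base F _ _) (L.smul_algebraMap_base F _ _)
    (L.xInv_add hF hC) (L.xInv_add hF (by rw [hC, hE]; module))
  rw [← Xi_eq_divDiff, ← Xi_eq_divDiff] at key
  simpa only [Algebra.smul_def, map_mul, map_ofNat, ← single_one_algebraMap] using key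

lemma Xi_braid_six (hF : F = hyperbolicFGL μ₁ μ₂) {i j : ι} (h₁ : D.A i j = -3)
    (h₂ : D.A j i = -1) :
    (L.Xi F j * L.Xi F i) ^ 3 + (4 * μ₂) • (L.Xi F j * L.Xi F i) ^ 2 +
        (3 * μ₂ ^ 2) • (L.Xi F j * L.Xi F i) =
      (L.Xi F i * L.Xi F j) ^ 3 + (4 * μ₂) • (L.Xi F i * L.Xi F j) ^ 2 +
        (3 * μ₂ ^ 2) • (L.Xi F i * L.Xi F j) := by
  have hij : D.s i • (L.simpleRoot j).1 = (3 : ℤ) • (L.simpleRoot i).1 + (L.simpleRoot j).1 := by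
    rw [s_smul_simpleRoot, h₁]; module
  have hji : D.s j • (L.simpleRoot i).1 = (L.simpleRoot i).1 + (L.simpleRoot j).1 := by
    rw [s_smul_simpleRoot, h₂]; module
  have hii := L.s_smul_simpleRoot_self i
  have hjj := L.s_smul_simpleRoot_self j
  let C := L.smulRoot (D.s j) (L.simpleRoot i)
  let D' := L.smulRoot (D.s i) C
  let E := L.smulRoot (D.s i) (L.simpleRoot j)
  let G := L.smulRoot (D.s j) E
  have hC : C.1 = (L.simpleRoot i).1 + (L.simpleRoot j).1 := hji
  have hD : D'.1 = (2 : ℤ) • (L.simpleRoot i).1 + (L.simpleRoot j).1 := by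
    change D.s i • C.1 = _
    rw [hC, smul_add, hii, hij]; module
  have hE : E.1 = (3 : ℤ) • (L.simpleRoot i).1 + (L.simpleRoot j).1 := hij
  have hG : G.1 = (3 : ℤ) • (L.simpleRoot i).1 + (2 : ℤ) • (L.simpleRoot j).1 := by
    change D.s j • E.1 = _
    rw [hE, smul_add, smul_comm (D.s j), hji, hjj]; module
  have key := divDiff_braid_six (D.s_mul_self i) (D.s_mul_self j) (D.braid_six h₁ h₂)
    (C := L.xInv F C) (D := L.xInv F D') (E := L.xInv F E) (G' := L.xInv F G)
    (m := algebraMap R (L.Q F) μ₁) (c := algebraMap R (L.Q F) μ₂) (L.s_smul_xInv_self hF i)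
    (L.smul_xInv rfl) (L.smul_xInv rfl)
    (L.smul_xInv (by rw [hG, smul_add, smul_comm (D.s i), smul_comm (D.s i), hii, hij]; module))
    (L.smul_xInv rfl) (L.s_smul_xInv_self hF j)
    (L.smul_xInv (by rw [hD, smul_add, smul_comm (D.s j), hji, hjj]; module)) (L.smul_xInv rfl)
    (L.smul_algebraMap_base F _ _) (L.smul_algebraMap_base F _ _)
    (L.smul_algebraMap_base F _ _) (L.smul_algebraMap_base F _ _)
    (L.xInv_add hF hC) (L.xInv_add hF (by rw [hC, hD]; module))
    (L.xInv_add hF (by rw [hD, hE]; module)) (L.xInv_add hF (by rw [hE, hG]; module))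
  rw [← Xi_eq_divDiff, ← Xi_eq_divDiff] at key
  simpa only [Algebra.smul_def, map_mul, map_pow, map_ofNat, ← single_one_algebraMap] using key

lemma ofFGA_mul_X (hF : F = hyperbolicFGL μ₁ μ₂) (α : L.RealRoot) (γ : L.FGA F) :
    L.ofFGA F γ * L.X F α =
      L.X F α * L.ofFGA F (L.refl α • γ) + L.ofFGA F (L.demazureOp F α γ) := by
  have e : algebraMap (L.FGA F) (L.Q F) γ * L.xInv F α =
      L.xInv F α * algebraMap (L.FGA F) (L.Q F) (L.refl α • γ) +
        algebraMap (L.FGA F) (L.Q F) (L.demazureOp F α γ) := by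
    have h := congrArg (algebraMap (L.FGA F) (L.Q F)) (L.x_mul_demazureOp hF α γ)
    rw [map_mul, map_sub] at h
    linear_combination (-L.xInv F α) * h +
      algebraMap (L.FGA F) (L.Q F) (L.demazureOp F α γ) * L.algebraMap_x_mul_xInv (F := F) α
  have h₁ (γ : L.FGA F) : L.ofFGA F γ = single 1 (algebraMap (L.FGA F) (L.Q F) γ) := rfl
  have h₂ : L.refl α • L.refl α • γ = γ := by rw [smul_smul, refl_mul_self, one_smul]
  have h₃ : L.X F α = single 1 (L.xInv F α) - single (L.refl α) (L.xInv F α) := by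
    rw [X, mul_sub, mul_one, SkewMonoidAlgebra.single_mul_single, one_mul, one_smul, mul_one]
  rw [h₁, h₁, h₁, h₃, mul_sub, sub_mul]
  simp only [SkewMonoidAlgebra.single_mul_single, one_mul, mul_one, one_smul]
  have e' := congrArg (single (1 : D.weylGroup)) e
  rw [SkewMonoidAlgebra.single_add] at e'
  rw [smul_algebraMap_Q, h₂, e', mul_comm (L.xInv F α) (algebraMap (L.FGA F) (L.Q F) γ)]
  abel

end Relations

end FormalDemazureLattice

namespace FormalDemazureLattice

open SkewMonoidAlgebra (single)
open CoxeterSystem (alternatingWord)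

variable {ι : Type*} [Fintype ι] {k : Type*} [Field k] {𝔥 : Type*} [AddCommGroup 𝔥] [Module k 𝔥]
  {D : KacMoodyDatum ι k 𝔥} (L : FormalDemazureLattice D)
  {R : Type*} [CommRing R] {F : FormalGroup R} {μ₁ μ₂ : R}

/-! ### The presented algebra -/

section Presented

lemma rel_presFGA_algebraMap (r : R) :
    L.presFGA F μ₁ μ₂ (algebraMap R (L.FGA F) r) = algebraMap R _ r :=
  (RingQuot.mkAlgHom_rel R (Rel.base r)).trans (AlgHom.commutes _ r)

lemma rel_presFGA_add (γ γ' : L.FGA F) :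
    L.presFGA F μ₁ μ₂ (γ + γ') = L.presFGA F μ₁ μ₂ γ + L.presFGA F μ₁ μ₂ γ' :=
  (RingQuot.mkAlgHom_rel R (Rel.add γ γ')).trans (map_add _ _ _)

lemma rel_presFGA_mul (γ γ' : L.FGA F) :
    L.presFGA F μ₁ μ₂ (γ * γ') = L.presFGA F μ₁ μ₂ γ * L.presFGA F μ₁ μ₂ γ' :=
  (RingQuot.mkAlgHom_rel R (Rel.mul γ γ')).trans (map_mul _ _ _)

variable (F μ₁ μ₂) in
/-- The homomorphism from `R⟦Λ⟧_F` to the presented algebra. -/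
def presHom : L.FGA F →ₐ[R] L.PresentedAlgebra F μ₁ μ₂ where
  toFun := L.presFGA F μ₁ μ₂
  map_one' := by rw [← map_one (algebraMap R (L.FGA F)), rel_presFGA_algebraMap, map_one]
  map_zero' := by rw [← map_zero (algebraMap R (L.FGA F)), rel_presFGA_algebraMap, map_zero]
  map_add' := L.rel_presFGA_add
  map_mul' := L.rel_presFGA_mul
  commutes' := L.rel_presFGA_algebraMap

lemma closure_presHom_union_presX :
    Subring.closure (Set.range (L.presHom F μ₁ μ₂ : L.FGA F →+* L.PresentedAlgebra F μ₁ μ₂) ∪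
      Set.range (L.presX F μ₁ μ₂)) = ⊤ := by
  rw [eq_top_iff]
  rintro x -
  obtain ⟨x, rfl⟩ := RingQuot.mkAlgHom_surjective R (L.Rel F μ₁ μ₂) x
  induction x using FreeAlgebra.induction with
  | grade0 r =>
    rw [AlgHom.commutes, ← (L.presHom F μ₁ μ₂).commutes]
    exact Subring.subset_closure (Or.inl ⟨_, rfl⟩)
  | grade1 a =>
    obtain γ | i := a
    · exact Subring.subset_closure (Or.inl ⟨γ, rfl⟩)
    · exact Subring.subset_closure (Or.inr ⟨i, rfl⟩)
  | mul x y hx hy => rw [map_mul]; exact mul_mem hx hy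
  | add x y hx hy => rw [map_add]; exact add_mem hx hy

lemma rel_presX_sq (i : ι) : L.presX F μ₁ μ₂ i ^ 2 = μ₁ • L.presX F μ₁ μ₂ i := by
  have h := RingQuot.mkAlgHom_rel R (Rel.sq (L := L) (F := F) (μ₁ := μ₁) (μ₂ := μ₂) i)
  simpa only [presX, map_pow, map_smul] using h

lemma rel_presX_comm {i j : ι} (hm : D.m i j = 2) :
    L.presX F μ₁ μ₂ i * L.presX F μ₁ μ₂ j = L.presX F μ₁ μ₂ j * L.presX F μ₁ μ₂ i := by
  have h := RingQuot.mkAlgHom_rel R (Rel.comm (L := L) (F := F) (μ₁ := μ₁) (μ₂ := μ₂) i j hm)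
  simpa only [presX, map_mul] using h

lemma rel_presX_three {i j : ι} (hm : D.m i j = 3) :
    L.presX F μ₁ μ₂ j * L.presX F μ₁ μ₂ i * L.presX F μ₁ μ₂ j -
        L.presX F μ₁ μ₂ i * L.presX F μ₁ μ₂ j * L.presX F μ₁ μ₂ i =
      μ₂ • (L.presX F μ₁ μ₂ i - L.presX F μ₁ μ₂ j) := by
  have h := RingQuot.mkAlgHom_rel R
    (Rel.braid_three (L := L) (F := F) (μ₁ := μ₁) (μ₂ := μ₂) i j hm)
  simpa only [presX, map_mul, map_sub, map_smul] using h

lemma rel_presX_four {i j : ι} (hm : D.m i j = 4) :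
    (L.presX F μ₁ μ₂ j * L.presX F μ₁ μ₂ i) ^ 2 - (L.presX F μ₁ μ₂ i * L.presX F μ₁ μ₂ j) ^ 2 =
      (2 * μ₂) • (L.presX F μ₁ μ₂ i * L.presX F μ₁ μ₂ j -
        L.presX F μ₁ μ₂ j * L.presX F μ₁ μ₂ i) := by
  have h := RingQuot.mkAlgHom_rel R
    (Rel.braid_four (L := L) (F := F) (μ₁ := μ₁) (μ₂ := μ₂) i j hm)
  simpa only [presX, map_mul, map_sub, map_smul, map_pow] using h

lemma rel_presX_six {i j : ι} (hm : D.m i j = 6) :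
    (L.presX F μ₁ μ₂ j * L.presX F μ₁ μ₂ i) ^ 3 - (L.presX F μ₁ μ₂ i * L.presX F μ₁ μ₂ j) ^ 3 =
      (4 * μ₂) • ((L.presX F μ₁ μ₂ i * L.presX F μ₁ μ₂ j) ^ 2 -
        (L.presX F μ₁ μ₂ j * L.presX F μ₁ μ₂ i) ^ 2) +
      (3 * μ₂ ^ 2) • (L.presX F μ₁ μ₂ i * L.presX F μ₁ μ₂ j -
        L.presX F μ₁ μ₂ j * L.presX F μ₁ μ₂ i) := by
  have h := RingQuot.mkAlgHom_rel R
    (Rel.braid_six (L := L) (F := F) (μ₁ := μ₁) (μ₂ := μ₂) i j hm)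
  simpa only [presX, map_mul, map_add, map_sub, map_smul, map_pow] using h

lemma smul_mem_wordSpan {n : ℕ} (r : R) {x : L.PresentedAlgebra F μ₁ μ₂}
    (hx : x ∈ wordSpan (L.presHom F μ₁ μ₂ : L.FGA F →+* L.PresentedAlgebra F μ₁ μ₂)
      (L.presX F μ₁ μ₂) n) :
    r • x ∈ wordSpan (L.presHom F μ₁ μ₂ : L.FGA F →+* L.PresentedAlgebra F μ₁ μ₂)
      (L.presX F μ₁ μ₂) n := by
  rw [Algebra.smul_def, ← (L.presHom F μ₁ μ₂).commutes]
  exact mul_mem_wordSpan _ hx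

variable [CharZero k]

lemma rel_presX_demazure (i : ι) (γ : L.FGA F) :
    L.presX F μ₁ μ₂ i * L.presHom F μ₁ μ₂ γ =
      L.presHom F μ₁ μ₂ (D.s i • γ) * L.presX F μ₁ μ₂ i +
        L.presHom F μ₁ μ₂ (-L.demazureOp F (L.simpleRoot i) (D.s i • γ)) := by
  have h := RingQuot.mkAlgHom_rel R
    (Rel.demazure (L := L) (F := F) (μ₁ := μ₁) (μ₂ := μ₂) (D.s i • γ) i)
  rw [refl_simpleRoot, smul_smul, D.s_mul_self, one_smul, map_mul, map_add, map_mul] at h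
  rw [map_neg, ← sub_eq_add_neg]
  exact eq_sub_of_add_eq h.symm

lemma braid_presX_mem_wordSpan {i j : ι} (hij : i ≠ j) (hm : D.m i j ≠ 0) :
    wordMul (L.presX F μ₁ μ₂) (alternatingWord i j (D.m i j)) -
      wordMul (L.presX F μ₁ μ₂) (alternatingWord j i (D.m i j)) ∈
      wordSpan (L.presHom F μ₁ μ₂ : L.FGA F →+* L.PresentedAlgebra F μ₁ μ₂)
        (L.presX F μ₁ μ₂) (D.m i j) := by
  have key (I : List ι) (n : ℕ) (h : I.length < n) := wordMul_mem_wordSpan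
    (g := (L.presHom F μ₁ μ₂ : L.FGA F →+* L.PresentedAlgebra F μ₁ μ₂))
    (T := L.presX F μ₁ μ₂) h
  have hcases : D.m i j = 2 ∨ D.m i j = 3 ∨ D.m i j = 4 ∨ D.m i j = 6 := by
    have := D.m_cases hij
    omega
  rcases hcases with h | h | h | h <;> rw [h]
  · have e := L.rel_presX_comm (F := F) (μ₁ := μ₁) (μ₂ := μ₂) h
    simp [CoxeterSystem.alternatingWord, e]
  · have := L.smul_mem_wordSpan μ₂ (sub_mem (key [i] 3 (by simp)) (key [j] 3 (by simp)))
    simp only [wordMul_cons, wordMul_nil, mul_one] at this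
    rw [← L.rel_presX_three (F := F) (μ₁ := μ₁) (μ₂ := μ₂) h] at this
    simpa [CoxeterSystem.alternatingWord, mul_assoc] using this
  · have e := L.rel_presX_four (F := F) (μ₁ := μ₁) (μ₂ := μ₂) h
    have := L.smul_mem_wordSpan (2 * μ₂) (sub_mem (key [i, j] 4 (by simp)) (key [j, i] 4 (by simp)))
    rw [← neg_sub]
    refine neg_mem ?_
    simp only [wordMul_cons, wordMul_nil, mul_one] at this
    rw [← e] at this
    simpa [CoxeterSystem.alternatingWord, pow_succ, mul_assoc] using this
  · have e := L.rel_presX_six (F := F) (μ₁ := μ₁) (μ₂ := μ₂) h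
    have := add_mem (L.smul_mem_wordSpan (4 * μ₂)
        (sub_mem (key [i, j, i, j] 6 (by simp)) (key [j, i, j, i] 6 (by simp))))
      (L.smul_mem_wordSpan (3 * μ₂ ^ 2)
        (sub_mem (key [i, j] 6 (by simp)) (key [j, i] 6 (by simp))))
    rw [← neg_sub]
    refine neg_mem ?_
    simp only [pow_succ _ 2, pow_two, mul_assoc] at e
    simp only [wordMul_cons, wordMul_nil, mul_one, pow_two] at this
    rw [← e] at this
    simpa [CoxeterSystem.alternatingWord, mul_assoc] using this

/-- Every element of the presented algebra is a combination of the products of the `X_i` along the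
chosen reduced words, with coefficients in `R⟦Λ⟧_F`. -/
lemma exists_eq_sum_presX (x : L.PresentedAlgebra F μ₁ μ₂) :
    ∃ f : D.weylGroup →₀ L.FGA F, x = f.sum fun w γ =>
      L.presHom F μ₁ μ₂ γ * wordMul (L.presX F μ₁ μ₂) (D.redWord w) :=
  D.exists_sum_redWord (g := (L.presHom F μ₁ μ₂ : L.FGA F →+* L.PresentedAlgebra F μ₁ μ₂))
    (fun i γ => ⟨_, _, L.rel_presX_demazure i γ⟩)
    (fun i => ⟨algebraMap R _ μ₁, by
      rw [← pow_two, rel_presX_sq, Algebra.smul_def, ← (L.presHom F μ₁ μ₂).commutes]; rfl⟩)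
    (fun i j hij hm => L.braid_presX_mem_wordSpan hij hm) L.closure_presHom_union_presX x

end Presented

/-! ### Triangularity -/

section Triangularity

lemma isUnit_smul_xInv (w : D.weylGroup) (α : L.RealRoot) : IsUnit (w • L.xInv F α) :=
  (IsUnit.of_mul_eq_one _ (by rw [mul_comm]; exact L.algebraMap_x_mul_xInv α)).map
    (MulSemiringAction.toRingHom D.weylGroup (L.Q F) w)

variable [CharZero k]

lemma coeff_mul_Xi (f : L.QW F) (i : ι) (v : D.weylGroup) :
    (f * L.Xi F i).coeff v = f.coeff v * v • L.xInv F (L.simpleRoot i) -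
      f.coeff (v * D.s i) * (v * D.s i) • L.xInv F (L.simpleRoot i) := by
  have h : L.Xi F i = single 1 (L.xInv F (L.simpleRoot i)) -
      single (D.s i) (L.xInv F (L.simpleRoot i)) := by
    rw [Xi_eq_divDiff, divDiff, mul_sub, mul_one, SkewMonoidAlgebra.single_mul_single, one_mul,
      one_smul, mul_one]
  rw [h, mul_sub, SkewMonoidAlgebra.coeff_sub, Finsupp.sub_apply,
    SkewMonoidAlgebra.coeff_mul_single_one, SkewMonoidAlgebra.coeff_mul_single, D.inv_s]

/-- The product of the `X_i` along a word of length `n` involves no `δ_v` with `ℓ(v) ≥ n`, except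
possibly for the element `v` that the word represents. -/
lemma coeff_wordMul_Xi_eq_zero {I : List ι} {v : D.weylGroup} (hv : I.length ≤ D.len v)
    (hne : v ≠ D.wordProd I) : (wordMul (L.Xi F) I).coeff v = 0 := by
  induction I using List.reverseRecOn generalizing v with
  | nil => simp [(Ne.symm hne : 1 ≠ v)]
  | append_singleton I i ih =>
    simp only [wordMul_append, wordMul_cons, wordMul_nil, mul_one, coeff_mul_Xi]
    rw [List.length_append, List.length_singleton] at hv
    have hI := D.len_wordProd_le I
    have hv' := D.len_le_len_mul_s v i
    rw [ih (by omega) (by rintro rfl; omega), ih (by omega), zero_mul, zero_mul, sub_zero]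
    intro e
    apply hne
    simp [← e, D.mul_s_mul_s]

lemma isUnit_coeff_wordMul_Xi {I : List ι} (hI : D.IsReduced I) :
    IsUnit ((wordMul (L.Xi F) I).coeff (D.wordProd I)) := by
  induction I using List.reverseRecOn with
  | nil => simp
  | append_singleton I i ih =>
    have e : D.wordProd (I ++ [i]) = D.wordProd I * D.s i := by simp
    have hlen : D.len (D.wordProd I * D.s i) = I.length + 1 := by rw [← e, hI]; simp
    have hI' := D.len_wordProd_le I
    have h₀ : (wordMul (L.Xi F) I).coeff (D.wordProd I * D.s i) = 0 :=
      L.coeff_wordMul_Xi_eq_zero (by omega) (fun h => by rw [h] at hlen; omega)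
    rw [e]
    simp only [wordMul_append, wordMul_cons, wordMul_nil, mul_one, coeff_mul_Xi]
    rw [h₀, zero_mul, zero_sub, D.mul_s_mul_s]
    exact ((ih (hI.of_append D)).mul (L.isUnit_smul_xInv _ _)).neg

/-- The products of the `X_i` along the chosen reduced words are linearly independent over
`R⟦Λ⟧_F`: the product for `w` involves `δ_w` with an invertible coefficient, and otherwise only
`δ_v` with `v` shorter than `w`. -/
lemma eq_zero_of_sum_eq_zero (hF : F = hyperbolicFGL μ₁ μ₂) (f : D.weylGroup →₀ L.FGA F)
    (h : (f.sum fun w γ => L.ofFGA F γ * wordMul (L.Xi F) (D.redWord w)) = 0) : f = 0 := by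
  by_contra hf
  -- The coefficient at `δ_w`, for `w` of maximal length in the support, has only one contribution.
  obtain ⟨w, hw, hmax⟩ := f.support.exists_max_image D.len (Finsupp.support_nonempty_iff.2 hf)
  have hc : (f.sum fun v γ => algebraMap (L.FGA F) (L.Q F) γ *
      (wordMul (L.Xi F) (D.redWord v)).coeff w) = 0 := by
    have h' := congrArg (fun x : L.QW F => (SkewMonoidAlgebra.coeffAddEquiv x) w) h
    simp only [Finsupp.sum, map_sum, map_zero, Finsupp.finsetSum_apply] at h'
    rw [Finsupp.sum, ← show _ = (0 : L.Q F) from h']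
    refine Finset.sum_congr rfl fun v _ => ?_
    exact (SkewMonoidAlgebra.coeff_single_one_mul _ _ _).symm
  rw [Finsupp.sum, Finset.sum_eq_single_of_mem w hw] at hc
  · have hu := L.isUnit_coeff_wordMul_Xi (F := F) (D.isReduced_redWord w)
    rw [D.wordProd_redWord] at hu
    rw [hu.mul_left_eq_zero] at hc
    exact Finsupp.mem_support_iff.1 hw
      (L.algebraMap_Q_injective hF (by rw [hc, map_zero]))
  · intro v hv hvw
    rw [L.coeff_wordMul_Xi_eq_zero (by rw [D.length_redWord]; exact hmax v hv)
      (by rw [D.wordProd_redWord]; exact hvw.symm), mul_zero]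

end Triangularity

end FormalDemazureLattice

/-! ### The relations in terms of `m_ij` -/

lemma KacMoodyDatum.ne_of_m_ne_one {ι : Type*} [Fintype ι] {k : Type*} [Field k] {𝔥 : Type*}
    [AddCommGroup 𝔥] [Module k 𝔥] (D : KacMoodyDatum ι k 𝔥) {i j : ι} (h : D.m i j ≠ 1) :
    i ≠ j := by
  rintro rfl
  exact h (by rw [m, D.s_mul_self, orderOf_one])

namespace FormalDemazureLattice

open SkewMonoidAlgebra (single)

variable {ι : Type*} [Fintype ι] {k : Type*} [Field k] {𝔥 : Type*} [AddCommGroup 𝔥] [Module k 𝔥]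
  {D : KacMoodyDatum ι k 𝔥} (L : FormalDemazureLattice D)
  {R : Type*} [CommRing R] {F : FormalGroup R} {μ₁ μ₂ : R}

section RelationsByOrder

variable [CharZero k]

lemma Xi_rel_two {i j : ι} (h : D.m i j = 2) :
    L.Xi F i * L.Xi F j = L.Xi F j * L.Xi F i := by
  have := D.m_cases (D.ne_of_m_ne_one (i := i) (j := j) (by omega))
  exact L.Xi_comm (by omega) (by omega)

lemma Xi_rel_three (hF : F = hyperbolicFGL μ₁ μ₂) {i j : ι} (h : D.m i j = 3) :
    L.Xi F j * L.Xi F i * L.Xi F j - L.Xi F i * L.Xi F j * L.Xi F i =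
      μ₂ • (L.Xi F i - L.Xi F j) := by
  have := D.m_cases (D.ne_of_m_ne_one (i := i) (j := j) (by omega))
  have e := L.Xi_braid_three hF (i := i) (j := j) (by omega) (by omega)
  rw [smul_sub, sub_eq_sub_iff_add_eq_add, e, add_comm]

lemma Xi_rel_four (hF : F = hyperbolicFGL μ₁ μ₂) {i j : ι} (h : D.m i j = 4) :
    (L.Xi F j * L.Xi F i) ^ 2 - (L.Xi F i * L.Xi F j) ^ 2 =
      (2 * μ₂) • (L.Xi F i * L.Xi F j - L.Xi F j * L.Xi F i) := by
  have hc := D.m_cases (D.ne_of_m_ne_one (i := i) (j := j) (by omega))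
  have e : (L.Xi F j * L.Xi F i) ^ 2 + (2 * μ₂) • (L.Xi F j * L.Xi F i) =
      (L.Xi F i * L.Xi F j) ^ 2 + (2 * μ₂) • (L.Xi F i * L.Xi F j) := by
    by_cases h' : D.A i j = -2
    · exact L.Xi_braid_four hF h' (by omega)
    · exact (L.Xi_braid_four hF (i := j) (j := i) (by omega) (by omega)).symm
  rw [smul_sub, sub_eq_sub_iff_add_eq_add, e, add_comm]

lemma Xi_rel_six (hF : F = hyperbolicFGL μ₁ μ₂) {i j : ι} (h : D.m i j = 6) :
    (L.Xi F j * L.Xi F i) ^ 3 - (L.Xi F i * L.Xi F j) ^ 3 =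
      (4 * μ₂) • ((L.Xi F i * L.Xi F j) ^ 2 - (L.Xi F j * L.Xi F i) ^ 2) +
        (3 * μ₂ ^ 2) • (L.Xi F i * L.Xi F j - L.Xi F j * L.Xi F i) := by
  have hc := D.m_cases (D.ne_of_m_ne_one (i := i) (j := j) (by omega))
  have e : (L.Xi F j * L.Xi F i) ^ 3 + (4 * μ₂) • (L.Xi F j * L.Xi F i) ^ 2 +
        (3 * μ₂ ^ 2) • (L.Xi F j * L.Xi F i) =
      (L.Xi F i * L.Xi F j) ^ 3 + (4 * μ₂) • (L.Xi F i * L.Xi F j) ^ 2 +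
        (3 * μ₂ ^ 2) • (L.Xi F i * L.Xi F j) := by
    by_cases h' : D.A i j = -3
    · exact L.Xi_braid_six hF h' (by omega)
    · exact (L.Xi_braid_six hF (i := j) (j := i) (by omega) (by omega)).symm
  rw [← sub_eq_zero] at e ⊢
  rw [← e, smul_sub, smul_sub]
  abel

end RelationsByOrder

/-! ### Generation by the `X_i` -/

section Generation

variable (F) in
/-- The subalgebra generated by `R⟦Λ⟧_F` and the `X_i`. -/
def simpleSubalgebra : Subalgebra R (L.QW F) :=
  Algebra.adjoin R (Set.range (L.ofFGA F) ∪ Set.range (L.Xi F))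

lemma Xi_mem_simpleSubalgebra (i : ι) : L.Xi F i ∈ L.simpleSubalgebra F :=
  Algebra.subset_adjoin (Or.inr ⟨i, rfl⟩)

variable [CharZero k]

lemma single_s_mem_simpleSubalgebra (i : ι) :
    (single (D.s i) 1 : L.QW F) ∈ L.simpleSubalgebra F := by
  have e : (single (D.s i) 1 : L.QW F) =
      1 - L.ofFGA F (L.x F (L.simpleRoot i)) * L.Xi F i := by
    have h : L.ofFGA F (L.x F (L.simpleRoot i)) *
        single 1 (L.xInv F (L.simpleRoot i)) = 1 := by
      change single 1 _ * single 1 _ = _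
      rw [SkewMonoidAlgebra.single_mul_single, one_mul, one_smul, algebraMap_x_mul_xInv]
      rfl
    rw [Xi_eq_divDiff, divDiff, ← mul_assoc, h, one_mul, sub_sub_cancel]
  rw [e]
  exact sub_mem (one_mem _)
    (mul_mem (Algebra.subset_adjoin (Or.inl ⟨_, rfl⟩)) (L.Xi_mem_simpleSubalgebra i))

lemma single_mem_simpleSubalgebra (w : D.weylGroup) :
    (single w 1 : L.QW F) ∈ L.simpleSubalgebra F := by
  obtain ⟨I, rfl⟩ := D.exists_word w
  induction I with
  | nil => exact one_mem _
  | cons i I ih =>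
    have e : (single (D.wordProd (i :: I)) 1 : L.QW F) =
        single (D.s i) 1 * single (D.wordProd I) 1 := by
      rw [SkewMonoidAlgebra.single_mul_single, smul_one, one_mul, D.wordProd_cons]
    rw [e]
    exact mul_mem (L.single_s_mem_simpleSubalgebra i) ih

/-- Conjugation by `δ_w` turns `X_α` into `X_{w α}`. -/
lemma X_smulRoot (w : D.weylGroup) (α : L.RealRoot) :
    L.X F (L.smulRoot w α) = single w 1 * L.X F α * single w⁻¹ 1 := by
  simp only [X, refl_smulRoot, mul_sub, sub_mul, mul_one, SkewMonoidAlgebra.single_mul_single,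
    one_mul, smul_one, mul_inv_cancel,
    L.smul_xInv (w := w) (α := α) (β := L.smulRoot w α) rfl]

lemma X_mem_simpleSubalgebra (α : L.RealRoot) : L.X F α ∈ L.simpleSubalgebra F := by
  obtain ⟨w, i, h⟩ := L.exists_smul_simpleRoot α
  have e : α = L.smulRoot w (L.simpleRoot i) := Subtype.ext h.symm
  rw [e, X_smulRoot]
  exact mul_mem (mul_mem (L.single_mem_simpleSubalgebra w) (L.Xi_mem_simpleSubalgebra i))
    (L.single_mem_simpleSubalgebra _)

lemma affineDemazureAlgebra_eq : L.affineDemazureAlgebra F = L.simpleSubalgebra F := by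
  refine le_antisymm (Algebra.adjoin_le (Set.union_subset ?_ ?_))
    (Algebra.adjoin_mono (Set.union_subset_union_right _ ?_))
  · exact Set.subset_union_left.trans Algebra.subset_adjoin
  · refine SetLike.coe_subset_coe.2 (Algebra.adjoin_le ?_)
    rintro _ ⟨α, rfl⟩
    exact L.X_mem_simpleSubalgebra α
  · rintro _ ⟨i, rfl⟩
    exact Algebra.subset_adjoin ⟨_, rfl⟩

end Generation

/-! ### The isomorphism with the presented algebra -/

section Completeness

variable (F) in
/-- The homomorphism from the free algebra to `Q_W^F` given by the generators. -/
def freeHom : FreeAlgebra R (L.FGA F ⊕ ι) →ₐ[R] L.QW F :=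
  FreeAlgebra.lift R (Sum.elim (L.ofFGA F) (L.Xi F))

lemma freeHom_genFGA (γ : L.FGA F) : L.freeHom F (L.genFGA F γ) = L.ofFGA F γ :=
  FreeAlgebra.lift_ι_apply _ _

lemma freeHom_genX (i : ι) : L.freeHom F (L.genX F i) = L.Xi F i :=
  FreeAlgebra.lift_ι_apply _ _

variable [CharZero k]

lemma freeHom_eq_of_rel (hF : F = hyperbolicFGL μ₁ μ₂) ⦃a b : FreeAlgebra R (L.FGA F ⊕ ι)⦄
    (h : L.Rel F μ₁ μ₂ a b) : L.freeHom F a = L.freeHom F b := by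
  induction h with
  | base r => rw [freeHom_genFGA, AlgHom.commutes, AlgHom.commutes]
  | add γ γ' => simp only [map_add, freeHom_genFGA]
  | mul γ γ' => simp only [map_mul, freeHom_genFGA]
  | demazure γ i =>
    simp only [map_mul, map_add, freeHom_genFGA, freeHom_genX]
    exact L.ofFGA_mul_X hF _ γ
  | sq i =>
    simp only [map_pow, map_smul, freeHom_genX]
    exact L.Xi_sq hF i
  | comm i j h =>
    simp only [map_mul, freeHom_genX]
    exact L.Xi_rel_two h
  | braid_three i j h =>
    simp only [map_mul, map_sub, map_smul, freeHom_genX]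
    exact L.Xi_rel_three hF h
  | braid_four i j h =>
    simp only [map_mul, map_sub, map_smul, map_pow, freeHom_genX]
    exact L.Xi_rel_four hF h
  | braid_six i j h =>
    simp only [map_mul, map_sub, map_add, map_smul, map_pow, freeHom_genX]
    exact L.Xi_rel_six hF h

/-- The natural homomorphism from the presented algebra to `Q_W^F`. -/
def presToQW (hF : F = hyperbolicFGL μ₁ μ₂) : L.PresentedAlgebra F μ₁ μ₂ →ₐ[R] L.QW F :=
  RingQuot.liftAlgHom R ⟨L.freeHom F, L.freeHom_eq_of_rel hF⟩

lemma presToQW_mk (hF : F = hyperbolicFGL μ₁ μ₂) (a : FreeAlgebra R (L.FGA F ⊕ ι)) :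
    L.presToQW hF (RingQuot.mkAlgHom R (L.Rel F μ₁ μ₂) a) = L.freeHom F a :=
  RingQuot.liftAlgHom_mkAlgHom_apply R _ _ a

lemma presToQW_presFGA (hF : F = hyperbolicFGL μ₁ μ₂) (γ : L.FGA F) :
    L.presToQW hF (L.presFGA F μ₁ μ₂ γ) = L.ofFGA F γ :=
  (L.presToQW_mk hF _).trans (L.freeHom_genFGA γ)

lemma presToQW_presX (hF : F = hyperbolicFGL μ₁ μ₂) (i : ι) :
    L.presToQW hF (L.presX F μ₁ μ₂ i) = L.Xi F i :=
  (L.presToQW_mk hF _).trans (L.freeHom_genX i)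

lemma presToQW_injective (hF : F = hyperbolicFGL μ₁ μ₂) :
    Function.Injective (L.presToQW (F := F) hF) := by
  rw [injective_iff_map_eq_zero]
  intro x hx
  obtain ⟨f, rfl⟩ := L.exists_eq_sum_presX x
  have hf : f = 0 := by
    refine L.eq_zero_of_sum_eq_zero hF f ?_
    rw [← hx, map_finsuppSum]
    refine Finsupp.sum_congr fun w _ => ?_
    rw [map_mul]
    congr 1
    · exact (L.presToQW_presFGA hF _).symm
    · have h := map_wordMul (L.presToQW (F := F) hF).toRingHom (L.presX F μ₁ μ₂) (D.redWord w)
      refine Eq.trans ?_ h.symm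
      congr 1
      exact funext fun i => (L.presToQW_presX hF i).symm
  rw [hf, Finsupp.sum_zero_index]

lemma range_presToQW (hF : F = hyperbolicFGL μ₁ μ₂) :
    (L.presToQW (F := F) hF).range = L.affineDemazureAlgebra F := by
  have h : (L.freeHom F).range = L.simpleSubalgebra F := by
    rw [simpleSubalgebra, ← Set.Sum.elim_range, Algebra.adjoin_range_eq_range_freeAlgebra_lift]
    rfl
  rw [affineDemazureAlgebra_eq, ← h]
  ext y
  constructor
  · rintro ⟨x, rfl⟩
    obtain ⟨a, rfl⟩ := RingQuot.mkAlgHom_surjective R (L.Rel F μ₁ μ₂) x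
    exact ⟨a, (L.presToQW_mk hF a).symm⟩
  · rintro ⟨a, rfl⟩
    exact ⟨_, L.presToQW_mk hF a⟩

end Completeness

end FormalDemazureLattice

end HyperbolicDemazure

end

open HyperbolicDemazure

theorem proposition4p11 {ι : Type*} [Fintype ι] {k : Type*} [Field k] [CharZero k]
    {𝔥 : Type*} [AddCommGroup 𝔥] [Module k 𝔥] (D : KacMoodyDatum ι k 𝔥)
    (L : FormalDemazureLattice D) {R : Type*} [CommRing R] (μ₁ μ₂ : R)
    (F : FormalGroup R) (hF : F = hyperbolicFGL μ₁ μ₂) :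
    -- the reflections `s_α` and the Demazure operators are well defined
    (∀ (α : L.RealRoot) (w : D.weylGroup) (i : ι), w • (L.simpleRoot i).1 = α.1 →
      L.refl α = w * D.s i * w⁻¹) ∧
    (∀ α : L.RealRoot, L.x F α ∈ nonZeroDivisors (L.FGA F) ∧
      ∀ γ : L.FGA F, L.x F α * L.demazureOp F α γ = γ - L.refl α • γ) ∧
    -- generation
    L.affineDemazureAlgebra F =
      Algebra.adjoin R (Set.range (L.ofFGA F) ∪ Set.range (L.Xi F)) ∧
    -- the relations
    (∀ (α : L.RealRoot) (γ : L.FGA F),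
      L.ofFGA F γ * L.X F α =
        L.X F α * L.ofFGA F (L.refl α • γ) + L.ofFGA F (L.demazureOp F α γ)) ∧
    (∀ i, L.Xi F i ^ 2 = μ₁ • L.Xi F i) ∧
    (∀ i j, D.m i j = 2 → L.Xi F i * L.Xi F j = L.Xi F j * L.Xi F i) ∧
    (∀ i j, D.m i j = 3 →
      L.Xi F j * L.Xi F i * L.Xi F j - L.Xi F i * L.Xi F j * L.Xi F i =
        μ₂ • (L.Xi F i - L.Xi F j)) ∧
    (∀ i j, D.m i j = 4 →
      (L.Xi F j * L.Xi F i) ^ 2 - (L.Xi F i * L.Xi F j) ^ 2 =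
        (2 * μ₂) • (L.Xi F i * L.Xi F j - L.Xi F j * L.Xi F i)) ∧
    (∀ i j, D.m i j = 6 →
      (L.Xi F j * L.Xi F i) ^ 3 - (L.Xi F i * L.Xi F j) ^ 3 =
        (4 * μ₂) • ((L.Xi F i * L.Xi F j) ^ 2 - (L.Xi F j * L.Xi F i) ^ 2) +
          (3 * μ₂ ^ 2) • (L.Xi F i * L.Xi F j - L.Xi F j * L.Xi F i)) ∧
    -- completeness of the relations
    ∃ e : L.PresentedAlgebra F μ₁ μ₂ ≃ₐ[R] L.affineDemazureAlgebra F,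
      (∀ γ, (e (L.presFGA F μ₁ μ₂ γ) : L.QW F) = L.ofFGA F γ) ∧
      (∀ i, (e (L.presX F μ₁ μ₂ i) : L.QW F) = L.Xi F i) := by
  refine ⟨fun α w i h => L.refl_eq α h,
    fun α => ⟨L.x_mem_nonZeroDivisors hF α, L.x_mul_demazureOp hF α⟩,
    L.affineDemazureAlgebra_eq, L.ofFGA_mul_X hF, L.Xi_sq hF,
    fun i j => L.Xi_rel_two, fun i j => L.Xi_rel_three hF, fun i j => L.Xi_rel_four hF,
    fun i j => L.Xi_rel_six hF,
    (AlgEquiv.ofInjective _ (L.presToQW_injective hF)).trans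
      (Subalgebra.equivOfEq _ _ (L.range_presToQW hF)),
    L.presToQW_presFGA hF, L.presToQW_presX hF⟩
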